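/- An instance of the Directed Waypoint Routing Problem (DWRP) consists of a directed graph $G=(V,E)$ with $m=|E|$ edges (loops and parallel edges are allowed), a set of waypoints $W\subseteq V$, edge weights $\omega\colon E\to\mathbb{N}$, edge capacities $\kappa\colon E\to\mathbb{N}$ and a budget $b\in\mathbb{N}$. A solution is a closed directed walk in $G$ of total weight at most $b$ that visits every vertex of $W$ and traverses each edge $e$ at most $\kappa(e)$ times; its number of edge occurrences is its length, i.e., edges are counted with multiplicity. As usual, $G$ is assumed to be strongly connected and $|W|\ge 2$. Theorem. There is a single deterministic algorithm that, given any such $m$-edge instance of DWRP and any $k\in\mathbb{N}$, decides in time $e^k\,4^k\,k^{O(\log k)}\cdot m\log m$ (up to an absolute multiplicative constant) whether the instance has a solution consisting of at most $k$ edge occurrences. Here time is the number of unit-cost instructions on a word RAM; if all numbers in the input (the numbers of vertices and edges, the vertex indices, weights, capacities, $b$ and $k$) have at most $L$ bits, then words of $O(k+L)$ bits suffice. -/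

import Mathlib

/-! ## The Directed Waypoint Routing Problem -/

/-- An instance of the Directed Waypoint Routing Problem: a directed graph with vertices
`0, …, n - 1` and edges `0, …, m - 1` (edge `e` goes from `src e` to `dst e`; loops and parallel
edges are allowed), a set of waypoints, edge weights, edge capacities and a budget. -/
structure DWRP where
  n : ℕ
  m : ℕ
  src : Fin m → Fin n
  dst : Fin m → Fin n
  waypoints : Finset (Fin n)
  weight : Fin m → ℕ
  capacity : Fin m → ℕ
  budget : ℕ

namespace DWRP

/-- `I.IsWalk u es v`: the list `es` of edge occurrences is a directed walk from `u` to `v`. -/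
def IsWalk (I : DWRP) : Fin I.n → List (Fin I.m) → Fin I.n → Prop
  | u, [], v => u = v
  | u, e :: es, v => I.src e = u ∧ I.IsWalk (I.dst e) es v

/-- Every vertex can be reached from every vertex. -/
def StronglyConnected (I : DWRP) : Prop :=
  ∀ u v : Fin I.n, ∃ es : List (Fin I.m), I.IsWalk u es v

/-- The closed walk that starts and ends in `u` and uses the edge occurrences `es`
is a solution of the instance. -/
structure IsSolution (I : DWRP) (u : Fin I.n) (es : List (Fin I.m)) : Prop where
  closed : I.IsWalk u es u
  visits : ∀ x ∈ I.waypoints, x = u ∨ ∃ e ∈ es, I.dst e = x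
  within_capacity : ∀ e : Fin I.m, es.count e ≤ I.capacity e
  within_budget : (es.map I.weight).sum ≤ I.budget

/-- There is a solution consisting of at most `k` edge occurrences. -/
def HasSolutionOfSize (I : DWRP) (k : ℕ) : Prop :=
  ∃ (u : Fin I.n) (es : List (Fin I.m)), I.IsSolution u es ∧ es.length ≤ k

/-- The sequence of numbers that describes the instance `I` together with the bound `k`:
the numbers `n`, `m`, `k` and the budget; tail, head, weight and capacity of every edge;
for every vertex one number that says whether it is a waypoint. -/
def encode (I : DWRP) (k : ℕ) : List ℕ :=
  [I.n, I.m, k, I.budget]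
    ++ (List.ofFn fun e : Fin I.m =>
        [(I.src e : ℕ), (I.dst e : ℕ), I.weight e, I.capacity e]).flatten
    ++ List.ofFn fun v : Fin I.n => if v ∈ I.waypoints then 1 else 0

end DWRP

/-! ## A word RAM with unit-cost instructions

The machine has registers and a random-access memory, both indexed by natural numbers, whose cells
hold words, that is, numbers below `2 ^ w` for the word length `w`. Programs are finite and do not
depend on `w`. There is no wrap-around: an instruction whose result does not fit
in a word cannot be executed. -/

namespace WordRAM

/-- Arithmetic instructions (subtraction is truncated at zero, division rounds down). -/
inductive Op
  | add
  | sub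
  | mul
  | div
  | mod

def Op.eval : Op → ℕ → ℕ → ℕ
  | .add, a, b => a + b
  | .sub, a, b => a - b
  | .mul, a, b => a * b
  | .div, a, b => a / b
  | .mod, a, b => a % b

/-- Comparisons of two registers. -/
inductive Test
  | lt (r s : ℕ)
  | eq (r s : ℕ)

inductive Program
  /-- do nothing -/
  | skip
  /-- register `r` receives the constant `a` -/
  | const (r a : ℕ)
  /-- register `r` receives the result of `o` on registers `s` and `t` -/
  | op (o : Op) (r s t : ℕ)
  /-- register `r` receives the content of the memory cell whose address is in register `s` -/
  | load (r s : ℕ)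
  /-- the memory cell whose address is in register `r` receives the content of register `s` -/
  | store (r s : ℕ)
  /-- first `P`, then `Q` -/
  | seq (P Q : Program)
  /-- if `b` then `P` else `Q` -/
  | ite (b : Test) (P Q : Program)
  /-- while `b` do `P` -/
  | loop (b : Test) (P : Program)

structure State where
  reg : ℕ → ℕ
  mem : ℕ → ℕ

def State.setReg (σ : State) (r a : ℕ) : State :=
  { σ with reg := Function.update σ.reg r a }

def State.setMem (σ : State) (i a : ℕ) : State :=
  { σ with mem := Function.update σ.mem i a }

def Test.holds : Test → State → Prop
  | .lt r s, σ => σ.reg r < σ.reg s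
  | .eq r s, σ => σ.reg r = σ.reg s

/-- `Exec w P σ t τ`: on a machine of word length `w`, the program `P` started in state `σ` halts
after exactly `t` steps in state `τ`. Each executed instruction and each evaluation of a test
is one step. -/
inductive Exec (w : ℕ) : Program → State → ℕ → State → Prop
  | skip {σ : State} : Exec w .skip σ 1 σ
  | const {σ : State} {r a : ℕ} (h : a < 2 ^ w) : Exec w (.const r a) σ 1 (σ.setReg r a)
  | op {σ : State} {o : Op} {r s t : ℕ} (h : o.eval (σ.reg s) (σ.reg t) < 2 ^ w) :
      Exec w (.op o r s t) σ 1 (σ.setReg r (o.eval (σ.reg s) (σ.reg t)))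
  | load {σ : State} {r s : ℕ} : Exec w (.load r s) σ 1 (σ.setReg r (σ.mem (σ.reg s)))
  | store {σ : State} {r s : ℕ} : Exec w (.store r s) σ 1 (σ.setMem (σ.reg r) (σ.reg s))
  | seq {P Q : Program} {σ τ υ : State} {t₁ t₂ : ℕ} (h₁ : Exec w P σ t₁ τ)
      (h₂ : Exec w Q τ t₂ υ) : Exec w (.seq P Q) σ (t₁ + t₂) υ
  | ite_true {b : Test} {P Q : Program} {σ τ : State} {t : ℕ} (hb : b.holds σ)
      (h : Exec w P σ t τ) : Exec w (.ite b P Q) σ (t + 1) τ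
  | ite_false {b : Test} {P Q : Program} {σ τ : State} {t : ℕ} (hb : ¬ b.holds σ)
      (h : Exec w Q σ t τ) : Exec w (.ite b P Q) σ (t + 1) τ
  | loop_true {b : Test} {P : Program} {σ τ υ : State} {t₁ t₂ : ℕ} (hb : b.holds σ)
      (h₁ : Exec w P σ t₁ τ) (h₂ : Exec w (.loop b P) τ t₂ υ) :
      Exec w (.loop b P) σ (t₁ + t₂ + 1) υ
  | loop_false {b : Test} {P : Program} {σ : State} (hb : ¬ b.holds σ) :
      Exec w (.loop b P) σ 1 σ

/-- The initial state: the input stands in the memory from address `0` on,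
all other cells and all registers are zero. -/
def initial (input : List ℕ) : State where
  reg := fun _ => 0
  mem := fun i => input.getD i 0

end WordRAM

/-! The method is derandomised colour coding on copies of edges. Give every edge `e` copies `(e, 0),
(e, 1), …`, where only indices below `k` and below the capacity of `e` may be used. A solution can
be rotated to start in a fixed waypoint, and if the occurrences of `e` use the copies `0, 1, …` in
turn, the solution uses at most `k` copies, all distinct. Suppose that a colouring gives them
different colours. Then the solution is found by dynamic programming over pairs of a vertex and a
mask; the mask records the colours used, the waypoints visited and, in its top part, the number of
steps. Conversely, a walk that never repeats a colour never repeats a copy and so respects the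
capacities. Hence every colouring gives sound answers (`Fits.hasSolution`), and only completeness
needs a good one (`exists_copies`). Masks strictly increase along a walk, so one pass through them
in increasing order computes all least weights (`Table.step_lower`, `Table.complete`). There are `t
= k + O(log k)` colours and at most `k` waypoints (more would need more than `k` edges), hence `4 ^
k * k ^ O(1)` masks; each of them costs `O(n + m * k)`, and strong connectivity gives `n ≤ m`.

It remains to list `e ^ k * k ^ O(log k) * log m` colourings, one of which is injective on any given
`k` copies. Two families of functions are built greedily by conditional expectations: values are
fixed one after another so that the weighted number of tuples on which the function is injective
never falls below its average (`le_sum_wt_update`, `total_le_of_best`, `Good.succ`).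

In the first family, from `Q` points to `K = 2 * k ^ 2` values with `Q` about the cube root of `m`,
the weight of a pair doubles at each collision. As the total weight grows slowly, every pair
collides in few functions (`Good.card_collisions_le`). Applied to the three base-`Q` digits of an
edge, some function is injective on any `k` edges (`Good.exists_hash_injOn`). The construction takes
time about `Q ^ 3`, which is why edges are cut into three digits.

This leaves `Kc = 8 * k ^ 7` names of copies. In the second family, tuples of length `s`, about `k /
(10 * log k)`, lose their weight once separated; about `e ^ s` functions up to polynomial factors
separate all of them (`Good.exists_injOn`). A colouring cuts the names into `10 * log k` intervals
and uses a function of the family, with private colours, on each of them (`exists_color_injOn`). All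
choices of cuts and functions number `e ^ k * k ^ O(log k)` (`D_pow_le`), whereas the short tuples
keep the construction within `4 ^ k * k ^ O(1)`.

Running times are proved in a small language of bounded loops, which is translated to the word RAM
with exact costs (`Cmd.exec_compile`). A `Spec` carries the time, the bound for all numbers and the
result at once. -/

set_option linter.constructorNameAsVariable false

/-! ## A language of bounded loops and its translation to the word RAM -/

namespace LoopLang

open WordRAM

/-- Program variables; each of them is kept in a register of its own. -/
inductive Var
  | out | n | m | k | b | q | w0 | lam | ell | s | Q | T | K | M | Kc | R | D | L | t | tot | full
  | gN | gs | gr | gR | gA | row | lim | j | x | z | a | i | i' | y | y' | cur | cur' | phi | wt | best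
  | bestz | sum | c | e | h | id | d | col | pw | Y | src | dst | wgt | cap | Y' | p | c' | num | v
  | base | expo | jj | two_u | two_t
  deriving DecidableEq

/-- Arrays; they are interleaved in the memory behind the input. -/
inductive Arr
  | wts | hashes | colors | code | wbit | dist
  deriving DecidableEq

/-- The register of a variable. -/
def Var.reg (x : Var) : ℕ := x.ctorIdx

/-- The register that holds the length of the input. -/
def lenReg : ℕ := 80

theorem Var.reg_lt (x : Var) : x.reg < lenReg := by
  cases x <;> decide

theorem Var.reg_injective : Function.Injective Var.reg := by
  intro x y h
  have hx : ∀ x : Var, Var.ofNat x.reg = x := fun x => by cases x <;> rfl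
  rw [← hx x, h, hx]

/-- The residue modulo `8` of the addresses of an array. -/
def Arr.num (A : Arr) : ℕ := A.ctorIdx

theorem Arr.num_lt (A : Arr) : A.num < 8 := by
  cases A <;> decide

theorem Arr.num_injective : Function.Injective Arr.num := by
  intro x y h
  cases x <;> cases y <;> first | rfl | exact absurd h (by decide)

structure St where
  reg : Var → ℕ
  arr : Arr → ℕ → ℕ
  inp : ℕ → ℕ

def St.set (σ : St) (x : Var) (a : ℕ) : St :=
  { σ with reg := fun y => if y = x then a else σ.reg y }

def St.put (σ : St) (A : Arr) (i a : ℕ) : St :=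
  { σ with arr := fun B => if B = A then Function.update (σ.arr A) i a else σ.arr B }

@[simp] theorem St.set_reg (σ : St) (x y : Var) (a : ℕ) :
    (σ.set x a).reg y = if y = x then a else σ.reg y := rfl
@[simp] theorem St.set_arr (σ : St) (x : Var) (a : ℕ) : (σ.set x a).arr = σ.arr := rfl
@[simp] theorem St.set_inp (σ : St) (x : Var) (a : ℕ) : (σ.set x a).inp = σ.inp := rfl
@[simp] theorem St.put_reg (σ : St) (A : Arr) (i a : ℕ) : (σ.put A i a).reg = σ.reg := rfl
@[simp] theorem St.put_arr (σ : St) (A B : Arr) (i a : ℕ) :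
    (σ.put A i a).arr B = if B = A then Function.update (σ.arr A) i a else σ.arr B := rfl
@[simp] theorem St.put_inp (σ : St) (A : Arr) (i a : ℕ) : (σ.put A i a).inp = σ.inp := rfl

/-! ### Expressions -/

inductive Exp
  | lit (a : ℕ)
  | var (x : Var)
  | bin (o : Op) (a b : Exp)
  | inp (e : Exp)
  | get (A : Arr) (e : Exp)

instance : Add Exp := ⟨Exp.bin .add⟩
instance : Sub Exp := ⟨Exp.bin .sub⟩
instance : Mul Exp := ⟨Exp.bin .mul⟩
instance : Div Exp := ⟨Exp.bin .div⟩
instance : Mod Exp := ⟨Exp.bin .mod⟩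
instance (a : ℕ) : OfNat Exp a := ⟨.lit a⟩

def Exp.eval (σ : St) : Exp → ℕ
  | .lit a => a
  | .var x => σ.reg x
  | .bin o a b => o.eval (a.eval σ) (b.eval σ)
  | .inp e => σ.inp (e.eval σ)
  | .get A e => σ.arr A (e.eval σ)

/-- The evaluation of an expression creates no numbers from `V` on by addition and
multiplication, and it stays inside the input of length `len`. -/
def Exp.Ok (V len : ℕ) (σ : St) : Exp → Prop
  | .lit _ => True
  | .var _ => True
  | .bin .add a b => a.Ok V len σ ∧ b.Ok V len σ ∧ a.eval σ + b.eval σ < V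
  | .bin .mul a b => a.Ok V len σ ∧ b.Ok V len σ ∧ a.eval σ * b.eval σ < V
  | .bin _ a b => a.Ok V len σ ∧ b.Ok V len σ
  | .inp e => e.Ok V len σ ∧ e.eval σ < len
  | .get _ e => e.Ok V len σ

def Exp.cost : Exp → ℕ
  | .lit _ => 1
  | .var _ => 2
  | .bin _ a b => a.cost + b.cost + 1
  | .inp e => e.cost + 1
  | .get _ e => e.cost + 6

/-- All literals of the expression are small. -/
def Exp.small : Exp → Bool
  | .lit a => a < 16
  | .var _ => true
  | .bin _ a b => a.small && b.small
  | .inp e => e.small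
  | .get _ e => e.small

section simp_lemmas

variable (σ : St) (V len : ℕ) (a b : Exp)

@[simp] theorem Exp.eval_add : (a + b).eval σ = a.eval σ + b.eval σ := rfl
@[simp] theorem Exp.eval_sub : (a - b).eval σ = a.eval σ - b.eval σ := rfl
@[simp] theorem Exp.eval_mul : (a * b).eval σ = a.eval σ * b.eval σ := rfl
@[simp] theorem Exp.eval_div : (a / b).eval σ = a.eval σ / b.eval σ := rfl
@[simp] theorem Exp.eval_mod : (a % b).eval σ = a.eval σ % b.eval σ := rfl
@[simp] theorem Exp.eval_zero : (0 : Exp).eval σ = 0 := rfl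
@[simp] theorem Exp.eval_one : (1 : Exp).eval σ = 1 := rfl
@[simp] theorem Exp.eval_lit (i : ℕ) : (Exp.lit i).eval σ = i := rfl
@[simp] theorem Exp.eval_var (x : Var) : (Exp.var x).eval σ = σ.reg x := rfl
@[simp] theorem Exp.eval_inp : (Exp.inp a).eval σ = σ.inp (a.eval σ) := rfl
@[simp] theorem Exp.eval_get (A : Arr) : (Exp.get A a).eval σ = σ.arr A (a.eval σ) := rfl
@[simp] theorem Exp.ok_add : (a + b).Ok V len σ ↔
    a.Ok V len σ ∧ b.Ok V len σ ∧ a.eval σ + b.eval σ < V := Iff.rfl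
@[simp] theorem Exp.ok_mul : (a * b).Ok V len σ ↔
    a.Ok V len σ ∧ b.Ok V len σ ∧ a.eval σ * b.eval σ < V := Iff.rfl
@[simp] theorem Exp.ok_sub : (a - b).Ok V len σ ↔ a.Ok V len σ ∧ b.Ok V len σ := Iff.rfl
@[simp] theorem Exp.ok_div : (a / b).Ok V len σ ↔ a.Ok V len σ ∧ b.Ok V len σ := Iff.rfl
@[simp] theorem Exp.ok_mod : (a % b).Ok V len σ ↔ a.Ok V len σ ∧ b.Ok V len σ := Iff.rfl
@[simp] theorem Exp.ok_zero : (0 : Exp).Ok V len σ ↔ True := Iff.rfl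
@[simp] theorem Exp.ok_one : (1 : Exp).Ok V len σ ↔ True := Iff.rfl
@[simp] theorem Exp.ok_lit (i : ℕ) : (Exp.lit i).Ok V len σ ↔ True := Iff.rfl
@[simp] theorem Exp.ok_var (x : Var) : (Exp.var x).Ok V len σ ↔ True := Iff.rfl
@[simp] theorem Exp.ok_inp : (Exp.inp a).Ok V len σ ↔ a.Ok V len σ ∧ a.eval σ < len := Iff.rfl
@[simp] theorem Exp.ok_get (A : Arr) : (Exp.get A a).Ok V len σ ↔ a.Ok V len σ := Iff.rfl
@[simp] theorem Exp.cost_add : (a + b).cost = a.cost + b.cost + 1 := rfl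
@[simp] theorem Exp.cost_sub : (a - b).cost = a.cost + b.cost + 1 := rfl
@[simp] theorem Exp.cost_mul : (a * b).cost = a.cost + b.cost + 1 := rfl
@[simp] theorem Exp.cost_div : (a / b).cost = a.cost + b.cost + 1 := rfl
@[simp] theorem Exp.cost_mod : (a % b).cost = a.cost + b.cost + 1 := rfl
@[simp] theorem Exp.cost_zero : (0 : Exp).cost = 1 := rfl
@[simp] theorem Exp.cost_one : (1 : Exp).cost = 1 := rfl
@[simp] theorem Exp.cost_lit (i : ℕ) : (Exp.lit i).cost = 1 := rfl
@[simp] theorem Exp.cost_var (x : Var) : (Exp.var x).cost = 2 := rfl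
@[simp] theorem Exp.cost_inp : (Exp.inp a).cost = a.cost + 1 := rfl
@[simp] theorem Exp.cost_get (A : Arr) : (Exp.get A a).cost = a.cost + 6 := rfl

end simp_lemmas

/-! ### Commands -/

inductive Cond
  | lt (a b : Exp)
  | eq (a b : Exp)

def Cond.holds (σ : St) : Cond → Prop
  | .lt a b => a.eval σ < b.eval σ
  | .eq a b => a.eval σ = b.eval σ

instance (σ : St) : (c : Cond) → Decidable (c.holds σ)
  | .lt a b => inferInstanceAs (Decidable (a.eval σ < b.eval σ))
  | .eq a b => inferInstanceAs (Decidable (a.eval σ = b.eval σ))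

def Cond.lhs : Cond → Exp
  | .lt a _ => a
  | .eq a _ => a

def Cond.rhs : Cond → Exp
  | .lt _ b => b
  | .eq _ b => b

@[simp] theorem Cond.holds_lt (σ : St) (a b : Exp) :
    (Cond.lt a b).holds σ ↔ a.eval σ < b.eval σ := Iff.rfl
@[simp] theorem Cond.holds_eq (σ : St) (a b : Exp) :
    (Cond.eq a b).holds σ ↔ a.eval σ = b.eval σ := Iff.rfl
@[simp] theorem Cond.lhs_lt (a b : Exp) : (Cond.lt a b).lhs = a := rfl
@[simp] theorem Cond.lhs_eq (a b : Exp) : (Cond.eq a b).lhs = a := rfl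
@[simp] theorem Cond.rhs_lt (a b : Exp) : (Cond.lt a b).rhs = b := rfl
@[simp] theorem Cond.rhs_eq (a b : Exp) : (Cond.eq a b).rhs = b := rfl

inductive Cmd
  | skip
  | set (x : Var) (e : Exp)
  | put (A : Arr) (i e : Exp)
  | seq (P Q : Cmd)
  | ite (c : Cond) (P Q : Cmd)
  /-- execute `P` for `x = 0, 1, …, e - 1`, where `e` is evaluated once at the start -/
  | rep (x : Var) (e : Exp) (P : Cmd)

infixr:60 " ;; " => Cmd.seq

/-- `iter f N σ` applies `f 0`, `f 1`, …, `f (N - 1)` to `σ`. -/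
def iter (f : ℕ → St → St) : ℕ → St → St
  | 0, σ => σ
  | N + 1, σ => f N (iter f N σ)

def Cmd.run : Cmd → St → St
  | .skip, σ => σ
  | .set x e, σ => σ.set x (e.eval σ)
  | .put A i e, σ => σ.put A (i.eval σ) (e.eval σ)
  | .seq P Q, σ => Q.run (P.run σ)
  | .ite c P Q, σ => if c.holds σ then P.run σ else Q.run σ
  | .rep x e P, σ => iter (fun j τ => P.run (τ.set x j)) (e.eval σ) σ

def Cmd.Ok (V len : ℕ) : Cmd → St → Prop
  | .skip, _ => True
  | .set _ e, σ => e.Ok V len σ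
  | .put _ i e, σ => i.Ok V len σ ∧ e.Ok V len σ
  | .seq P Q, σ => P.Ok V len σ ∧ Q.Ok V len (P.run σ)
  | .ite c P Q, σ => c.lhs.Ok V len σ ∧ c.rhs.Ok V len σ ∧
      if c.holds σ then P.Ok V len σ else Q.Ok V len σ
  | .rep x e P, σ => e.Ok V len σ ∧
      ∀ j < e.eval σ, P.Ok V len ((iter (fun j τ => P.run (τ.set x j)) j σ).set x j)

def Cmd.cost : Cmd → St → ℕ
  | .skip, _ => 1
  | .set _ e, _ => e.cost
  | .put _ i e, _ => i.cost + e.cost + 6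
  | .seq P Q, σ => P.cost σ + Q.cost (P.run σ)
  | .ite c P Q, σ => c.lhs.cost + c.rhs.cost + 1 + if c.holds σ then P.cost σ else Q.cost σ
  | .rep x e P, σ => e.cost + 2 + ∑ j ∈ Finset.range (e.eval σ),
      (P.cost ((iter (fun j τ => P.run (τ.set x j)) j σ).set x j) + 5)

def Cmd.small : Cmd → Bool
  | .skip => true
  | .set _ e => e.small
  | .put _ i e => i.small && e.small
  | .seq P Q => P.small && Q.small
  | .ite c P Q => c.lhs.small && c.rhs.small && P.small && Q.small
  | .rep _ e P => e.small && P.small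

/-! ### Translation -/

/-- The result goes to register `r`; the registers from `d` on are scratch. There is no move
instruction, so a variable is copied by adding zero. Entry `i` of the array `A` has the address `len
+ 8 * i + A.num`; with interleaved arrays no size has to be fixed in advance. -/
def Exp.compile : Exp → ℕ → ℕ → Program
  | .lit a, r, _ => .const r a
  | .var x, r, d => .seq (.const d 0) (.op .add r x.reg d)
  | .bin o a b, r, d =>
      .seq (.seq (a.compile d (d + 1)) (b.compile (d + 1) (d + 2))) (.op o r d (d + 1))
  | .inp e, r, d => .seq (e.compile d (d + 1)) (.load r d)
  | .get A e, r, d =>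
      .seq (e.compile d (d + 1)) (.seq (.const (d + 1) 8) (.seq (.op .mul d d (d + 1))
        (.seq (.op .add d d lenReg) (.seq (.const (d + 1) A.num) (.seq (.op .add d d (d + 1))
          (.load r d))))))

def Cond.test : Cond → ℕ → ℕ → Test
  | .lt _ _, r, s => .lt r s
  | .eq _ _, r, s => .eq r s

/-- The registers strictly between `lenReg` and `d` belong to the enclosing loops. A loop keeps its
counter in `d` and its bound in `d + 1` and copies the counter to the loop variable, so the body may
overwrite that variable and those in the bound. -/
def Cmd.compile : Cmd → ℕ → Program
  | .skip, _ => .skip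
  | .set x e, d => e.compile x.reg d
  | .put A i e, d =>
      .seq (i.compile d (d + 1)) (.seq (e.compile (d + 1) (d + 2))
        (.seq (.const (d + 2) 8) (.seq (.op .mul d d (d + 2))
        (.seq (.op .add d d lenReg) (.seq (.const (d + 2) A.num) (.seq (.op .add d d (d + 2))
          (.store d (d + 1))))))))
  | .seq P Q, d => .seq (P.compile d) (Q.compile d)
  | .ite c P Q, d =>
      .seq (c.lhs.compile d (d + 1)) (.seq (c.rhs.compile (d + 1) (d + 2))
        (.ite (c.test d (d + 1)) (P.compile d) (Q.compile d)))
  | .rep x e P, d =>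
      .seq (e.compile (d + 1) (d + 2)) (.seq (.const d 0) (.loop (.lt d (d + 1))
        (.seq (.const (d + 2) 0) (.seq (.op .add x.reg d (d + 2)) (.seq (P.compile (d + 2))
          (.seq (.const (d + 2) 1) (.op .add d d (d + 2))))))))

/-- All numbers of the state are below `V`. -/
structure St.Bdd (V len : ℕ) (σ : St) : Prop where
  reg : ∀ x, σ.reg x < V
  arr : ∀ A i, σ.arr A i < V
  inp : ∀ i < len, σ.inp i < V

/-- The state `ρ` of the machine represents the state `σ`. -/
structure Rep (len : ℕ) (ρ : State) (σ : St) : Prop where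
  reg : ∀ x : Var, ρ.reg x.reg = σ.reg x
  inp : ∀ i < len, ρ.mem i = σ.inp i
  arr : ∀ (A : Arr) (i : ℕ), ρ.mem (len + 8 * i + A.num) = σ.arr A i
  len : ρ.reg lenReg = len

/-- Subtraction, division and remainder never exceed their left operand, even for divisor zero, so
`Ok` has to restrict only sums and products. -/
theorem Exp.eval_lt {V len : ℕ} {σ : St} (hV : 16 ≤ V) (hσ : σ.Bdd V len) :
    ∀ {e : Exp}, e.small = true → e.Ok V len σ → e.eval σ < V
  | .lit a, hs, _ => by
      simp [Exp.small] at hs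
      simp [Exp.eval]; omega
  | .var x, _, _ => hσ.reg x
  | .bin o a b, hs, ho => by
      simp only [Exp.small, Bool.and_eq_true] at hs
      cases o
      · exact ho.2.2
      · exact lt_of_le_of_lt (Nat.sub_le _ _) (Exp.eval_lt hV hσ hs.1 ho.1)
      · exact ho.2.2
      · exact lt_of_le_of_lt (Nat.div_le_self _ _) (Exp.eval_lt hV hσ hs.1 ho.1)
      · exact lt_of_le_of_lt (Nat.mod_le _ _) (Exp.eval_lt hV hσ hs.1 ho.1)
  | .inp e, hs, ho => hσ.inp _ ho.2
  | .get A e, hs, ho => hσ.arr _ _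

theorem Rep.of_agree {len : ℕ} {ρ ρ' : State} {σ : St} (h : Rep len ρ σ)
    (hr : ∀ r ≤ lenReg, ρ'.reg r = ρ.reg r) (hm : ρ'.mem = ρ.mem) : Rep len ρ' σ where
  reg x := by rw [hr _ x.reg_lt.le, h.reg]
  len := by rw [hr _ le_rfl, h.len]
  inp i hi := by rw [hm, h.inp i hi]
  arr A i := by rw [hm, h.arr]

/-- The factor `16` makes room for addresses: `len + 8 * i + A.num` stays below `16 * V` as `len ≤
V`, `i < V` and `A.num < 8`. -/
theorem Exp.exec_compile {V len w : ℕ} {σ : St} (hV : 16 ≤ V) (hlen : len ≤ V)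
    (hw : 16 * V ≤ 2 ^ w) (hσ : σ.Bdd V len) :
    ∀ {e : Exp} {ρ : State} {r d : ℕ}, e.small = true → e.Ok V len σ → Rep len ρ σ → lenReg < d →
      r < d → ∃ ρ', Exec w (e.compile r d) ρ e.cost ρ' ∧ ρ'.reg r = e.eval σ ∧ ρ'.mem = ρ.mem ∧
        ∀ r' < d, r' ≠ r → ρ'.reg r' = ρ.reg r'
  | .lit a, ρ, r, d, hs, ho, hρ, hd, hr => by
      simp only [Exp.small, decide_eq_true_eq] at hs
      refine ⟨_, Exec.const (by omega), by simp [State.setReg, Exp.eval], rfl, ?_⟩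
      intro r' h1 h2
      simp [State.setReg, h2]
  | .var x, ρ, r, d, hs, ho, hρ, hd, hr => by
      have hx := x.reg_lt
      have hv := hσ.reg x
      have hρx := hρ.reg x
      have e1 : (ρ.setReg d 0).reg x.reg = σ.reg x := by
        rw [← hρx]; exact Function.update_of_ne (by omega) _ _
      have e2 : (ρ.setReg d 0).reg d = 0 := by simp [State.setReg]
      refine ⟨_, Exec.seq (Exec.const (by positivity)) (Exec.op ?_), ?_, rfl, ?_⟩
      · simp only [Op.eval, e1, e2]; omega
      · simp only [Op.eval, e1, e2]; simp [State.setReg, Exp.eval]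
      · intro r' h1 h2
        simp [State.setReg, h2, h1.ne]
  | .bin o a b, ρ, r, d, hs, ho, hρ, hd, hr => by
      have hev := Exp.eval_lt hV hσ hs ho
      simp only [Exp.small, Bool.and_eq_true] at hs
      have hoa : a.Ok V len σ := by cases o <;> exact ho.1
      have hob : b.Ok V len σ := by
        cases o
        · exact ho.2.1
        · exact ho.2
        · exact ho.2.1
        · exact ho.2
        · exact ho.2
      obtain ⟨ρ₁, x1, v1, m1, f1⟩ := Exp.exec_compile hV hlen hw hσ hs.1 hoa hρ
        (d := d + 1) (r := d) (by omega) (by omega)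
      obtain ⟨ρ₂, x2, v2, m2, f2⟩ := Exp.exec_compile hV hlen hw hσ hs.2 hob
        (hρ.of_agree (fun r' h => f1 r' (by omega) (by omega)) m1)
        (d := d + 2) (r := d + 1) (by omega) (by omega)
      have e1 : ρ₂.reg d = a.eval σ := by rw [f2 d (by omega) (by omega), v1]
      refine ⟨_, Exec.seq (Exec.seq x1 x2) (Exec.op ?_), ?_, ?_, ?_⟩
      · rw [e1, v2]
        simp only [Exp.eval] at hev
        omega
      · simp [State.setReg, e1, v2, Exp.eval]
      · simp [State.setReg, m1, m2]
      · intro r' h1 h2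
        simp only [State.setReg]
        rw [Function.update_of_ne h2, f2 r' (by omega) (by omega), f1 r' (by omega) (by omega)]
  | .inp e, ρ, r, d, hs, ho, hρ, hd, hr => by
      obtain ⟨ρ₁, x1, v1, m1, f1⟩ := Exp.exec_compile hV hlen hw hσ (e := e) hs ho.1 hρ
        (d := d + 1) (r := d) (by omega) (by omega)
      refine ⟨_, Exec.seq x1 Exec.load, ?_, m1, ?_⟩
      · simp [State.setReg, v1, m1, Exp.eval, hρ.inp _ ho.2]
      · intro r' h1 h2
        simp only [State.setReg]
        rw [Function.update_of_ne h2, f1 r' (by omega) (by omega)]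
  | .get A e, ρ, r, d, hs, ho, hρ, hd, hr => by
      obtain ⟨ρ₁, x1, v1, m1, f1⟩ := Exp.exec_compile hV hlen hw hσ (e := e) hs ho hρ
        (d := d + 1) (r := d) (by omega) (by omega)
      have hev := Exp.eval_lt hV hσ (e := e) hs ho
      have hl : ρ₁.reg lenReg = len := by rw [f1 _ (by omega) (by omega), hρ.len]
      have hA := A.num_lt
      have hld : lenReg ≠ d := by omega
      refine ⟨_, Exec.seq x1 (Exec.seq (Exec.const (by omega)) (Exec.seq (Exec.op ?_)
        (Exec.seq (Exec.op ?_) (Exec.seq (Exec.const (by omega)) (Exec.seq (Exec.op ?_)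
          Exec.load))))), ?_, m1, ?_⟩
      · simp [State.setReg, Op.eval, v1]; omega
      · have : lenReg ≠ d + 1 := by omega
        simp [State.setReg, Op.eval, v1, hl, hld, this]; omega
      · have : lenReg ≠ d + 1 := by omega
        simp [State.setReg, Op.eval, v1, hl, hld, this]; omega
      · have : lenReg ≠ d + 1 := by omega
        simp [State.setReg, Op.eval, v1, hl, hld, this, m1, Exp.eval, ← hρ.arr]
        congr 1; ring
      · intro r' h1 h2
        have : r' ≠ d := by omega
        have : r' ≠ d + 1 := by omega
        simp [State.setReg, *]
        exact f1 r' (by omega) (by omega)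

theorem Rep.set {len : ℕ} {ρ ρ' : State} {σ : St} (h : Rep len ρ σ) {x : Var} {a : ℕ}
    (hx : ρ'.reg x.reg = a) (hr : ∀ r ≤ lenReg, r ≠ x.reg → ρ'.reg r = ρ.reg r)
    (hm : ρ'.mem = ρ.mem) : Rep len ρ' (σ.set x a) where
  reg y := by
    by_cases hy : y = x
    · simp [hy, hx]
    · rw [hr _ y.reg_lt.le (fun h => hy (Var.reg_injective h)), h.reg]
      simp [hy]
  len := by rw [hr _ le_rfl x.reg_lt.ne', h.len]
  inp i hi := by rw [hm, h.inp i hi]; rfl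
  arr A i := by rw [hm, h.arr]; rfl

/-- The addresses of different arrays differ modulo `8` after subtracting `len`, and none of them
lies in the input. -/
theorem Rep.put {len : ℕ} {ρ : State} {σ : St} (h : Rep len ρ σ) (A : Arr) (i a : ℕ) :
    Rep len (ρ.setMem (len + 8 * i + A.num) a) (σ.put A i a) where
  reg y := h.reg y
  len := h.len
  inp j hj := by
    simp only [State.setMem]
    rw [Function.update_of_ne (by omega), h.inp j hj]; rfl
  arr B j := by
    have hA := A.num_lt
    have hB := B.num_lt
    simp only [State.setMem, St.put_arr]
    by_cases hBA : B = A
    · subst hBA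
      by_cases hj : j = i
      · simp [hj]
      · rw [Function.update_of_ne (by omega), h.arr]
        simp [hj]
    · have : B.num ≠ A.num := fun h => hBA (Arr.num_injective h)
      rw [Function.update_of_ne (by omega), h.arr]
      simp [hBA]

theorem St.Bdd.set {V len : ℕ} {σ : St} (h : σ.Bdd V len) (x : Var) {a : ℕ} (ha : a < V) :
    (σ.set x a).Bdd V len where
  reg y := by
    simp only [St.set_reg]; split_ifs
    · exact ha
    · exact h.reg y
  arr := h.arr
  inp := h.inp

theorem St.Bdd.put {V len : ℕ} {σ : St} (h : σ.Bdd V len) (A : Arr) (i : ℕ) {a : ℕ} (ha : a < V) :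
    (σ.put A i a).Bdd V len where
  reg := h.reg
  arr B j := by
    simp only [St.put_arr]; split_ifs
    · by_cases hj : j = i
      · simpa [hj] using ha
      · simpa [hj] using h.arr _ _
    · exact h.arr _ _
  inp := h.inp

theorem Cond.test_holds {ρ : State} {σ : St} {c : Cond} {r s : ℕ} (hr : ρ.reg r = c.lhs.eval σ)
    (hs : ρ.reg s = c.rhs.eval σ) : (c.test r s).holds ρ ↔ c.holds σ := by
  cases c <;> simp only [Cond.lhs, Cond.rhs] at hr hs <;>
    simp [Cond.test, Test.holds, Cond.holds, hr, hs]

theorem exec_op {w : ℕ} {ρ : State} {o : Op} {r s t v : ℕ} (h : o.eval (ρ.reg s) (ρ.reg t) = v)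
    (hv : v < 2 ^ w) : Exec w (.op o r s t) ρ 1 (ρ.setReg r v) := by
  subst h
  exact Exec.op hv

/-- Correctness of the translation. -/
theorem Cmd.exec_compile {V len w : ℕ} (hV : 16 ≤ V) (hlen : len ≤ V)
    (hw : 16 * V ≤ 2 ^ w) :
    ∀ {P : Cmd} {ρ : State} {σ : St} {d : ℕ}, P.small = true → P.Ok V len σ → σ.Bdd V len →
      Rep len ρ σ → lenReg < d → ∃ ρ', Exec w (P.compile d) ρ (P.cost σ) ρ' ∧
        Rep len ρ' (P.run σ) ∧ (P.run σ).Bdd V len ∧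
          ∀ r < d, lenReg < r → ρ'.reg r = ρ.reg r
  | .skip, ρ, σ, d, hs, ho, hb, hρ, hd => ⟨ρ, Exec.skip, hρ, hb, fun _ _ _ => rfl⟩
  | .set x e, ρ, σ, d, hs, ho, hb, hρ, hd => by
      have hx := x.reg_lt
      obtain ⟨ρ₁, x1, v1, m1, f1⟩ := Exp.exec_compile hV hlen hw hb (e := e) hs ho hρ
        (d := d) (r := x.reg) (by omega) (by omega)
      exact ⟨ρ₁, x1, hρ.set v1 (fun r hr h => f1 r (by omega) h) m1,
        hb.set x (Exp.eval_lt hV hb hs ho), fun r h1 h2 => f1 r h1 (by omega)⟩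
  | .put A i e, ρ, σ, d, hs, ho, hb, hρ, hd => by
      simp only [Cmd.small, Bool.and_eq_true] at hs
      obtain ⟨ρ₁, x1, v1, m1, f1⟩ := Exp.exec_compile hV hlen hw hb (e := i) hs.1 ho.1 hρ
        (d := d + 1) (r := d) (by omega) (by omega)
      obtain ⟨ρ₂, x2, v2, m2, f2⟩ := Exp.exec_compile hV hlen hw hb (e := e) hs.2 ho.2
        (hρ.of_agree (fun r' h => f1 r' (by omega) (by omega)) m1)
        (d := d + 2) (r := d + 1) (by omega) (by omega)
      have hevi := Exp.eval_lt hV hb hs.1 ho.1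
      have heve := Exp.eval_lt hV hb hs.2 ho.2
      have e1 : ρ₂.reg d = i.eval σ := by rw [f2 d (by omega) (by omega), v1]
      have hl : ρ₂.reg lenReg = len := by
        rw [f2 _ (by omega) (by omega), f1 _ (by omega) (by omega), hρ.len]
      have hA := A.num_lt
      have n1 : lenReg ≠ d := by omega
      have n2 : lenReg ≠ d + 2 := by omega
      have hρ₂ : Rep len ρ₂ σ := hρ.of_agree
        (fun r h => by rw [f2 r (by omega) (by omega), f1 r (by omega) (by omega)]) (m2.trans m1)
      have key : ∀ ρ₃ : State, ρ₃.mem = ρ₂.mem → (∀ r < d, ρ₃.reg r = ρ₂.reg r) →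
          ρ₃.reg d = len + 8 * i.eval σ + A.num → ρ₃.reg (d + 1) = e.eval σ →
          Rep len (ρ₃.setMem (ρ₃.reg d) (ρ₃.reg (d + 1))) (σ.put A (i.eval σ) (e.eval σ)) := by
        intro ρ₃ h1 h2 h3 h4
        rw [h3, h4]
        exact (hρ₂.of_agree (fun r h => h2 r (by omega)) h1).put A _ _
      refine ⟨_, ?_, key (((((ρ₂.setReg (d + 2) 8).setReg d (i.eval σ * 8)).setReg d
        (i.eval σ * 8 + len)).setReg (d + 2) A.num).setReg d (i.eval σ * 8 + len + A.num))
          ?_ ?_ ?_ ?_, hb.put A _ heve, ?_⟩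
      · have : (Cmd.put A i e).cost σ = i.cost + (e.cost + (1 + (1 + (1 + (1 + (1 + 1)))))) := by
          simp only [Cmd.cost]; omega
        rw [this]
        exact Exec.seq x1 (Exec.seq x2 (Exec.seq (Exec.const (by omega))
          (Exec.seq (exec_op (v := i.eval σ * 8) (by simp [State.setReg, Op.eval, e1]) (by omega))
          (Exec.seq (exec_op (v := i.eval σ * 8 + len)
            (by simp [State.setReg, Op.eval, hl, n1, n2]) (by omega))
          (Exec.seq (Exec.const (by omega))
          (Exec.seq (exec_op (v := i.eval σ * 8 + len + A.num)
            (by simp [State.setReg, Op.eval]) (by omega)) Exec.store))))))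
      · rfl
      · intro r hr
        have a1 : r ≠ d := by omega
        have a2 : r ≠ d + 2 := by omega
        simp [State.setReg, a1, a2]
      · simp [State.setReg]; ring
      · simp [State.setReg, v2]
      · intro r h1 h2
        have a1 : r ≠ d := by omega
        have a2 : r ≠ d + 2 := by omega
        have : ∀ (ρ : State) (x y : ℕ), (ρ.setMem x y).reg = ρ.reg := fun _ _ _ => rfl
        simp only [State.setReg, this, ne_eq, a1, not_false_eq_true,
          Function.update_of_ne, a2]
        rw [f2 r (by omega) (by omega), f1 r (by omega) (by omega)]
  | .seq P Q, ρ, σ, d, hs, ho, hb, hρ, hd => by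
      simp only [Cmd.small, Bool.and_eq_true] at hs
      obtain ⟨ρ₁, x1, r1, b1, f1⟩ := Cmd.exec_compile hV hlen hw hs.1 ho.1 hb hρ hd
      obtain ⟨ρ₂, x2, r2, b2, f2⟩ := Cmd.exec_compile hV hlen hw hs.2 ho.2 b1 r1 hd
      exact ⟨ρ₂, Exec.seq x1 x2, r2, b2, fun r h1 h2 => (f2 r h1 h2).trans (f1 r h1 h2)⟩
  | .ite c P Q, ρ, σ, d, hs, ho, hb, hρ, hd => by
      simp only [Cmd.small, Bool.and_eq_true] at hs
      obtain ⟨ρ₁, x1, v1, m1, f1⟩ := Exp.exec_compile hV hlen hw hb hs.1.1.1 ho.1 hρ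
        (d := d + 1) (r := d) (by omega) (by omega)
      obtain ⟨ρ₂, x2, v2, m2, f2⟩ := Exp.exec_compile hV hlen hw hb hs.1.1.2 ho.2.1
        (hρ.of_agree (fun r' h => f1 r' (by omega) (by omega)) m1)
        (d := d + 2) (r := d + 1) (by omega) (by omega)
      have e1 : ρ₂.reg d = c.lhs.eval σ := by rw [f2 d (by omega) (by omega), v1]
      have hρ₂ : Rep len ρ₂ σ := hρ.of_agree
        (fun r h => by rw [f2 r (by omega) (by omega), f1 r (by omega) (by omega)]) (m2.trans m1)
      have ht := Cond.test_holds e1 v2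
      have ho' := ho.2.2
      by_cases hc : c.holds σ
      · rw [if_pos hc] at ho'
        obtain ⟨ρ₃, x3, r3, b3, f3⟩ := Cmd.exec_compile hV hlen hw hs.1.2 ho' hb hρ₂ hd
        refine ⟨ρ₃, ?_, ?_, ?_, ?_⟩
        · have : (Cmd.ite c P Q).cost σ = c.lhs.cost + (c.rhs.cost + (P.cost σ + 1)) := by
            simp only [Cmd.cost, if_pos hc]; omega
          rw [this]
          exact Exec.seq x1 (Exec.seq x2 (Exec.ite_true (ht.2 hc) x3))
        · simpa only [Cmd.run, if_pos hc] using r3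
        · simpa only [Cmd.run, if_pos hc] using b3
        · intro r h1 h2
          rw [f3 r h1 h2, f2 r (by omega) (by omega), f1 r (by omega) (by omega)]
      · rw [if_neg hc] at ho'
        obtain ⟨ρ₃, x3, r3, b3, f3⟩ := Cmd.exec_compile hV hlen hw hs.2 ho' hb hρ₂ hd
        refine ⟨ρ₃, ?_, ?_, ?_, ?_⟩
        · have : (Cmd.ite c P Q).cost σ = c.lhs.cost + (c.rhs.cost + (Q.cost σ + 1)) := by
            simp only [Cmd.cost, if_neg hc]; omega
          rw [this]
          exact Exec.seq x1 (Exec.seq x2 (Exec.ite_false (fun h => hc (ht.1 h)) x3))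
        · simpa only [Cmd.run, if_neg hc] using r3
        · simpa only [Cmd.run, if_neg hc] using b3
        · intro r h1 h2
          rw [f3 r h1 h2, f2 r (by omega) (by omega), f1 r (by omega) (by omega)]
  | .rep x e P, ρ, σ, d, hs, ho, hb, hρ, hd => by
      simp only [Cmd.small, Bool.and_eq_true] at hs
      obtain ⟨ρ₁, x1, v1, m1, f1⟩ := Exp.exec_compile hV hlen hw hb hs.1 ho.1 hρ
        (d := d + 2) (r := d + 1) (by omega) (by omega)
      have hN := Exp.eval_lt hV hb hs.1 ho.1
      set N := e.eval σ with hNdef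
      set g := fun j τ => P.run (St.set τ x j) with hg
      have hxr := x.reg_lt
      -- the remaining iterations
      have loop : ∀ l j, l + j = N → ∀ ρ₂ : State, Rep len ρ₂ (iter g j σ) →
          (iter g j σ).Bdd V len → ρ₂.reg d = j → ρ₂.reg (d + 1) = N →
          ∃ ρ', Exec w (.loop (.lt d (d + 1))
            (.seq (.const (d + 2) 0) (.seq (.op .add x.reg d (d + 2)) (.seq (P.compile (d + 2))
              (.seq (.const (d + 2) 1) (.op .add d d (d + 2)))))))
            ρ₂ (1 + ∑ j' ∈ Finset.Ico j N, (P.cost ((iter g j' σ).set x j') + 5)) ρ' ∧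
            Rep len ρ' (iter g N σ) ∧ (iter g N σ).Bdd V len ∧
            ∀ r < d, lenReg < r → ρ'.reg r = ρ₂.reg r := by
        intro l
        induction l with
        | zero =>
          intro j hj ρ₂ h1 h2 h3 h4
          obtain rfl : j = N := by omega
          refine ⟨ρ₂, ?_, h1, h2, fun _ _ _ => rfl⟩
          simp only [Finset.Ico_self, Finset.sum_empty, add_zero]
          exact Exec.loop_false (by simp [Test.holds, h3, h4])
        | succ l ih =>
          intro j hj ρ₂ h1 h2 h3 h4
          have hjN : j < N := by omega
          have n1 : x.reg ≠ d := by omega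
          have n2 : x.reg ≠ d + 1 := by omega
          have n3 : x.reg ≠ d + 2 := by omega
          have hrep : Rep len ((ρ₂.setReg (d + 2) 0).setReg x.reg j) ((iter g j σ).set x j) := by
            refine h1.set (by simp [State.setReg]) (fun r hr hrx => ?_) rfl
            have : r ≠ d + 2 := by omega
            simp [State.setReg, hrx, this]
          obtain ⟨ρ₃, x3, r3, b3, f3⟩ := Cmd.exec_compile hV hlen hw hs.2 (ho.2 j hjN)
            (h2.set x (by omega)) hrep (d := d + 2) (by omega)
          have e3 : ρ₃.reg d = j := by
            rw [f3 d (by omega) (by omega)]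
            simp [State.setReg, n1.symm, h3]
          have e4 : ρ₃.reg (d + 1) = N := by
            rw [f3 (d + 1) (by omega) (by omega)]
            simp [State.setReg, n2.symm, h4]
          obtain ⟨ρ₄, x4, r4, b4, f4⟩ := ih (j + 1) (by omega)
            ((ρ₃.setReg (d + 2) 1).setReg d (j + 1))
            (r3.of_agree (fun r hr => by
              have : r ≠ d := by omega
              have : r ≠ d + 2 := by omega
              simp [State.setReg, *]) rfl) b3 (by simp [State.setReg])
              (by simp [State.setReg, e4])
          refine ⟨ρ₄, ?_, r4, b4, ?_⟩
          · rw [Finset.sum_eq_sum_Ico_succ_bot hjN]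
            have hb : (Test.lt d (d + 1)).holds ρ₂ := by simp [Test.holds, h3, h4, hjN]
            -- Four bookkeeping instructions surround the body; with the test of the loop they are
            -- the `5` in `Cmd.cost`.
            have body : Exec w (.seq (.const (d + 2) 0) (.seq (.op .add x.reg d (d + 2))
                (.seq (P.compile (d + 2)) (.seq (.const (d + 2) 1) (.op .add d d (d + 2))))))
                ρ₂ (1 + (1 + (P.cost ((iter g j σ).set x j) + (1 + 1))))
                ((ρ₃.setReg (d + 2) 1).setReg d (j + 1)) := by
              refine Exec.seq (Exec.const (by positivity)) (Exec.seq ?_ (Exec.seq x3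
                (Exec.seq (Exec.const (by omega)) ?_)))
              · exact exec_op (by simp [State.setReg, Op.eval, h3]) (by omega)
              · exact exec_op (by simp [State.setReg, Op.eval, e3]) (by omega)
            convert Exec.loop_true hb body x4 using 1
            omega
          · intro r h1 h2
            have a1 : r ≠ d := by omega
            have a2 : r ≠ d + 2 := by omega
            have a3 : r ≠ x.reg := by omega
            rw [f4 r h1 h2]
            simp only [State.setReg, ne_eq, a1, not_false_eq_true, Function.update_of_ne, a2]
            rw [f3 r (by omega) h2]
            simp [State.setReg, a2, a3]
      obtain ⟨ρ₂, x2, r2, b2, f2⟩ := loop N 0 (by omega) (ρ₁.setReg d 0)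
        ((hρ.of_agree (fun r h => f1 r (by omega) (by omega)) m1).of_agree (fun r hr => by
              have : r ≠ d := by omega
              simp [State.setReg, *]) rfl) hb (by simp [State.setReg])
              (by simp [State.setReg, v1])
      refine ⟨ρ₂, ?_, r2, b2, ?_⟩
      · have : (Cmd.rep x e P).cost σ = e.cost + (1 + (1 + ∑ j' ∈ Finset.Ico 0 N,
            (P.cost ((iter g j' σ).set x j') + 5))) := by
          simp only [Cmd.cost, Finset.range_eq_Ico, ← hNdef, ← hg]
          omega
        rw [this]
        exact Exec.seq x1 (Exec.seq (Exec.const (by positivity)) x2)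
      · intro r h1 h2
        rw [f2 r h1 h2]
        have a1 : r ≠ d := by omega
        simp only [State.setReg, ne_eq, a1, not_false_eq_true, Function.update_of_ne]
        exact f1 r (by omega) (by omega)

/-! ### Running a translated command on an input -/

/-- Stores the length of the encoded instance in the register `lenReg`. -/
def loadLength : Program :=
  .seq (.const 81 1) (.seq (.load 82 81) (.seq (.const 83 4) (.seq (.op .mul 82 82 83)
    (.seq (.op .add 82 82 83) (.seq (.const 84 0) (.seq (.load 85 84) (.op .add 80 82 85)))))))

def St.initial (input : List ℕ) : St where
  reg _ := 0
  arr _ _ := 0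
  inp i := input.getD i 0

/-- The length of the input is not given, but `hl` recovers it from the first two numbers;
`loadLength` does so in 8 steps. The registers above `lenReg` that it spoils represent nothing. -/
theorem exec_initial {V w : ℕ} {input : List ℕ} {P : Cmd} (hV : 16 ≤ V) (hlen : input.length ≤ V)
    (hw : 16 * V ≤ 2 ^ w) (hinput : ∀ x ∈ input, x < V)
    (hl : 4 + 4 * input.getD 1 0 + input.getD 0 0 = input.length) (hP : P.small = true)
    (hok : P.Ok V input.length (St.initial input)) :
    ∃ τ, Exec w (.seq loadLength (P.compile 81)) (WordRAM.initial input)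
      (8 + P.cost (St.initial input)) τ ∧ τ.reg 0 = (P.run (St.initial input)).reg .out := by
  obtain ⟨ρ, x1, l1, m1, r1⟩ : ∃ ρ, Exec w loadLength (WordRAM.initial input) 8 ρ ∧
      ρ.reg 80 = input.length ∧ ρ.mem = (WordRAM.initial input).mem ∧ ∀ r < 80, ρ.reg r = 0 := by
    have hm : (WordRAM.initial input).mem 1 = input.getD 1 0 := rfl
    have hn : (WordRAM.initial input).mem 0 = input.getD 0 0 := rfl
    refine ⟨_, Exec.seq (Exec.const (by omega)) (Exec.seq Exec.load (Exec.seq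
      (Exec.const (by omega)) (Exec.seq
      (exec_op (v := input.getD 1 0 * 4) ?_ (by omega)) (Exec.seq
      (exec_op (v := input.getD 1 0 * 4 + 4) ?_ (by omega)) (Exec.seq (Exec.const (by omega))
      (Exec.seq Exec.load (exec_op (v := input.length) ?_ (by omega)))))))), ?_, ?_, ?_⟩
    · simp [State.setReg, Op.eval, hm]
    · simp [State.setReg, Op.eval]
    · simp [State.setReg, Op.eval, hn]; simp at hl; omega
    · simp [State.setReg]
    · rfl
    · intro r hr
      have h1 : r ≠ 80 := by omega
      have h2 : r ≠ 81 := by omega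
      have h3 : r ≠ 82 := by omega
      have h4 : r ≠ 83 := by omega
      have h5 : r ≠ 84 := by omega
      have h6 : r ≠ 85 := by omega
      simp [State.setReg, *]
      rfl
  have hrep : Rep input.length ρ (St.initial input) :=
    { reg := fun x => r1 _ x.reg_lt
      len := l1
      inp := fun i hi => by rw [m1]; rfl
      arr := fun A i => by
        rw [m1]
        exact List.getD_eq_default _ _ (by omega) }
  have hb : (St.initial input).Bdd V input.length :=
    { reg := fun _ => by change 0 < V; omega
      arr := fun _ _ => by change 0 < V; omega
      inp := fun i hi => by
        change input.getD i 0 < V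
        rw [List.getD_eq_getElem _ _ hi]
        exact hinput _ (List.getElem_mem hi) }
  obtain ⟨ρ', x2, r2, -, -⟩ := Cmd.exec_compile hV hlen hw hP hok hb hrep (d := 81) (by decide)
  exact ⟨ρ', Exec.seq x1 x2, r2.reg .out⟩

/-! ### Frame rule -/

def Cmd.writes : Cmd → Var → Bool
  | .skip, _ => false
  | .set x _, y => x = y
  | .put _ _ _, _ => false
  | .seq P Q, y => P.writes y || Q.writes y
  | .ite _ P Q, y => P.writes y || Q.writes y
  | .rep x _ P, y => x = y || P.writes y

def Cmd.stores : Cmd → Arr → Bool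
  | .skip, _ => false
  | .set _ _, _ => false
  | .put A _ _, B => A = B
  | .seq P Q, B => P.stores B || Q.stores B
  | .ite _ P Q, B => P.stores B || Q.stores B
  | .rep _ _ P, B => P.stores B

/-- `τ` differs from `σ` at most in variables and arrays that `P` changes. -/
structure Frame (P : Cmd) (σ τ : St) : Prop where
  reg : ∀ x, P.writes x = false → τ.reg x = σ.reg x
  arr : ∀ A, P.stores A = false → τ.arr A = σ.arr A
  inp : τ.inp = σ.inp

theorem Frame.refl (P : Cmd) (σ : St) : Frame P σ σ := ⟨fun _ _ => rfl, fun _ _ => rfl, rfl⟩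

theorem Frame.trans {P : Cmd} {σ τ υ : St} (h : Frame P σ τ) (h' : Frame P τ υ) : Frame P σ υ :=
  ⟨fun x hx => (h'.reg x hx).trans (h.reg x hx), fun A hA => (h'.arr A hA).trans (h.arr A hA),
    h'.inp.trans h.inp⟩

theorem Frame.mono {P Q : Cmd} {σ τ : St} (h : Frame P σ τ)
    (hw : ∀ x, Q.writes x = false → P.writes x = false)
    (hs : ∀ A, Q.stores A = false → P.stores A = false) : Frame Q σ τ :=
  ⟨fun x hx => h.reg x (hw x hx), fun A hA => h.arr A (hs A hA), h.inp⟩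

theorem Cmd.frame_run : ∀ (P : Cmd) (σ : St), Frame P σ (P.run σ)
  | .skip, σ => Frame.refl _ _
  | .set x e, σ => ⟨fun y hy => by
      have : y ≠ x := by rintro rfl; simp [Cmd.writes] at hy
      simp [Cmd.run, this], fun _ _ => rfl, rfl⟩
  | .put A i e, σ => ⟨fun y hy => rfl, fun B hB => by
      have : B ≠ A := by rintro rfl; simp [Cmd.stores] at hB
      simp [Cmd.run, this], rfl⟩
  | .seq P Q, σ =>
      ((P.frame_run σ).mono (fun x hx => by simp_all [Cmd.writes])
        (fun x hx => by simp_all [Cmd.stores])).trans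
      ((Q.frame_run _).mono (fun x hx => by simp_all [Cmd.writes])
        (fun x hx => by simp_all [Cmd.stores]))
  | .ite c P Q, σ => by
      simp only [Cmd.run]
      split_ifs
      · exact (P.frame_run σ).mono (fun x hx => by simp_all [Cmd.writes])
          (fun x hx => by simp_all [Cmd.stores])
      · exact (Q.frame_run σ).mono (fun x hx => by simp_all [Cmd.writes])
          (fun x hx => by simp_all [Cmd.stores])
  | .rep x e P, σ => by
      simp only [Cmd.run]
      induction e.eval σ with
      | zero => exact Frame.refl _ _
      | succ N ih =>
        refine ih.trans ?_
        simp only [iter]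
        have h1 : ∀ τ : St, Frame (.rep x e P) τ (τ.set x N) := fun τ => ⟨fun y hy => by
          have : y ≠ x := by rintro rfl; simp [Cmd.writes] at hy
          simp [this], fun _ _ => rfl, rfl⟩
        exact (h1 _).trans ((P.frame_run _).mono (fun x hx => by simp_all [Cmd.writes])
          (fun x hx => by simp_all [Cmd.stores]))

/-! ### Specifications -/

/-- Started in `σ`, the command `P` takes time at most `t`, creates no numbers from `V` on, reads
the input of length `len` only, and establishes `post`. -/
def Spec (V len : ℕ) (P : Cmd) (t : ℕ) (σ : St) (post : St → Prop) : Prop :=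
  P.Ok V len σ ∧ P.cost σ ≤ t ∧ post (P.run σ)

theorem Spec.mono {V len : ℕ} {P : Cmd} {t t' : ℕ} {σ : St} {post post' : St → Prop}
    (h : Spec V len P t σ post) (ht : t ≤ t') (hpost : ∀ τ, Frame P σ τ → post τ → post' τ) :
    Spec V len P t' σ post' :=
  ⟨h.1, h.2.1.trans ht, hpost _ (P.frame_run σ) h.2.2⟩

theorem Spec.le {V len : ℕ} {P : Cmd} {t t' : ℕ} {σ : St} {post : St → Prop}
    (h : Spec V len P t σ post) (ht : t ≤ t') : Spec V len P t' σ post :=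
  h.mono ht fun _ _ h => h

theorem Spec.seq {V len : ℕ} {P Q : Cmd} {t₁ t₂ t : ℕ} {σ : St} {mid post : St → Prop}
    (h₁ : Spec V len P t₁ σ mid)
    (h₂ : ∀ τ, Frame P σ τ → mid τ → Spec V len Q t₂ τ post) (ht : t₁ + t₂ ≤ t) :
    Spec V len (P ;; Q) t σ post := by
  have h := h₂ _ (P.frame_run σ) h₁.2.2
  refine ⟨⟨h₁.1, h.1⟩, ?_, h.2.2⟩
  have := h₁.2.1
  have := h.2.1
  simp only [Cmd.cost]
  omega

theorem Spec.ite {V len : ℕ} {c : Cond} {P Q : Cmd} {t t' : ℕ} {σ : St} {post : St → Prop}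
    (hl : c.lhs.Ok V len σ) (hr : c.rhs.Ok V len σ) (h₁ : c.holds σ → Spec V len P t σ post)
    (h₂ : ¬ c.holds σ → Spec V len Q t σ post) (ht : c.lhs.cost + c.rhs.cost + 1 + t ≤ t') :
    Spec V len (.ite c P Q) t' σ post := by
  by_cases h : c.holds σ
  · have := h₁ h
    refine ⟨⟨hl, hr, by rw [if_pos h]; exact this.1⟩, ?_, by simpa [Cmd.run, h] using this.2.2⟩
    have := this.2.1
    simp only [Cmd.cost, if_pos h]
    omega
  · have := h₂ h
    refine ⟨⟨hl, hr, by rw [if_neg h]; exact this.1⟩, ?_, by simpa [Cmd.run, h] using this.2.2⟩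
    have := this.2.1
    simp only [Cmd.cost, if_neg h]
    omega

/-- The rule for loops with the invariant `I`. -/
theorem Spec.rep {V len : ℕ} {x : Var} {e : Exp} {P : Cmd} {t t' N : ℕ} {σ : St}
    {post : St → Prop} (I : ℕ → St → Prop) (he : e.Ok V len σ) (hN : e.eval σ = N) (h0 : I 0 σ)
    (hstep : ∀ j < N, ∀ τ, Frame (.rep x e P) σ τ → I j τ →
      Spec V len P t (τ.set x j) (I (j + 1)))
    (hpost : ∀ τ, Frame (.rep x e P) σ τ → I N τ → post τ)
    (ht : N * (t + 5) + e.cost + 2 ≤ t') :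
    Spec V len (.rep x e P) t' σ post := by
  subst hN
  set g := fun j τ => P.run (St.set τ x j) with hg
  have hfr : ∀ j, Frame (.rep x e P) σ (iter g j σ) := by
    intro j
    -- What may change depends on `x` and `P` only, so the first `j` rounds can be viewed as a loop
    -- with the literal bound `j`.
    have := (Cmd.rep x (.lit j) P).frame_run σ
    exact ⟨this.1, this.2, this.3⟩
  have hI : ∀ j ≤ e.eval σ, I j (iter g j σ) := by
    intro j
    induction j with
    | zero => intro _; exact h0
    | succ j ih =>
      intro hj
      exact (hstep j hj _ (hfr j) (ih (by omega))).2.2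
  refine ⟨⟨he, fun j hj => (hstep j hj _ (hfr j) (hI j hj.le)).1⟩, ?_, hpost _ (hfr _) (hI _ le_rfl)⟩
  have : ∑ j ∈ Finset.range (e.eval σ), (P.cost ((iter g j σ).set x j) + 5)
      ≤ ∑ j ∈ Finset.range (e.eval σ), (t + 5) := by
    refine Finset.sum_le_sum fun j hj => ?_
    have := (hstep j (Finset.mem_range.1 hj) _ (hfr j) (hI j (Finset.mem_range.1 hj).le)).2.1
    omega
  simp only [Finset.sum_const, Finset.card_range, smul_eq_mul] at this
  simp only [Cmd.cost, ← hg]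
  omega

/-- The command contains no loop. -/
def Cmd.flat : Cmd → Bool
  | .skip => true
  | .set _ _ => true
  | .put _ _ _ => true
  | .seq P Q => P.flat && Q.flat
  | .ite _ P Q => P.flat && Q.flat
  | .rep _ _ _ => false

/-- A bound for the time of a command without loops. -/
def Cmd.flatCost : Cmd → ℕ
  | .skip => 1
  | .set _ e => e.cost
  | .put _ i e => i.cost + e.cost + 6
  | .seq P Q => P.flatCost + Q.flatCost
  | .ite c P Q => c.lhs.cost + c.rhs.cost + 1 + max P.flatCost Q.flatCost
  | .rep _ _ _ => 0

theorem Cmd.cost_le_flatCost : ∀ (P : Cmd) (σ : St), P.flat = true → P.cost σ ≤ P.flatCost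
  | .skip, _, _ => le_rfl
  | .set _ _, _, _ => le_rfl
  | .put _ _ _, _, _ => le_rfl
  | .seq P Q, σ, h => by
      simp only [Cmd.flat, Bool.and_eq_true] at h
      exact add_le_add (P.cost_le_flatCost _ h.1) (Q.cost_le_flatCost _ h.2)
  | .ite c P Q, σ, h => by
      simp only [Cmd.flat, Bool.and_eq_true] at h
      have h1 := P.cost_le_flatCost σ h.1
      have h2 := Q.cost_le_flatCost σ h.2
      simp only [Cmd.cost, Cmd.flatCost]
      split_ifs <;> omega
  | .rep _ _ _, _, h => by simp [Cmd.flat] at h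

/-- Without loops the time is bounded by a number that does not depend on the state, so the bound
`hc` can be checked by evaluation. -/
theorem Spec.flat {V len : ℕ} {P : Cmd} (c : ℕ) {t : ℕ} {σ : St} {post : St → Prop}
    (hP : P.flat = true) (hc : P.flatCost ≤ c) (ht : c ≤ t) (hok : P.Ok V len σ)
    (hpost : post (P.run σ)) : Spec V len P t σ post :=
  ⟨hok, (P.cost_le_flatCost σ hP).trans (hc.trans ht), hpost⟩

theorem Spec.flat_seq {V len : ℕ} {P Q : Cmd} {c t₂ t : ℕ} {σ : St} {post : St → Prop}
    (hP : P.flat = true) (hc : P.flatCost ≤ c) (hok : P.Ok V len σ)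
    (h : ∀ τ, τ = P.run σ → Frame P σ τ → Spec V len Q t₂ τ post) (ht : c + t₂ ≤ t) :
    Spec V len (P ;; Q) t σ post :=
  Spec.seq (mid := fun τ => τ = P.run σ) (Spec.flat c hP hc le_rfl hok rfl) (fun τ fr hτ => h τ hτ fr) ht

/-! ### Values of several variables -/

/-- The variables in `l` have the values given there. -/
def St.Has (σ : St) (l : List (Var × ℕ)) : Prop := ∀ p ∈ l, σ.reg p.1 = p.2

theorem St.Has.frame {σ τ : St} {l : List (Var × ℕ)} {P : Cmd} (h : σ.Has l) (hfr : Frame P σ τ)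
    (hP : (l.all fun p => !P.writes p.1) = true) : τ.Has l := by
  intro p hp
  rw [List.all_eq_true] at hP
  rw [hfr.reg p.1 (by simpa using hP p hp), h p hp]

theorem St.Has.set {σ : St} {l : List (Var × ℕ)} {x : Var} {a : ℕ} (h : σ.Has l)
    (hx : (l.all fun p => !decide (p.1 = x)) = true) : (σ.set x a).Has l := by
  intro p hp
  rw [List.all_eq_true] at hx
  have : p.1 ≠ x := by simpa using hx p hp
  simp [this, h p hp]

theorem St.Has.cons {σ : St} {l : List (Var × ℕ)} {x : Var} {a : ℕ} (h : σ.Has l)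
    (hx : σ.reg x = a) : σ.Has ((x, a) :: l) := by
  intro p hp
  rcases List.mem_cons.1 hp with rfl | hp
  · exact hx
  · exact h p hp

end LoopLang

/-! ## Greedy construction of hash families -/

namespace HashFamily

open Finset

/-- The `i`-th digit of `a` in base `N`. -/
def dig (N a i : ℕ) : ℕ := a / N ^ i % N

/-- The `s` digits of `a` are strictly increasing. -/
def Increasing (N s a : ℕ) : Prop := ∀ i, i + 1 < s → dig N a i < dig N a (i + 1)

instance (N s a : ℕ) : Decidable (Increasing N s a) :=
  decidable_of_iff (∀ i < s, i + 1 < s → dig N a i < dig N a (i + 1))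
    ⟨fun h i hi => h i (by omega) hi, fun h i _ hi => h i hi⟩

/-- `r` times the conditional probability that the `i`-th digit of `a` gets another value than the
digits before it, if the values of `f` from `lim` on are random. -/
def phi (N r : ℕ) (f : ℕ → ℕ) (lim a i : ℕ) : ℕ :=
  if dig N a i < lim then (if ∃ i' < i, f (dig N a i') = f (dig N a i) then 0 else r) else r - i

/-- `r ^ s` times the conditional probability that `f` is injective on the digits of `a`. -/
def wt (N s r : ℕ) (f : ℕ → ℕ) (lim a : ℕ) : ℕ := ∏ i ∈ range s, phi N r f lim a i

/-- The weight of `a` after `j` rounds. -/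
def weights (N s r α β : ℕ) (f : ℕ → ℕ → ℕ) : ℕ → ℕ → ℕ
  | 0, a => if Increasing N s a then 1 else 0
  | j + 1, a => weights N s r α β f j a * if wt N s r (f j) N a = 0 then β else α

/-- Every function of the family is at least as good as a random function. -/
def Good (N s r α β : ℕ) (f : ℕ → ℕ → ℕ) (R : ℕ) : Prop :=
  ∀ j < R, (∀ x < N, f j x < r) ∧
    r.descFactorial s * ∑ a ∈ range (N ^ s), weights N s r α β f j a ≤
      r ^ s * ∑ a ∈ range (N ^ s), if wt N s r (f j) N a = 0 then 0 else weights N s r α β f j a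

variable {N s r α β : ℕ}

theorem Increasing.lt {a : ℕ} (h : Increasing N s a) {i j : ℕ} (hij : i < j) (hj : j < s) :
    dig N a i < dig N a j := by
  induction j, hij using Nat.le_induction with
  | base => exact h i hj
  | succ j hij ih => exact (ih (by omega)).trans (h j hj)

theorem phi_le (f : ℕ → ℕ) (lim a i : ℕ) : phi N r f lim a i ≤ r := by
  unfold phi
  split_ifs <;> omega

theorem wt_le (f : ℕ → ℕ) (lim a : ℕ) : wt N s r f lim a ≤ r ^ s := by
  calc wt N s r f lim a ≤ ∏ i ∈ range s, r := prod_le_prod' fun i _ => phi_le f lim a i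
    _ = r ^ s := by simp

theorem wt_zero (f : ℕ → ℕ) (a : ℕ) : wt N s r f 0 a = r.descFactorial s := by
  simp [wt, phi, Nat.descFactorial_eq_prod_range]

/-- As the digits increase, all digits before one below `lim` are below `lim` as well, so only the
part of `f` that is already fixed is consulted. -/
theorem phi_congr {f g : ℕ → ℕ} {lim a i : ℕ} (hinc : Increasing N s a) (hi : i < s)
    (h : ∀ x < lim, f x = g x) : phi N r f lim a i = phi N r g lim a i := by
  unfold phi
  split_ifs with h1 h2 h3 h3 <;> try rfl
  · exact absurd (by
      obtain ⟨i', h4, h5⟩ := h2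
      exact ⟨i', h4, by rwa [← h _ h1, ← h _ ((hinc.lt h4 hi).trans h1)]⟩) h3
  · exact absurd (by
      obtain ⟨i', h4, h5⟩ := h3
      exact ⟨i', h4, by rwa [h _ h1, h _ ((hinc.lt h4 hi).trans h1)]⟩) h2

theorem wt_congr {f g : ℕ → ℕ} {lim a : ℕ} (hinc : Increasing N s a)
    (h : ∀ x < lim, f x = g x) : wt N s r f lim a = wt N s r g lim a :=
  prod_congr rfl fun _ hi => phi_congr hinc (mem_range.1 hi) h

/-- A digit below `x` is compared with still smaller digits only; a digit above `x` remains unfixed.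
-/
theorem phi_update {f : ℕ → ℕ} {x z a i : ℕ} (hinc : Increasing N s a) (hi : i < s)
    (hx : dig N a i ≠ x) :
    phi N r (Function.update f x z) (x + 1) a i = phi N r f x a i := by
  rw [phi, phi]
  by_cases h1 : dig N a i < x
  · have h2 : dig N a i < x + 1 := by omega
    simp only [h1, h2, if_true]
    refine if_congr ?_ rfl rfl
    refine exists_congr fun i' => and_congr_right fun h3 => ?_
    have := hinc.lt h3 hi
    rw [Function.update_of_ne (by omega), Function.update_of_ne (by omega)]
  · have h2 : ¬ dig N a i < x + 1 := by omega
    simp [h1, h2]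

/-- On average over the value at `x`, the conditional probability stays the same. -/
theorem le_sum_wt_update {f : ℕ → ℕ} {x a : ℕ} (hinc : Increasing N s a) :
    r * wt N s r f x a ≤ ∑ z ∈ range r, wt N s r (Function.update f x z) (x + 1) a := by
  by_cases hx : ∃ i < s, dig N a i = x
  · obtain ⟨i, hi, hix⟩ := hx
    -- The digits are distinct, so `x` occurs in one position only and all other factors ignore the
    -- value at `x`.
    have hne : ∀ i' ∈ (range s).erase i, dig N a i' ≠ x := by
      intro i' hi'
      simp only [mem_erase, mem_range] at hi'
      rcases lt_or_gt_of_ne hi'.1 with h | h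
      · have := hinc.lt h hi; omega
      · have := hinc.lt h hi'.2; omega
    -- The earlier digits occupy at most `i` values; each of the others, at least `r - i` of them,
    -- contributes `r`.
    have key : r * (r - i) ≤ ∑ z ∈ range r, phi N r (Function.update f x z) (x + 1) a i := by
      have h1 : ∀ z, phi N r (Function.update f x z) (x + 1) a i =
          if z ∈ (range i).image (fun i' => f (dig N a i')) then 0 else r := by
        intro z
        rw [phi, if_pos (by omega)]
        refine if_congr ?_ rfl rfl
        simp only [mem_image, mem_range]
        refine exists_congr fun i' => and_congr_right fun h3 => ?_
        have := hinc.lt h3 hi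
        rw [Function.update_of_ne (by omega), hix, Function.update_self]
      simp only [h1]
      rw [sum_ite, sum_const_zero, zero_add, sum_const, smul_eq_mul, mul_comm]
      refine Nat.mul_le_mul_right _ ?_
      have h2 : range r \ (range i).image (fun i' => f (dig N a i')) ⊆
          {z ∈ range r | z ∉ (range i).image (fun i' => f (dig N a i'))} := by
        intro z; simp only [mem_sdiff, mem_filter, imp_self]
      refine le_trans ?_ (card_le_card h2)
      have h3 := le_card_sdiff ((range i).image (fun i' => f (dig N a i'))) (range r)
      have h4 : #((range i).image (fun i' => f (dig N a i'))) ≤ i := by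
        simpa using card_image_le (s := range i) (f := fun i' => f (dig N a i'))
      rw [card_range] at h3
      omega
    have hmem := mem_range.2 hi
    simp only [wt]
    rw [← mul_prod_erase _ _ hmem]
    have h5 : ∀ z, ∏ i' ∈ range s, phi N r (Function.update f x z) (x + 1) a i' =
        phi N r (Function.update f x z) (x + 1) a i * ∏ i' ∈ (range s).erase i, phi N r f x a i' := by
      intro z
      rw [← mul_prod_erase _ _ hmem]
      congr 1
      exact prod_congr rfl fun i' hi' =>
        phi_update hinc (mem_range.1 (mem_of_mem_erase hi')) (hne i' hi')
    simp only [h5]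
    rw [← sum_mul, ← mul_assoc]
    refine Nat.mul_le_mul_right _ ?_
    have : phi N r f x a i = r - i := by rw [phi, if_neg (by omega)]
    rwa [this]
  · push Not at hx
    have : ∀ z, wt N s r (Function.update f x z) (x + 1) a = wt N s r f x a := fun z =>
      prod_congr rfl fun i hi => phi_update hinc (mem_range.1 hi) (hx i (mem_range.1 hi))
    simp [this]

/-- The total weight, measured with the conditional probabilities. -/
def total (N s r : ℕ) (W f : ℕ → ℕ) (lim : ℕ) : ℕ :=
  ∑ a ∈ range (N ^ s), W a * wt N s r f lim a

theorem total_le (W f : ℕ → ℕ) (lim : ℕ) :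
    total N s r W f lim ≤ r ^ s * ∑ a ∈ range (N ^ s), W a := by
  rw [mul_sum]
  refine sum_le_sum fun a _ => ?_
  rw [mul_comm]
  exact Nat.mul_le_mul_right _ (wt_le f lim a)

theorem total_congr {W f g : ℕ → ℕ} {lim : ℕ} (hW : ∀ a, W a ≠ 0 → Increasing N s a)
    (h : ∀ x < lim, f x = g x) : total N s r W f lim = total N s r W g lim := by
  refine sum_congr rfl fun a _ => ?_
  by_cases ha : W a = 0
  · simp [ha]
  · rw [wt_congr (hW a ha) h]

/-- A best value at `x` does not decrease the total weight. -/
theorem total_le_of_best {W f : ℕ → ℕ} {x best : ℕ} (hr : 0 < r)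
    (hW : ∀ a, W a ≠ 0 → Increasing N s a)
    (hbest : ∀ z < r, total N s r W (Function.update f x z) (x + 1) ≤ best) :
    total N s r W f x ≤ best := by
  have h1 : r * total N s r W f x ≤
      ∑ z ∈ range r, total N s r W (Function.update f x z) (x + 1) := by
    simp only [total]
    rw [sum_comm, mul_sum]
    refine sum_le_sum fun a _ => ?_
    rw [← mul_sum]
    by_cases ha : W a = 0
    · simp [ha]
    · rw [mul_left_comm]
      exact Nat.mul_le_mul_left _ (le_sum_wt_update (hW a ha))
  have h2 : ∑ z ∈ range r, total N s r W (Function.update f x z) (x + 1) ≤ r * best := by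
    have := sum_le_sum (s := range r) fun z hz => hbest z (mem_range.1 hz)
    simpa using this
  exact Nat.le_of_mul_le_mul_left (h1.trans h2) hr

theorem weights_ne_zero {f : ℕ → ℕ → ℕ} {j a : ℕ} (h : weights N s r α β f j a ≠ 0) :
    Increasing N s a := by
  induction j with
  | zero =>
    by_contra h'
    simp [weights, h'] at h
  | succ j ih => exact ih (left_ne_zero_of_mul h)

theorem weights_congr {f g : ℕ → ℕ → ℕ} {j : ℕ} (h : ∀ j' < j, ∀ x < N, f j' x = g j' x) (a : ℕ) :
    weights N s r α β f j a = weights N s r α β g j a := by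
  induction j with
  | zero => rfl
  | succ j ih =>
    simp only [weights]
    rw [← ih fun j' hj' => h j' (by omega)]
    by_cases ha : weights N s r α β f j a = 0
    · simp [ha]
    · rw [wt_congr (weights_ne_zero ha) (h j (by omega))]

/-- The family is kept in an array, whose cells outside the rows below `R` may still change. -/
theorem Good.congr {f g : ℕ → ℕ → ℕ} {R : ℕ} (hf : Good N s r α β f R)
    (h : ∀ j < R, ∀ x < N, f j x = g j x) : Good N s r α β g R := by
  intro j hj
  obtain ⟨h1, h2⟩ := hf j hj
  refine ⟨fun x hx => by rw [← h j hj x hx]; exact h1 x hx, ?_⟩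
  have h3 : ∀ a, weights N s r α β g j a = weights N s r α β f j a := fun a =>
    (weights_congr (fun j' hj' => h j' (by omega)) a).symm
  simp only [h3]
  refine h2.trans (le_of_eq ?_)
  congr 1
  refine sum_congr rfl fun a _ => ?_
  by_cases ha : weights N s r α β f j a = 0
  · simp [ha]
  · rw [wt_congr (weights_ne_zero ha) (h j hj)]

/-- One more round. -/
theorem Good.succ {f : ℕ → ℕ → ℕ} {R : ℕ} (hf : Good N s r α β f R) (hr : ∀ x < N, f R x < r)
    (h : ∀ x < N, total N s r (weights N s r α β f R) (f R) x ≤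
      total N s r (weights N s r α β f R) (f R) (x + 1)) : Good N s r α β f (R + 1) := by
  intro j hj
  rcases Nat.lt_succ_iff_lt_or_eq.1 hj with hj | rfl
  · exact hf j hj
  refine ⟨hr, ?_⟩
  -- With nothing fixed the total is the average over random functions; with all `N` values fixed it
  -- counts the tuples on which `f j` is injective. No choice in between lowers it.
  have h1 : ∀ x ≤ N, total N s r (weights N s r α β f j) (f j) 0 ≤
      total N s r (weights N s r α β f j) (f j) x := by
    intro x
    induction x with
    | zero => intro _; rfl
    | succ x ih => intro hx; exact (ih (by omega)).trans (h x hx)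
  have h2 := h1 N le_rfl
  simp only [total, wt_zero] at h2
  rw [← sum_mul, mul_comm] at h2
  refine h2.trans ?_
  rw [mul_sum]
  refine sum_le_sum fun a _ => ?_
  split_ifs with h3
  · simp [h3]
  · rw [mul_comm]
    exact Nat.mul_le_mul_right _ (wt_le _ _ _)

theorem ne_of_wt_ne_zero {f : ℕ → ℕ} {a : ℕ} (hN : 0 < N) (h : wt N s r f N a ≠ 0)
    {i j : ℕ} (hij : i < j) (hj : j < s) : f (dig N a i) ≠ f (dig N a j) := by
  intro he
  refine h (prod_eq_zero (mem_range.2 hj) ?_)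
  have : dig N a j < N := Nat.mod_lt _ hN
  rw [phi, if_pos this, if_pos ⟨i, hij, he⟩]

/-- A strictly increasing tuple is the sequence of digits of a number. -/
theorem exists_dig_eq {y : ℕ → ℕ} (hy : ∀ i < s, y i < N) :
    ∃ a < N ^ s, ∀ i < s, dig N a i = y i := by
  refine ⟨(finFunctionFinEquiv (fun i : Fin s => (⟨y i, hy i i.2⟩ : Fin N)) : Fin (N ^ s)),
    Fin.isLt _, fun i hi => ?_⟩
  have := finFunctionFinEquiv_symm_apply_val
    (finFunctionFinEquiv (fun i : Fin s => (⟨y i, hy i i.2⟩ : Fin N))) ⟨i, hi⟩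
  rw [Equiv.symm_apply_apply] at this
  exact this.symm

theorem sum_weights_zero_le (f : ℕ → ℕ → ℕ) :
    ∑ a ∈ range (N ^ s), weights N s r α β f 0 a ≤ N ^ s := by
  calc ∑ a ∈ range (N ^ s), weights N s r α β f 0 a ≤ ∑ a ∈ range (N ^ s), 1 :=
        sum_le_sum fun a _ => by simp only [weights]; split_ifs <;> omega
    _ = N ^ s := by simp

/-! ### Families in which every pair collides rarely -/

/-- A random function separates a pair with probability `(K - 1) / K`. The chosen one does as well
in weighted average, and only the pairs that collide double, so each round multiplies the total
weight by at most `1 + 1 / K`. -/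
theorem Good.mul_sum_weights_le {K Q R : ℕ} {f : ℕ → ℕ → ℕ} (hf : Good Q 2 K 1 2 f R) {j : ℕ}
    (hj : j ≤ R) (hK : 0 < K) :
    K ^ j * ∑ a ∈ range (Q ^ 2), weights Q 2 K 1 2 f j a ≤ (K + 1) ^ j * Q ^ 2 := by
  induction j with
  | zero => simpa using sum_weights_zero_le f
  | succ j ih =>
    have ih := ih (by omega)
    obtain ⟨-, h⟩ := hf j (by omega)
    set S := ∑ a ∈ range (Q ^ 2), weights Q 2 K 1 2 f j a
    set I := ∑ a ∈ range (Q ^ 2), if wt Q 2 K (f j) Q a = 0 then 0 else weights Q 2 K 1 2 f j a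
    have h1 : ∑ a ∈ range (Q ^ 2), weights Q 2 K 1 2 f (j + 1) a + I = 2 * S := by
      rw [← sum_add_distrib, mul_sum]
      refine sum_congr rfl fun a _ => ?_
      simp only [weights]
      split_ifs <;> ring
    have h2 : K.descFactorial 2 = (K - 1) * K := by simp [Nat.descFactorial_succ]
    obtain ⟨K', rfl⟩ : ∃ K', K = K' + 1 := ⟨K - 1, by omega⟩
    rw [h2, Nat.add_sub_cancel, sq] at h
    have h3 : K' * S ≤ (K' + 1) * I := by
      refine Nat.le_of_mul_le_mul_left (c := K' + 1) ?_ (by omega)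
      calc (K' + 1) * (K' * S) = K' * (K' + 1) * S := by ring
        _ ≤ _ := h
        _ = _ := by ring
    have h4 : (K' + 1) * ∑ a ∈ range (Q ^ 2), weights Q 2 (K' + 1) 1 2 f (j + 1) a ≤
        (K' + 1 + 1) * S := by
      nlinarith
    calc (K' + 1) ^ (j + 1) * ∑ a ∈ range (Q ^ 2), weights Q 2 (K' + 1) 1 2 f (j + 1) a
        = (K' + 1) ^ j * ((K' + 1) *
          ∑ a ∈ range (Q ^ 2), weights Q 2 (K' + 1) 1 2 f (j + 1) a) := by ring
      _ ≤ (K' + 1) ^ j * ((K' + 1 + 1) * S) := Nat.mul_le_mul_left _ h4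
      _ = (K' + 1 + 1) * ((K' + 1) ^ j * S) := by ring
      _ ≤ (K' + 1 + 1) * ((K' + 1 + 1) ^ j * Q ^ 2) := Nat.mul_le_mul_left _ ih
      _ = _ := by ring

/-- This is `(1 + 1 / K) ^ K ≤ e ≤ 4`. -/
theorem succ_pow_self_le (K : ℕ) (hK : 0 < K) : (K + 1) ^ K ≤ 4 * K ^ K := by
  have h1 : ((K : ℝ) + 1) ^ K ≤ 4 * (K : ℝ) ^ K := by
    have hK' : (0 : ℝ) < K := by exact_mod_cast hK
    have h2 : ((K : ℝ) + 1) = (1 / K + 1) * K := by field_simp; ring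
    have h3 : ((1 : ℝ) / K + 1) ^ K ≤ Real.exp 1 := by
      calc ((1 : ℝ) / K + 1) ^ K ≤ Real.exp (1 / K) ^ K :=
            pow_le_pow_left₀ (by positivity) (Real.add_one_le_exp _) _
        _ = Real.exp 1 := by rw [← Real.exp_nat_mul]; congr 1; field_simp
    have h4 : Real.exp 1 ≤ 4 := by linarith [Real.exp_one_lt_d9]
    rw [h2, mul_pow]
    exact mul_le_mul_of_nonneg_right (h3.trans h4) (by positivity)
  exact_mod_cast h1

/-- The growth over `j ≤ K * T` rounds is at most `(1 + 1 / K) ^ (K * T) ≤ 4 ^ T`. The case `j = K *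
T` bounds the collisions; the other values of `j` bound the numbers that occur in the construction.
-/
theorem Good.sum_weights_le {K Q T j R : ℕ} {f : ℕ → ℕ → ℕ} (hf : Good Q 2 K 1 2 f R)
    (hK : 0 < K) (hjR : j ≤ R) (hj : j ≤ K * T) :
    ∑ a ∈ range (Q ^ 2), weights Q 2 K 1 2 f j a ≤ 4 ^ T * Q ^ 2 := by
  have h1 := hf.mul_sum_weights_le hjR hK
  have h2 : K ^ (K * T - j) * K ^ j = (K ^ K) ^ T := by rw [← pow_add, ← pow_mul]; congr 1; omega
  have h3 : (K + 1) ^ (K * T - j) * (K + 1) ^ j = ((K + 1) ^ K) ^ T := by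
    rw [← pow_add, ← pow_mul]; congr 1; omega
  have h4 : ((K + 1) ^ K) ^ T ≤ 4 ^ T * (K ^ K) ^ T := by
    rw [← mul_pow]
    exact Nat.pow_le_pow_left (succ_pow_self_le K hK) T
  refine Nat.le_of_mul_le_mul_left (c := (K ^ K) ^ T) ?_ (by positivity)
  calc (K ^ K) ^ T * ∑ a ∈ range (Q ^ 2), weights Q 2 K 1 2 f j a
      = K ^ (K * T - j) * (K ^ j * ∑ a ∈ range (Q ^ 2), weights Q 2 K 1 2 f j a) := by
        rw [← mul_assoc, h2]
    _ ≤ (K + 1) ^ (K * T - j) * ((K + 1) ^ j * Q ^ 2) :=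
        Nat.mul_le_mul (Nat.pow_le_pow_left (by omega) _) h1
    _ = ((K + 1) ^ K) ^ T * Q ^ 2 := by rw [← mul_assoc, h3]
    _ ≤ 4 ^ T * (K ^ K) ^ T * Q ^ 2 := Nat.mul_le_mul_right _ h4
    _ = _ := by ring

/-- Two elements collide in at most `4 * T` of the functions. -/
theorem Good.card_collisions_le {K Q T : ℕ} {f : ℕ → ℕ → ℕ} (hf : Good Q 2 K 1 2 f (K * T))
    (hK : 0 < K) (hT : Q ≤ 2 ^ T) {x y : ℕ} (hx : x < Q) (hy : y < Q) (hxy : x ≠ y) :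
    #{j ∈ range (K * T) | f j x = f j y} ≤ 4 * T := by
  wlog h : x < y generalizing x y
  · simpa only [eq_comm] using this hy hx hxy.symm (by omega)
  have hQ : 0 < Q := by omega
  obtain ⟨a, ha, hdig⟩ := exists_dig_eq (N := Q) (s := 2) (y := fun i => if i = 0 then x else y)
    (fun i _ => by split_ifs <;> assumption)
  have h0 : dig Q a 0 = x := by simpa using hdig 0 (by omega)
  have h1 : dig Q a 1 = y := by simpa using hdig 1 (by omega)
  have hinc : Increasing Q 2 a := by
    intro i hi
    obtain rfl : i = 0 := by omega
    rw [h0, h1]; exact h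
  have hwt : ∀ j, f j x = f j y → wt Q 2 K (f j) Q a = 0 := by
    intro j hj
    by_contra hne
    have := ne_of_wt_ne_zero hQ hne (i := 0) (j := 1) (by omega) (by omega)
    rw [h0, h1] at this
    exact this hj
  -- Each collision doubles the weight of the pair, so the weight shows how many have occurred.
  have hpow : ∀ l, 2 ^ #{j ∈ range l | f j x = f j y} ≤ weights Q 2 K 1 2 f l a := by
    intro l
    induction l with
    | zero => simp [weights, hinc]
    | succ l ih =>
      rw [range_add_one, filter_insert, weights]
      split_ifs with h2 h3 h3
      · rw [card_insert_of_notMem (by simp), pow_succ]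
        exact Nat.mul_le_mul_right _ ih
      · exact absurd (hwt l h2) h3
      · omega
      · omega
  have hle := hf.sum_weights_le hK le_rfl (j := K * T) le_rfl
  have h2 : weights Q 2 K 1 2 f (K * T) a ≤ 4 ^ T * Q ^ 2 :=
    le_trans (single_le_sum (f := weights Q 2 K 1 2 f (K * T)) (fun _ _ => Nat.zero_le _)
      (mem_range.2 ha)) hle
  have h3 : 4 ^ T * Q ^ 2 ≤ 2 ^ (4 * T) := by
    calc 4 ^ T * Q ^ 2 ≤ 4 ^ T * (2 ^ T) ^ 2 :=
          Nat.mul_le_mul_left _ (Nat.pow_le_pow_left hT 2)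
      _ = 2 ^ (4 * T) := by
          rw [show (4 : ℕ) = 2 ^ 2 by norm_num, ← pow_mul, ← pow_mul, ← pow_add]; congr 1; ring
  exact (Nat.pow_le_pow_iff_right (by norm_num)).1 ((hpow _).trans (h2.trans h3))

/-! ### Perfect families -/

/-- A tuple counts until a function is injective on it. A random function to `s` values is so with
probability `s! / s ^ s`, hence each chosen one removes at least this fraction of what is left. -/
theorem Good.sum_weights_cover {R : ℕ} {f : ℕ → ℕ → ℕ} (hf : Good N s s 0 1 f R) {j : ℕ}
    (hj : j ≤ R) :
    (∑ a ∈ range (N ^ s), weights N s s 0 1 f j a : ℕ) ≤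
      ((1 : ℝ) - s.factorial / s ^ s) ^ j * (N : ℝ) ^ s := by
  have hps : (0 : ℝ) < (s : ℝ) ^ s := by
    rcases Nat.eq_zero_or_pos s with rfl | h
    · simp
    · positivity
  have hle : (s.factorial : ℝ) / s ^ s ≤ 1 := by
    rw [div_le_one hps]; exact_mod_cast Nat.factorial_le_pow s
  induction j with
  | zero =>
    have := sum_weights_zero_le (N := N) (s := s) (r := s) (α := 0) (β := 1) f
    simpa using (by exact_mod_cast this :
      ((∑ a ∈ range (N ^ s), weights N s s 0 1 f 0 a : ℕ) : ℝ) ≤ (N : ℝ) ^ s)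
  | succ j ih =>
    have ih := ih (by omega)
    obtain ⟨-, h⟩ := hf j (by omega)
    set S := ∑ a ∈ range (N ^ s), weights N s s 0 1 f j a
    set I := ∑ a ∈ range (N ^ s), if wt N s s (f j) N a = 0 then 0 else weights N s s 0 1 f j a
    have h1 : ∑ a ∈ range (N ^ s), weights N s s 0 1 f (j + 1) a + I = S := by
      rw [← sum_add_distrib]
      refine sum_congr rfl fun a _ => ?_
      simp only [weights]
      split_ifs <;> simp
    rw [Nat.descFactorial_self] at h
    have h2 : (s.factorial : ℝ) / s ^ s * S ≤ I := by
      rw [div_mul_eq_mul_div, div_le_iff₀ hps, mul_comm (I : ℝ)]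
      exact_mod_cast h
    have h3 : ((∑ a ∈ range (N ^ s), weights N s s 0 1 f (j + 1) a : ℕ) : ℝ) + I = S := by
      exact_mod_cast h1
    calc ((∑ a ∈ range (N ^ s), weights N s s 0 1 f (j + 1) a : ℕ) : ℝ)
        ≤ (1 - s.factorial / s ^ s) * S := by linarith
      _ ≤ (1 - s.factorial / s ^ s) * ((1 - s.factorial / s ^ s) ^ j * (N : ℝ) ^ s) :=
          mul_le_mul_of_nonneg_left ih (by linarith)
      _ = _ := by ring

/-- Weights never increase in this family. The bound is needed for the size of the numbers only. -/
theorem sum_weights_le_pow (f : ℕ → ℕ → ℕ) (j : ℕ) :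
    ∑ a ∈ range (N ^ s), weights N s s 0 1 f j a ≤ N ^ s := by
  induction j with
  | zero => exact sum_weights_zero_le f
  | succ j ih =>
    refine le_trans (sum_le_sum fun a _ => ?_) ih
    simp only [weights]
    split_ifs <;> simp

/-- Every set of `s` elements is separated by one of the functions. -/
theorem Good.exists_injOn {R l : ℕ} {f : ℕ → ℕ → ℕ} (hf : Good N s s 0 1 f R) (hs : 0 < s) (hl : 0 < l)
    (hN : N ^ s ≤ 2 ^ l) (hR : (s ^ s / s.factorial + 1) * l ≤ R) (hsN : s ≤ N)
    {X : Finset ℕ} (hX : ∀ x ∈ X, x < N) (hcard : #X ≤ s) :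
    ∃ j < R, Set.InjOn (f j) X := by
  -- Tuples have exactly `s` digits, so `X` is filled up inside `range N`; this is where `s ≤ N` is
  -- used.
  obtain ⟨Y, hXY, hYN, hYs⟩ := exists_subsuperset_card_eq
    (s := X) (t := range N) (fun x hx => mem_range.2 (hX x hx)) hcard (by simpa using hsN)
  have hN0 : 0 < N := by omega
  obtain ⟨a, ha, hdig⟩ := exists_dig_eq (N := N) (s := s)
    (y := fun i => if h : i < s then Y.orderEmbOfFin hYs ⟨i, h⟩ else 0) (fun i hi => by
      simp only [hi, dif_pos]
      exact mem_range.1 (hYN (orderEmbOfFin_mem _ _ _)))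
  have hinc : Increasing N s a := by
    intro i hi
    rw [hdig i (by omega), hdig (i + 1) hi]
    simp only [hi, dif_pos, show i < s by omega]
    exact (Y.orderEmbOfFin hYs).strictMono (by simp [Fin.lt_def])
  -- the weight of `a` vanishes in the end
  have hps : (0 : ℝ) < (s : ℝ) ^ s := by positivity
  have hfac : (0 : ℝ) < s.factorial := by exact_mod_cast s.factorial_pos
  -- As `R` is at least `l * s ^ s / s!`, the first factor is at most `e ^ (-l)`; the second is at
  -- most `2 ^ l`, and `2 / e < 1`.
  have hlt : ((1 : ℝ) - s.factorial / s ^ s) ^ R * (N : ℝ) ^ s < 1 := by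
    have h1 : (1 : ℝ) - s.factorial / s ^ s ≤ Real.exp (-(s.factorial / s ^ s)) := by
      have := Real.add_one_le_exp (-((s.factorial : ℝ) / s ^ s)); linarith
    have hle : (s.factorial : ℝ) / s ^ s ≤ 1 := by
      rw [div_le_one hps]; exact_mod_cast Nat.factorial_le_pow s
    have h2 : (s.factorial : ℝ) / s ^ s * R ≥ l := by
      have h3 : (s : ℝ) ^ s ≤ s.factorial * ((s ^ s / s.factorial + 1 : ℕ) : ℝ) := by
        have := (Nat.lt_mul_div_succ (s ^ s) s.factorial_pos).le
        exact_mod_cast this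
      have h4 : (((s ^ s / s.factorial + 1) * l : ℕ) : ℝ) ≤ R := by exact_mod_cast hR
      rw [ge_iff_le, div_mul_eq_mul_div, le_div_iff₀ hps]
      push_cast at h3 h4
      calc (l : ℝ) * s ^ s ≤ l * (s.factorial * (((s ^ s / s.factorial : ℕ) : ℝ) + 1)) := by
            gcongr
        _ = s.factorial * ((((s ^ s / s.factorial : ℕ) : ℝ) + 1) * l) := by ring
        _ ≤ s.factorial * R := by gcongr
    calc ((1 : ℝ) - s.factorial / s ^ s) ^ R * (N : ℝ) ^ s
        ≤ Real.exp (-(s.factorial / s ^ s)) ^ R * (N : ℝ) ^ s := by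
          refine mul_le_mul_of_nonneg_right (pow_le_pow_left₀ (by linarith) h1 _) (by positivity)
      _ = Real.exp (-(s.factorial / s ^ s * R)) * (N : ℝ) ^ s := by
          rw [← Real.exp_nat_mul]; congr 2; ring
      _ ≤ Real.exp (-l) * 2 ^ l := by
          refine mul_le_mul (Real.exp_le_exp.2 (by linarith)) (by exact_mod_cast hN)
            (by positivity) (by positivity)
      _ = (Real.exp (-1) * 2) ^ l := by rw [mul_pow, ← Real.exp_nat_mul]; congr 2; ring
      _ < 1 := by
          refine pow_lt_one₀ (by positivity) ?_ hl.ne'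
          have := Real.exp_one_gt_d9
          rw [Real.exp_neg, inv_mul_lt_iff₀ (Real.exp_pos _)]
          linarith
  -- The total weight is a natural number below one, so every weight is zero; as `a` started with
  -- weight one, some function was injective on it.
  have hzero : weights N s s 0 1 f R a = 0 := by
    have h1 := (hf.sum_weights_cover le_rfl).trans_lt hlt
    have h2 : ∑ a ∈ range (N ^ s), weights N s s 0 1 f R a < 1 := by exact_mod_cast h1
    have h3 := single_le_sum (f := weights N s s 0 1 f R) (fun _ _ => Nat.zero_le _)
      (mem_range.2 ha)
    omega
  have hex : ∀ l, weights N s s 0 1 f l a = 0 → ∃ j < l, wt N s s (f j) N a ≠ 0 := by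
    intro l
    induction l with
    | zero => intro h; simp [weights, hinc] at h
    | succ l ih =>
      intro h
      simp only [weights, mul_eq_zero] at h
      rcases h with h | h
      · obtain ⟨j, hj, h'⟩ := ih h
        exact ⟨j, by omega, h'⟩
      · refine ⟨l, by omega, fun h' => ?_⟩
        simp [h'] at h
  obtain ⟨j, hj, hwt⟩ := hex R hzero
  refine ⟨j, hj, ?_⟩
  have key : ∀ i i' : Fin s, i < i' → f j (Y.orderEmbOfFin hYs i) ≠ f j (Y.orderEmbOfFin hYs i') := by
    intro i i' hii
    have h1 := ne_of_wt_ne_zero hN0 hwt (Fin.lt_def.1 hii) i'.2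
    rw [hdig i i.2, hdig i' i'.2] at h1
    simpa using h1
  intro x hx y hy hxy
  obtain ⟨i, rfl⟩ : ∃ i, Y.orderEmbOfFin hYs i = x := by
    have : x ∈ Set.range (Y.orderEmbOfFin hYs) := by rw [range_orderEmbOfFin]; exact hXY hx
    exact this
  obtain ⟨i', rfl⟩ : ∃ i, Y.orderEmbOfFin hYs i = y := by
    have : y ∈ Set.range (Y.orderEmbOfFin hYs) := by rw [range_orderEmbOfFin]; exact hXY hy
    exact this
  rcases lt_trichotomy i i' with h | h | h
  · exact absurd hxy (key i i' h)
  · rw [h]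
  · exact absurd hxy.symm (key i' i h)

end HashFamily

/-! ### Programs for the greedy construction -/

namespace LoopLang

open HashFamily

prefix:max "♯" => Exp.var

/-- Computes `HashFamily.wt` for the tuple `a` and the function in row `row` of the array `F`. -/
def wtCmd (F : Arr) : Cmd :=
  (.set .wt 1 ;; .set .cur ♯.a) ;; .rep .i ♯.gs (
    (.set .y (♯.cur % ♯.gN) ;; .set .cur (♯.cur / ♯.gN)) ;;
    .ite (.lt ♯.y ♯.lim)
      ((.set .phi ♯.gr ;; .set .cur' ♯.a) ;;
        .rep .i' ♯.i (.set .y' (♯.cur' % ♯.gN) ;; .set .cur' (♯.cur' / ♯.gN) ;;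
          .ite (.eq (.get F (♯.row + ♯.y')) (.get F (♯.row + ♯.y))) (.set .phi 0) .skip))
      (.set .phi (♯.gr - ♯.i)) ;;
    .set .wt (♯.wt * ♯.phi))

def wtTime (s : ℕ) : ℕ := s * (60 * s + 100) + 20

theorem div_pow_succ (a N j : ℕ) : a / N ^ j / N = a / N ^ (j + 1) := by
  rw [Nat.div_div_eq_div_mul, pow_succ]

/-- Digits are split off by repeated division; the inner loop splits them off `a` anew instead of
storing them, which costs only a factor `s`. Every partial product is at most `r ^ s`. -/
theorem spec_wtCmd {V len N s r lim a row : ℕ} {F : Arr} {σ : St} (hN : 0 < N) (hr : 0 < r)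
    (hrow : row + N ≤ V) (hV : r ^ s < V)
    (h : σ.Has [(.gN, N), (.gs, s), (.gr, r), (.lim, lim), (.a, a), (.row, row)]) :
    Spec V len (wtCmd F) (wtTime s) σ
      (fun τ => τ.reg .wt = wt N s r (fun y => σ.arr F (row + y)) lim a) := by
  set f := fun y => σ.arr F (row + y) with hf
  have hdig : ∀ i, dig N a i < N := fun i => Nat.mod_lt _ hN
  refine Spec.flat_seq (c := 10) (t₂ := s * (60 * s + 95) + 4) rfl (by decide) (by simp [Cmd.Ok])
    ?_ (by unfold wtTime; nlinarith)
  intro τ hτ fr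
  have hτ1 : τ.reg .wt = 1 := by simp [hτ, Cmd.run]
  have hτ2 : τ.reg .cur = a := by
    have := h; simp [St.Has] at this; simp [hτ, Cmd.run, this]
  have g := h.frame fr rfl
  have ga := fr.arr F rfl
  clear hτ fr h
  refine Spec.rep (N := s) (t := 60 * s + 90)
    (fun j τ => τ.reg .cur = a / N ^ j ∧ τ.reg .wt = ∏ i ∈ Finset.range j, phi N r f lim a i)
    (by simp) (g (.gs, s) (by simp)) (by simp [hτ1, hτ2]) ?_ (fun τ₁ _ h => h.2)
    (by simp [Exp.cost])
  rintro j hj τ₁ fr₁ ⟨c1, c2⟩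
  have g1 := (g.frame fr₁ rfl).set (x := .i) (a := j) rfl
  have ga1 := (fr₁.arr F rfl).trans ga
  have hprod : ∀ i ≤ s, ∏ i ∈ Finset.range i, phi N r f lim a i ≤ r ^ s := fun i hi =>
    (wt_le f lim a (s := i)).trans (Nat.pow_le_pow_right hr hi)
  have hprod' := hprod (j + 1) (by omega)
  rw [Finset.prod_range_succ] at hprod' ⊢
  simp [St.Has] at g1
  refine Spec.flat_seq (c := 20) (t₂ := 60 * s + 70) rfl (by decide) (by simp [Cmd.Ok]) ?_
    (by omega)
  intro τ₂ hτ₂ fr₂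
  have d1 : τ₂.reg .y = dig N a j := by simp [hτ₂, Cmd.run, g1, c1, dig]
  have d2 : τ₂.reg .cur = a / N ^ (j + 1) := by simp [hτ₂, Cmd.run, g1, c1, div_pow_succ]
  have d3 : τ₂.reg .wt = ∏ i ∈ Finset.range j, phi N r f lim a i := by simp [hτ₂, Cmd.run, c2]
  have g2 : τ₂.Has [(.gN, N), (.gr, r), (.lim, lim), (.a, a), (.row, row), (.i, j)] := by
    simp [St.Has, hτ₂, Cmd.run, g1]
  have ga2 := (fr₂.arr F rfl).trans ga1
  clear hτ₂ fr₂ c1 c2 g1 fr₁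
  refine Spec.seq (t₁ := 60 * s + 55) (t₂ := 10) (mid := fun τ => τ.reg .phi = phi N r f lim a j)
    ?_ ?_ (by omega)
  · refine Spec.ite (t := 60 * s + 40) (by simp) (by simp) ?_ ?_ (by simp; omega)
    · intro hlt
      have g2' := g2
      simp [St.Has] at g2'
      simp [d1, g2'] at hlt
      refine Spec.flat_seq (c := 10) (t₂ := 60 * s + 10) rfl (by decide) (by simp [Cmd.Ok]) ?_
        (by omega)
      intro τ₃ hτ₃ fr₃
      have e1 : τ₃.reg .phi = r := by simp [hτ₃, Cmd.run, g2']
      have e2 : τ₃.reg .cur' = a := by simp [hτ₃, Cmd.run, g2']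
      have g3 := (g2.cons d1).frame fr₃ rfl
      have ga3 := (fr₃.arr F rfl).trans ga2
      clear hτ₃ fr₃ g2'
      refine Spec.rep (N := j) (t := 55)
        (fun l τ => τ.reg .cur' = a / N ^ l ∧
          τ.reg .phi = if ∃ i' < l, f (dig N a i') = f (dig N a j) then 0 else r)
        (by simp) (g3 (.i, j) (by simp)) (by simp [e1, e2]) ?_ ?_
        (by simp [Exp.cost]; omega)
      · rintro l hl τ₄ fr₄ ⟨b1, b2⟩
        have g4 := (g3.frame fr₄ rfl).set (x := .i') (a := l) rfl
        have ga4 := (fr₄.arr F rfl).trans ga3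
        simp [St.Has] at g4
        have hd1 := hdig l
        have hd2 := hdig j
        have hfl : f (dig N a l) = σ.arr F (row + dig N a l) := rfl
        have hfj : f (dig N a j) = σ.arr F (row + dig N a j) := rfl
        have hiff : (∃ i' < l + 1, f (dig N a i') = f (dig N a j)) ↔
            (∃ i' < l, f (dig N a i') = f (dig N a j)) ∨ f (dig N a l) = f (dig N a j) := by
          constructor
          · rintro ⟨i', h1, h2⟩
            rcases Nat.lt_succ_iff_lt_or_eq.1 h1 with h1 | rfl
            · exact Or.inl ⟨i', h1, h2⟩
            · exact Or.inr h2
          · rintro (⟨i', h1, h2⟩ | h2)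
            · exact ⟨i', by omega, h2⟩
            · exact ⟨l, by omega, h2⟩
        have hdl : a / N ^ l % N = dig N a l := rfl
        refine Spec.flat 55 rfl (Nat.le_of_ble_eq_true rfl) le_rfl ?_ ?_
        · simp [Cmd.Ok, Cmd.run, g4, b1, hdl]
          omega
        · simp only [hiff]
          simp [Cmd.run, g4, b1, hdl, ga4, hfl, hfj]
          split_ifs with h1 h2 h3 <;> simp_all [div_pow_succ]
      · rintro τ₄ - ⟨-, b2⟩
        rw [b2, phi, if_pos hlt]
    · intro hlt
      simp [St.Has] at g2
      simp [d1, g2] at hlt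
      exact Spec.flat 10 rfl (by decide) (by omega) (by simp [Cmd.Ok])
        (by simp [Cmd.run, g2, phi, hlt])
  · intro τ₃ fr₃ e1
    have e2 := (fr₃.reg .cur rfl).trans d2
    have e3 := (fr₃.reg .wt rfl).trans d3
    exact Spec.flat 10 rfl (by decide) le_rfl
      (by simp [Cmd.Ok, e1, e3]; omega) (by simp [Cmd.run, e1, e2, e3])

/-- Initialises the weights of all tuples. -/
def initCmd : Cmd :=
  .rep .a ♯.gA (
    (.put .wts ♯.a 1 ;; .set .y (♯.a % ♯.gN) ;; .set .cur (♯.a / ♯.gN)) ;;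
    .rep .i (♯.gs - 1) (
      .set .y' (♯.cur % ♯.gN) ;; .set .cur (♯.cur / ♯.gN) ;;
      .ite (.lt ♯.y ♯.y') .skip (.put .wts ♯.a 0) ;; .set .y ♯.y'))

/-- Sums up the weights, measured with the conditional probabilities. -/
def totalCmd (F : Arr) : Cmd :=
  .rep .a ♯.gA (wtCmd F ;; .set .sum (♯.sum + .get .wts ♯.a * ♯.wt))

/-- Finds a best value at `x`. -/
def bestCmd (F : Arr) : Cmd :=
  (.set .best 0 ;; .set .bestz 0 ;; .set .lim (♯.x + 1)) ;;
  .rep .z ♯.gr (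
    (.put F (♯.row + ♯.x) ♯.z ;; .set .sum 0) ;;
    totalCmd F ;;
    .ite (.lt ♯.best ♯.sum) (.set .best ♯.sum ;; .set .bestz ♯.z) .skip) ;;
  .put F (♯.row + ♯.x) ♯.bestz

/-- Updates the weights at the end of a round. -/
def updateCmd (F : Arr) (α β : ℕ) : Cmd :=
  .rep .a ♯.gA (wtCmd F ;;
    .ite (.eq ♯.wt 0) (.put .wts ♯.a (.get .wts ♯.a * .lit β))
      (.put .wts ♯.a (.get .wts ♯.a * .lit α)))

/-- Constructs `gR` rows of `gN` values below `gr` in the array `F`. -/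
def greedyCmd (F : Arr) (α β : ℕ) : Cmd :=
  initCmd ;; .rep .j ♯.gR (
    .set .row (♯.j * ♯.gN) ;; .rep .x ♯.gN (bestCmd F) ;; .set .lim ♯.gN ;; updateCmd F α β)

theorem spec_initCmd {V len N s A r α β : ℕ} {f : ℕ → ℕ → ℕ} {σ : St}
    (h : σ.Has [(.gN, N), (.gs, s), (.gA, A)]) :
    Spec V len initCmd (A * (s * 50 + 60) + 10) σ
      (fun τ => ∀ a < A, τ.arr .wts a = weights N s r α β f 0 a) := by
  refine Spec.rep (N := A) (t := s * 50 + 50)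
    (fun j τ => ∀ a < j, τ.arr .wts a = weights N s r α β f 0 a)
    (by simp) (h (.gA, A) (by simp)) (by simp) ?_ (fun τ₁ _ h => h)
    (by simp [Exp.cost]; nlinarith)
  intro j hj τ fr hI
  have g := (h.frame fr rfl).set (x := .a) (a := j) rfl
  clear fr h
  refine Spec.flat_seq (c := 30) (t₂ := s * 50 + 20) rfl (by decide) (by simp [Cmd.Ok]) ?_
    (by omega)
  intro τ₁ hτ₁ fr₁
  have g' := g
  simp [St.Has] at g'
  have d1 : τ₁.reg .y = dig N j 0 := by simp [hτ₁, Cmd.run, g', dig]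
  have d2 : τ₁.reg .cur = j / N ^ 1 := by simp [hτ₁, Cmd.run, g']
  have d3 : τ₁.arr .wts j = 1 := by simp [hτ₁, Cmd.run, g']
  have d4 : ∀ a < j, τ₁.arr .wts a = weights N s r α β f 0 a := by
    intro a ha
    rw [← hI a ha]
    simp [hτ₁, Cmd.run, Function.update_of_ne ha.ne]
  have g1 := g.frame fr₁ rfl
  have g1a : τ₁.reg .a = j := by simp [hτ₁, Cmd.run]
  have g2 := g1.cons g1a
  clear hτ₁ fr₁ g g' g1a
  refine Spec.rep (N := s - 1) (t := 40)
    (fun l τ => τ.reg .y = dig N j l ∧ τ.reg .cur = j / N ^ (l + 1) ∧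
      (τ.arr .wts j = if ∀ i < l, dig N j i < dig N j (i + 1) then 1 else 0) ∧
      ∀ a < j, τ.arr .wts a = weights N s r α β f 0 a)
    (by simp) ?_ ⟨d1, d2, by simpa using d3, d4⟩ ?_ ?_ (by simp [Exp.cost]; omega)
  · have := g2 (.gs, s) (by simp)
    simp at this
    simp [this]
  · rintro l hl τ₂ fr₂ ⟨e1, e2, e3, e4⟩
    have g3 := (g2.frame fr₂ rfl).set (x := .i) (a := l) rfl
    simp [St.Has] at g3
    have hiff : (∀ i < l + 1, dig N j i < dig N j (i + 1)) ↔
        (∀ i < l, dig N j i < dig N j (i + 1)) ∧ dig N j l < dig N j (l + 1) := by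
      constructor
      · intro h; exact ⟨fun i hi => h i (by omega), h l (by omega)⟩
      · rintro ⟨h1, h2⟩ i hi
        rcases Nat.lt_succ_iff_lt_or_eq.1 hi with hi | rfl
        · exact h1 i hi
        · exact h2
    have hdl : j / N ^ (l + 1) % N = dig N j (l + 1) := rfl
    refine Spec.flat 40 rfl (by decide) le_rfl ?_ ?_
    · simp [Cmd.Ok, Cmd.run]
    · simp only [hiff]
      by_cases hlt : dig N j l < dig N j (l + 1)
      · simp [Cmd.run, g3, e1, e2, hdl, hlt, e3, div_pow_succ]
        exact e4
      · simp [Cmd.run, g3, e1, e2, hdl, hlt, div_pow_succ]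
        intro a ha
        rw [Function.update_of_ne ha.ne, e4 a ha]
  · rintro τ₂ - ⟨-, -, e3, e4⟩ a ha
    rcases Nat.lt_succ_iff_lt_or_eq.1 ha with ha | rfl
    · exact e4 a ha
    · rw [e3, weights]
      refine if_congr ?_ rfl rfl
      exact ⟨fun h i hi => h i (by omega), fun h i hi => h i (by omega)⟩

/-- The values of the parameters of the greedy construction. -/
def greedyParams (N s r A R : ℕ) : List (Var × ℕ) :=
  [(.gN, N), (.gs, s), (.gr, r), (.gA, A), (.gR, R)]

theorem spec_totalCmd {V len N s r R lim row : ℕ} {F : Arr} {σ : St} (hN : 0 < N) (hr : 0 < r)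
    (hrow : row + N ≤ V) (hV : r ^ s < V)
    (hW : r ^ s * ∑ a ∈ Finset.range (N ^ s), σ.arr .wts a < V)
    (h : σ.Has ((.lim, lim) :: (.row, row) :: (.sum, 0) :: greedyParams N s r (N ^ s) R)) :
    Spec V len (totalCmd F) (N ^ s * (wtTime s + 35) + 10) σ
      (fun τ => τ.reg .sum = total N s r (σ.arr .wts) (fun y => σ.arr F (row + y)) lim) := by
  have hle := (total_le (N := N) (s := s) (r := r) (σ.arr .wts)
    (fun y => σ.arr F (row + y)) lim).trans_lt hW
  refine Spec.rep (N := N ^ s) (t := wtTime s + 30)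
    (fun j τ => τ.reg .sum = ∑ a ∈ Finset.range j,
      σ.arr .wts a * wt N s r (fun y => σ.arr F (row + y)) lim a)
    (by simp) (h (.gA, N ^ s) (by simp [greedyParams])) (h (.sum, 0) (by simp)) ?_
    (fun τ _ h => h) (by simp [Exp.cost])
  intro j hj τ fr hI
  have h' : σ.Has ((.lim, lim) :: (.row, row) :: greedyParams N s r (N ^ s) R) :=
    fun p hp => h p (by simp at hp ⊢; tauto)
  have g := ((h'.frame fr rfl).set (x := .a) (a := j) rfl).cons (x := .a) (a := j) (by simp)
  have gF := fr.arr F rfl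
  have gW := fr.arr .wts rfl
  have hsum : (τ.set .a j).reg .sum = τ.reg .sum := by simp
  clear fr h h'
  refine Spec.seq (spec_wtCmd (N := N) (s := s) (r := r) (lim := lim) (a := j) (row := row) hN hr
    hrow hV (fun p hp => g p (by simp [greedyParams] at hp ⊢; tauto))) (t₂ := 20) ?_ (by omega)
  intro τ₁ fr₁ hwt
  have e1 : τ₁.reg .sum = τ.reg .sum := (fr₁.reg .sum rfl).trans hsum
  have e2 : τ₁.reg .a = j := (fr₁.reg .a rfl).trans (by simp)
  have e3 : τ₁.arr .wts = σ.arr .wts := (fr₁.arr .wts rfl).trans gW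
  simp only [St.set_arr, gF] at hwt
  have hle' : ∑ a ∈ Finset.range (j + 1),
      σ.arr .wts a * wt N s r (fun y => σ.arr F (row + y)) lim a < V :=
    lt_of_le_of_lt (Finset.sum_le_sum_of_subset (Finset.range_mono hj)) hle
  rw [Finset.sum_range_succ] at hle' ⊢
  refine Spec.flat 20 rfl (by decide) le_rfl ?_ ?_
  · simp [Cmd.Ok, e1, e2, e3, hwt, hI]; omega
  · simp [Cmd.run, e1, e2, e3, hwt, hI]

/-- A candidate is written into its cell of the array while it is evaluated, so the invariant leaves
the content of that cell open; the last command stores the winner. -/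
theorem spec_bestCmd {V len N s r R x row : ℕ} {F : Arr} {σ : St} (hN : 0 < N) (hr : 0 < r)
    (hF : F ≠ .wts) (hrow : row + N < V) (hV : r ^ s < V) (hx : x < N)
    (hW : r ^ s * ∑ a ∈ Finset.range (N ^ s), σ.arr .wts a < V)
    (h : σ.Has ((.x, x) :: (.row, row) :: greedyParams N s r (N ^ s) R)) :
    Spec V len (bestCmd F) (r * (N ^ s * (wtTime s + 35) + 60) + 60) σ
      (fun τ => ∃ v < r, τ.arr F = Function.update (σ.arr F) (row + x) v ∧
        ∀ z < r, total N s r (σ.arr .wts)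
            (Function.update (fun y => σ.arr F (row + y)) x z) (x + 1) ≤
          total N s r (σ.arr .wts) (Function.update (fun y => σ.arr F (row + y)) x v) (x + 1)) := by
  set f := fun y => σ.arr F (row + y) with hf
  set W := σ.arr .wts with hWdef
  have hupd : ∀ z, (fun y => Function.update (σ.arr F) (row + x) z (row + y)) =
      Function.update f x z := by
    intro z
    funext y
    by_cases hy : y = x
    · simp [hy]
    · rw [Function.update_of_ne hy, Function.update_of_ne (by omega)]
  have hstoreW : ∀ P : Cmd, P.stores .wts = decide (F = .wts) → P.stores .wts = false := by
    intro P hP; rw [hP]; simp [hF]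
  refine Spec.flat_seq (c := 10) (t₂ := r * (N ^ s * (wtTime s + 35) + 60) + 40) rfl (by decide)
    ?_ ?_ (by omega)
  · have := h (.x, x) (by simp)
    simp at this
    simp [Cmd.Ok, Cmd.run, this]; omega
  intro τ hτ fr
  have e0 : τ.Has [(.best, 0), (.bestz, 0), (.lim, x + 1)] := by
    have := h (.x, x) (by simp)
    simp at this
    simp [St.Has, hτ, Cmd.run, this]
  have g := (h.frame fr rfl).cons (e0 (.lim, x + 1) (by simp))
  have gF := fr.arr F rfl
  have gW : τ.arr .wts = W := fr.arr .wts rfl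
  simp [St.Has] at e0
  clear hτ fr h
  refine Spec.seq (t₁ := r * (N ^ s * (wtTime s + 35) + 60) + 20) (t₂ := 20)
    (mid := fun τ => ∃ v < r, τ.reg .bestz = v ∧ (∃ z, τ.arr F = Function.update (σ.arr F) (row + x) z) ∧
      ∀ z < r, total N s r W (Function.update f x z) (x + 1) ≤
          total N s r W (Function.update f x v) (x + 1)) ?_ ?_ (by omega)
  · refine Spec.rep (N := r) (t := N ^ s * (wtTime s + 35) + 50)
      (fun j τ => τ.reg .bestz < r ∧ (∃ z, τ.arr F = Function.update (σ.arr F) (row + x) z) ∧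
        (∀ z < j, total N s r W (Function.update f x z) (x + 1) ≤ τ.reg .best) ∧
        τ.reg .best ≤ total N s r W (Function.update f x (τ.reg .bestz)) (x + 1))
      (by simp) (g (.gr, r) (by simp [greedyParams])) ?_ ?_ ?_
      (by simp [Exp.cost]; nlinarith)
    -- The initial choice `bestz = 0` is admissible because `0 < r`.
    · refine ⟨by omega, ⟨σ.arr F (row + x), by simp [gF]⟩, by simp, by omega⟩
    · rintro j hj τ₁ fr₁ ⟨i1, ⟨z0, i2⟩, i3, i4⟩
      have g1 := (g.frame fr₁ rfl).set (x := .z) (a := j) rfl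
      have gW1 : τ₁.arr .wts = W := (fr₁.arr .wts (hstoreW _ (by
        cases F <;> rfl))).trans gW
      clear fr₁
      have g1' := g1
      simp [St.Has, greedyParams] at g1'
      refine Spec.flat_seq (c := 20) (t₂ := N ^ s * (wtTime s + 35) + 30) rfl
        (Nat.le_of_ble_eq_true rfl)
        ?_ ?_ (by omega)
      · simp [Cmd.Ok, Cmd.run, g1']; omega
      intro τ₂ hτ₂ fr₂
      have e1 : τ₂.reg .sum = 0 := by simp [hτ₂, Cmd.run]
      have e2 : τ₂.arr F = Function.update (σ.arr F) (row + x) j := by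
        simp [hτ₂, Cmd.run, i2, g1']
      have e3 : τ₂.reg .best = τ₁.reg .best := by simp [hτ₂, Cmd.run]
      have e4 : τ₂.reg .bestz = τ₁.reg .bestz := by simp [hτ₂, Cmd.run]
      have e5 : τ₂.reg .z = j := by simp [hτ₂, Cmd.run]
      have g2 := g1.frame fr₂ rfl
      have gW2 : τ₂.arr .wts = W := (fr₂.arr .wts (hstoreW _ (by
        cases F <;> rfl))).trans gW1
      clear hτ₂ fr₂ g1'
      refine Spec.seq (spec_totalCmd (N := N) (s := s) (r := r) (R := R) (lim := x + 1) (row := row)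
        hN hr hrow.le hV (by rw [gW2]; exact hW)
        (fun p hp => by
          simp only [List.mem_cons] at hp
          rcases hp with rfl | rfl | rfl | hp
          · exact g2 _ (by simp)
          · exact g2 _ (by simp)
          · exact e1
          · exact g2 _ (by simp [hp]))) (t₂ := 20) ?_ (by omega)
      intro τ₃ fr₃ hsum
      rw [gW2, e2] at hsum
      simp only [hupd] at hsum
      have b1 := (fr₃.reg .best rfl).trans e3
      have b2 := (fr₃.reg .bestz rfl).trans e4
      have b3 := (fr₃.reg .z rfl).trans e5
      have b4 := (fr₃.arr F rfl).trans e2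
      refine Spec.flat 20 rfl (by decide) le_rfl ?_ ?_
      · simp [Cmd.Ok]
      · simp only [Cmd.run, Cond.holds_lt, Exp.eval_var, b1, hsum]
        split_ifs with hlt
        · simp only [St.set_reg, b2, b3, St.set_arr, b4, reduceCtorEq,
            if_true, if_false]
          refine ⟨hj, ⟨j, rfl⟩, ?_, le_rfl⟩
          intro z hz
          rcases Nat.lt_succ_iff_lt_or_eq.1 hz with hz | rfl
          · exact (i3 z hz).trans hlt.le
          · exact le_rfl
        · simp only [b1, b2, b4]
          refine ⟨i1, ⟨j, rfl⟩, ?_, i4⟩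
          intro z hz
          rcases Nat.lt_succ_iff_lt_or_eq.1 hz with hz | rfl
          · exact i3 z hz
          · omega
    · rintro τ₁ - ⟨i1, i2, i3, i4⟩
      exact ⟨_, i1, rfl, i2, fun z hz => (i3 z hz).trans i4⟩
  · rintro τ₁ fr₁ ⟨v, hv, i1, ⟨z, i2⟩, i3⟩
    have g1 := g.frame fr₁ rfl
    simp [St.Has, greedyParams] at g1
    refine Spec.flat 20 rfl (Nat.le_of_ble_eq_true rfl) le_rfl ?_ ?_
    · simp [Cmd.Ok, g1]; omega
    · refine ⟨v, hv, ?_, i3⟩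
      simp [Cmd.run, g1, i1, i2]

theorem spec_updateCmd {V len N s r R row α β : ℕ} {F : Arr} {σ : St} (hN : 0 < N) (hr : 0 < r)
    (hF : F ≠ .wts) (hrow : row + N ≤ V) (hV : r ^ s < V)
    (hW : ∀ a < N ^ s, σ.arr .wts a * (if wt N s r (fun y => σ.arr F (row + y)) N a = 0
      then β else α) < V)
    (h : σ.Has ((.lim, N) :: (.row, row) :: greedyParams N s r (N ^ s) R)) :
    Spec V len (updateCmd F α β) (N ^ s * (wtTime s + 45) + 10) σ
      (fun τ => ∀ a < N ^ s, τ.arr .wts a = σ.arr .wts a *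
        if wt N s r (fun y => σ.arr F (row + y)) N a = 0 then β else α) := by
  refine Spec.rep (N := N ^ s) (t := wtTime s + 40)
    (fun j τ => (∀ a < j, τ.arr .wts a = σ.arr .wts a *
        if wt N s r (fun y => σ.arr F (row + y)) N a = 0 then β else α) ∧
      ∀ a, j ≤ a → τ.arr .wts a = σ.arr .wts a)
    (by simp) (h (.gA, N ^ s) (by simp [greedyParams])) (by simp) ?_
    (fun τ _ h => h.1) (by simp [Exp.cost])
  rintro j hj τ fr ⟨hI, hI'⟩
  have g := ((h.frame fr rfl).set (x := .a) (a := j) rfl).cons (x := .a) (a := j) (by simp)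
  have gF : τ.arr F = σ.arr F := fr.arr F (by
    cases F <;> first | rfl | exact absurd rfl hF)
  clear fr h
  refine Spec.seq (spec_wtCmd (N := N) (s := s) (r := r) (lim := N) (a := j) (row := row) hN hr
    hrow hV (fun p hp => g p (by simp [greedyParams] at hp ⊢; tauto))) (t₂ := 30) ?_ (by omega)
  intro τ₁ fr₁ hwt
  have e2 : τ₁.reg .a = j := (fr₁.reg .a rfl).trans (by simp)
  have e3 : τ₁.arr .wts = τ.arr .wts := fr₁.arr .wts rfl
  simp only [St.set_arr, gF] at hwt
  have hWj := hW j hj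
  refine Spec.flat 30 rfl (Nat.le_of_ble_eq_true rfl) le_rfl ?_ ?_
  · simp only [Cmd.Ok, Cond.lhs_eq, Cond.rhs_eq, Exp.ok_var, Exp.ok_zero, true_and,
      Cond.holds_eq, Exp.eval_var, hwt, Exp.eval_zero]
    split_ifs with h0 <;> simp [e2, e3, hI' j le_rfl] <;> simpa [h0] using hWj
  · simp only [Cmd.run, Cond.holds_eq, Exp.eval_var, hwt, Exp.eval_zero]
    have key : ∀ v, v = σ.arr .wts j * (if wt N s r (fun y => σ.arr F (row + y)) N j = 0
        then β else α) →
        (∀ a < j + 1, Function.update (τ.arr .wts) j v a = σ.arr .wts a *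
          if wt N s r (fun y => σ.arr F (row + y)) N a = 0 then β else α) ∧
        ∀ a, j + 1 ≤ a → Function.update (τ.arr .wts) j v a = σ.arr .wts a := by
      rintro v rfl
      constructor
      · intro a ha
        rcases Nat.lt_succ_iff_lt_or_eq.1 ha with ha | rfl
        · rw [Function.update_of_ne ha.ne, hI a ha]
        · simp
      · intro a ha
        rw [Function.update_of_ne (by omega), hI' a (by omega)]
    split_ifs with h0
    · simp only [St.put_arr, if_true, Exp.eval_var, e2, e3, Exp.eval_mul, Exp.eval_get,
        Exp.eval_lit, hI' j le_rfl]
      exact key _ (by simp [h0])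
    · simp only [St.put_arr, if_true, Exp.eval_var, e2, e3, Exp.eval_mul, Exp.eval_get,
        Exp.eval_lit, hI' j le_rfl]
      exact key _ (by simp [h0])

/-- The leading term multiplies rounds, points, candidate values and tuples. For `s = 2` it contains
`N ^ 3`, so `N` has to be about the cube root of `m`; for the second family, `s` has to be small
enough for `N ^ s` to be at most about `2 ^ k`. -/
def greedyTime (N s r R : ℕ) : ℕ :=
  R * (N * (r * (N ^ s * (wtTime s + 35) + 60) + 70) + N ^ s * (wtTime s + 45) + 50) +
    N ^ s * (s * 50 + 60) + 20

/-- The functions are not known in advance, so `hW` asks for a bound on the total weight of every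
good family. -/
theorem spec_greedyCmd {V len N s r R α β : ℕ} {F : Arr} {σ : St} (hN : 0 < N) (hr : 0 < r)
    (hF : F ≠ .wts) (hR : R * N < V) (hV : r ^ s < V)
    (hW : ∀ (f : ℕ → ℕ → ℕ), ∀ j ≤ R, Good N s r α β f j →
      r ^ s * ∑ a ∈ Finset.range (N ^ s), weights N s r α β f j a < V)
    (h : σ.Has (greedyParams N s r (N ^ s) R)) :
    Spec V len (greedyCmd F α β) (greedyTime N s r R) σ
      (fun τ => Good N s r α β (fun j x => τ.arr F (j * N + x)) R) := by
  have hrs : 0 < r ^ s := by positivity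
  refine Spec.seq (spec_initCmd (A := N ^ s) (s := s) (N := N) (r := r) (α := α) (β := β)
    (f := fun _ _ => 0)
    (fun p hp => h p (by simp [greedyParams] at hp ⊢; tauto)))
    (t₂ := R * (N * (r * (N ^ s * (wtTime s + 35) + 60) + 70) + N ^ s * (wtTime s + 45) + 50) + 10)
    ?_ (by unfold greedyTime; omega)
  intro τ fr hinit
  have g := h.frame fr rfl
  clear fr h σ
  refine Spec.rep (N := R)
    (t := N * (r * (N ^ s * (wtTime s + 35) + 60) + 70) + N ^ s * (wtTime s + 45) + 45)
    (fun j τ => Good N s r α β (fun j x => τ.arr F (j * N + x)) j ∧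
      ∀ a < N ^ s, τ.arr .wts a = weights N s r α β (fun j x => τ.arr F (j * N + x)) j a)
    (by simp) (g (.gR, R) (by simp [greedyParams])) ?_ ?_ (fun τ _ h => h.1)
    (by simp [Exp.cost])
  · exact ⟨fun j hj => absurd hj (by omega), fun a ha => hinit a ha⟩
  rintro j hj τ₁ fr₁ ⟨hgood, hwts⟩
  have g1 := ((g.frame fr₁ rfl).set (x := .j) (a := j) rfl).cons (x := .j) (a := j) (by simp)
  clear fr₁ g hinit τ
  have hrowV : j * N + N < V := by
    calc j * N + N = (j + 1) * N := by ring
      _ ≤ R * N := Nat.mul_le_mul_right _ hj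
      _ < V := hR
  -- the part of the array that is complete
  set f₀ : ℕ → ℕ → ℕ := fun j x => τ₁.arr F (j * N + x) with hf₀
  set W := weights N s r α β f₀ j with hWdef
  have hWinc : ∀ a, W a ≠ 0 → Increasing N s a := fun a => weights_ne_zero
  have hWsum := hW f₀ j hj.le hgood
  refine Spec.flat_seq (c := 10)
    (t₂ := N * (r * (N ^ s * (wtTime s + 35) + 60) + 70) + N ^ s * (wtTime s + 45) + 35) rfl
    (by decide) ?_ ?_ (by omega)
  · have := g1
    simp [St.Has, greedyParams] at this
    simp [Cmd.Ok, this]; omega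
  intro τ₂ hτ₂ fr₂
  have g2 : τ₂.Has ((.row, j * N) :: (.j, j) :: greedyParams N s r (N ^ s) R) :=
    (g1.frame fr₂ rfl).cons (by
      have := g1
      simp [St.Has, greedyParams] at this
      simp [hτ₂, Cmd.run, this])
  have gF2 : τ₂.arr F = τ₁.arr F := fr₂.arr F rfl
  have gW2 : τ₂.arr .wts = τ₁.arr .wts := fr₂.arr .wts rfl
  clear hτ₂ fr₂ g1
  have htot : ∀ {U U' : ℕ → ℕ} {f : ℕ → ℕ} {l : ℕ}, (∀ a < N ^ s, U a = U' a) →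
      total N s r U f l = total N s r U' f l := fun hU =>
    Finset.sum_congr rfl fun a ha => by rw [hU a (Finset.mem_range.1 ha)]
  refine Spec.seq (t₁ := N * (r * (N ^ s * (wtTime s + 35) + 60) + 70) + 5)
    (t₂ := N ^ s * (wtTime s + 45) + 20)
    (mid := fun τ => (∀ i < j * N, τ.arr F i = τ₁.arr F i) ∧
      (∀ y < N, τ.arr F (j * N + y) < r) ∧
      ∀ y < N, total N s r W (fun y => τ.arr F (j * N + y)) y ≤
        total N s r W (fun y => τ.arr F (j * N + y)) (y + 1)) ?_ ?_ (by omega)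
  · refine Spec.rep (N := N) (t := r * (N ^ s * (wtTime s + 35) + 60) + 60)
      (fun x τ => (∀ i < j * N, τ.arr F i = τ₁.arr F i) ∧
        (∀ y < x, τ.arr F (j * N + y) < r) ∧
        ∀ y < x, total N s r W (fun y => τ.arr F (j * N + y)) y ≤
          total N s r W (fun y => τ.arr F (j * N + y)) (y + 1))
      (by simp) (g2 (.gN, N) (by simp [greedyParams])) ?_ ?_ (fun τ _ h => h)
      (by simp [Exp.cost]; nlinarith)
    · simp [gF2]
    rintro x hx τ₃ fr₃ ⟨i1, i2, i3⟩
    have g3 := (((g2.frame fr₃ rfl).set (x := .x) (a := x) rfl).cons (x := .x) (a := x) (by simp))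
    have gW3 : τ₃.arr .wts = τ₁.arr .wts := (fr₃.arr .wts (by
      cases F <;> first | rfl | exact absurd rfl hF)).trans gW2
    clear fr₃
    have hsum3 : r ^ s * ∑ a ∈ Finset.range (N ^ s), (τ₃.set .x x).arr .wts a < V := by
      rw [St.set_arr, gW3]
      rwa [Finset.sum_congr rfl fun a ha => hwts a (Finset.mem_range.1 ha)]
    refine (spec_bestCmd (R := R) (row := j * N) hN hr hF hrowV hV hx hsum3
      (fun p hp => g3 p (by simp at hp ⊢; tauto))).mono le_rfl ?_
    rintro τ₄ - ⟨v, hv, e1, e2⟩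
    simp only [St.set_arr, gW3] at e1 e2
    have hrow4 : (fun y => τ₄.arr F (j * N + y)) =
        Function.update (fun y => τ₃.arr F (j * N + y)) x v := by
      funext y
      rw [e1]
      by_cases hy : y = x
      · simp [hy]
      · rw [Function.update_of_ne hy, Function.update_of_ne (by omega)]
    refine ⟨fun i hi => ?_, fun y hy => ?_, fun y hy => ?_⟩
    · rw [e1, Function.update_of_ne (by omega), i1 i hi]
    · have := congrFun hrow4 y
      rw [this]
      rcases Nat.lt_succ_iff_lt_or_eq.1 hy with hy | rfl
      · rw [Function.update_of_ne hy.ne]; exact i2 y hy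
      · simpa using hv
    · rw [hrow4]
      -- Totals with fewer fixed values do not see the new one, so the inequalities already
      -- established survive.
      have hc : ∀ l ≤ x, total N s r W
          (Function.update (fun y => τ₃.arr F (j * N + y)) x v) l =
          total N s r W (fun y => τ₃.arr F (j * N + y)) l := fun l hl =>
        total_congr hWinc fun y' hy' => Function.update_of_ne (by omega) _ _
      rcases Nat.lt_succ_iff_lt_or_eq.1 hy with hy | rfl
      · rw [hc y (by omega), hc (y + 1) (by omega)]
        exact i3 y hy
      · rw [hc y le_rfl]
        refine total_le_of_best hr hWinc fun z hz => ?_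
        have := e2 z hz
        rwa [htot hwts, htot hwts] at this
  rintro τ₃ fr₃ ⟨i1, i2, i3⟩
  have g3 := g2.frame fr₃ rfl
  have gW3 : τ₃.arr .wts = τ₁.arr .wts := (fr₃.arr .wts (by
      cases F <;> first | rfl | exact absurd rfl hF)).trans gW2
  clear fr₃
  set f₁ : ℕ → ℕ → ℕ := fun j x => τ₃.arr F (j * N + x) with hf₁
  have hagree : ∀ j' < j, ∀ x < N, f₀ j' x = f₁ j' x := by
    intro j' hj' x hx
    refine (i1 _ ?_).symm
    calc j' * N + x < j' * N + N := by omega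
      _ = (j' + 1) * N := by ring
      _ ≤ j * N := Nat.mul_le_mul_right _ hj'
  have hW1 : weights N s r α β f₁ j = W := by
    funext a; exact (weights_congr hagree a).symm
  have hgood1 : Good N s r α β f₁ (j + 1) := by
    refine (hgood.congr hagree).succ i2 ?_
    rw [hW1]; exact i3
  refine Spec.flat_seq (c := 5) (t₂ := N ^ s * (wtTime s + 45) + 10) rfl (by decide)
    (by simp [Cmd.Ok]) ?_ (by omega)
  intro τ₄ hτ₄ fr₄
  have g4 : τ₄.Has ((.lim, N) :: (.row, j * N) :: (.j, j) :: greedyParams N s r (N ^ s) R) :=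
    (g3.frame fr₄ rfl).cons (by
      have := g3
      simp [St.Has, greedyParams] at this
      simp [hτ₄, Cmd.run, this])
  have gF4 : τ₄.arr F = τ₃.arr F := fr₄.arr F rfl
  have gW4 : τ₄.arr .wts = τ₁.arr .wts := (fr₄.arr .wts rfl).trans gW3
  clear hτ₄ fr₄ g3
  have hnew : ∀ a < N ^ s, τ₄.arr .wts a *
      (if wt N s r (fun y => τ₄.arr F (j * N + y)) N a = 0 then β else α) =
      weights N s r α β f₁ (j + 1) a := by
    intro a ha
    rw [gW4, hwts a ha, gF4, weights, hW1]
  refine (spec_updateCmd (R := R) (row := j * N) (α := α) (β := β) hN hr hF hrowV.le hV ?_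
    (fun p hp => g4 p (by simp at hp ⊢; tauto))).mono le_rfl ?_
  · intro a ha
    rw [hnew a ha]
    refine lt_of_le_of_lt ?_ (hW f₁ (j + 1) hj hgood1)
    calc weights N s r α β f₁ (j + 1) a ≤
        ∑ a ∈ Finset.range (N ^ s), weights N s r α β f₁ (j + 1) a :=
          Finset.single_le_sum (f := weights N s r α β f₁ (j + 1)) (fun _ _ => Nat.zero_le _)
            (Finset.mem_range.2 ha)
      _ ≤ _ := Nat.le_mul_of_pos_left _ hrs
  · intro τ₅ fr₅ hu
    have gF5 : τ₅.arr F = τ₃.arr F := (fr₅.arr F (by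
      cases F <;> first | rfl | exact absurd rfl hF)).trans gF4
    refine ⟨by rw [gF5]; exact hgood1, fun a ha => ?_⟩
    rw [gF5, hu a ha, hnew a ha]

end LoopLang

namespace HashFamily

open Finset

/-! ### Colourings -/

/-- Hashing of the three digits of `e` in base `Q`. -/
def hash (G : ℕ → ℕ → ℕ) (Q K j e : ℕ) : ℕ :=
  (G j (e % Q) * K + G j (e / Q % Q)) * K + G j (e / (Q * Q))

theorem hash_lt {G : ℕ → ℕ → ℕ} {Q K j e : ℕ} (hQ : 0 < Q) (he : e < Q ^ 3)
    (hG : ∀ x < Q, G j x < K) : hash G Q K j e < K ^ 3 := by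
  have h1 := hG _ (Nat.mod_lt e hQ)
  have h2 := hG _ (Nat.mod_lt (e / Q) hQ)
  have h3 := hG (e / (Q * Q)) (Nat.div_lt_of_lt_mul (by calc e < Q ^ 3 := he
                                                      _ = _ := by ring))
  unfold hash
  have h4 : G j (e % Q) * K + G j (e / Q % Q) < K * K := by nlinarith
  calc _ < (G j (e % Q) * K + G j (e / Q % Q)) * K + K := by omega
    _ = (G j (e % Q) * K + G j (e / Q % Q) + 1) * K := by ring
    _ ≤ K * K * K := Nat.mul_le_mul_right _ h4
    _ = K ^ 3 := by ring

theorem mul_add_inj {K a b c d : ℕ} (hb : b < K) (hd : d < K) (h : a * K + b = c * K + d) :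
    a = c ∧ b = d := by
  have h1 : (a * K + b) / K = a := by
    rw [mul_comm, Nat.mul_add_div (by omega), Nat.div_eq_of_lt hb, add_zero]
  have h2 : (c * K + d) / K = c := by
    rw [mul_comm, Nat.mul_add_div (by omega), Nat.div_eq_of_lt hd, add_zero]
  have : a = c := by rw [← h1, ← h2, h]
  subst this
  exact ⟨rfl, by omega⟩

/-- A family in which pairs collide rarely separates all small sets of edges. -/
theorem Good.exists_hash_injOn {G : ℕ → ℕ → ℕ} {Q T k : ℕ}
    (hG : Good Q 2 (2 * k ^ 2) 1 2 G (2 * k ^ 2 * T)) (hk : 0 < k) (hT0 : 0 < T) (hT : Q ≤ 2 ^ T)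
    {E : Finset ℕ} (hE : ∀ e ∈ E, e < Q ^ 3) (hcard : #E ≤ k) :
    ∃ j < 2 * k ^ 2 * T, Set.InjOn (hash G Q (2 * k ^ 2) j) E := by
  set K := 2 * k ^ 2 with hK
  have hK0 : 0 < K := by positivity
  -- the rows in which a pair of edges collides
  have hpair : ∀ p ∈ E.offDiag, #{j ∈ range (K * T) | hash G Q K j p.1 = hash G Q K j p.2} ≤
      4 * T := by
    rintro ⟨e, e'⟩ hp
    obtain ⟨he, he', hne⟩ := mem_offDiag.1 hp
    have hlt := hE e he
    have hlt' := hE e' he'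
    have hQ : 0 < Q := by
      rcases Nat.eq_zero_or_pos Q with rfl | h
      · simp at hlt
      · exact h
    have hd : ∀ e < Q ^ 3, e / (Q * Q) < Q := fun e he =>
      Nat.div_lt_of_lt_mul (by calc e < Q ^ 3 := he
                                _ = _ := by ring)
    have hcomp : ∀ j < K * T, hash G Q K j e = hash G Q K j e' →
        G j (e % Q) = G j (e' % Q) ∧ G j (e / Q % Q) = G j (e' / Q % Q) ∧
          G j (e / (Q * Q)) = G j (e' / (Q * Q)) := by
      intro j hj h
      have hv := (hG j hj).1
      obtain ⟨h1, h2⟩ := mul_add_inj (hv _ (hd e hlt)) (hv _ (hd e' hlt')) h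
      obtain ⟨h3, h4⟩ := mul_add_inj (hv _ (Nat.mod_lt _ hQ)) (hv _ (Nat.mod_lt _ hQ)) h1
      exact ⟨h3, h4, h2⟩
    -- Distinct edges differ in some base-`Q` digit, and a collision of hashes forces the functions
    -- to identify these two digits, which happens in at most `4 * T` rows.
    have hdiff : e % Q ≠ e' % Q ∨ e / Q % Q ≠ e' / Q % Q ∨ e / (Q * Q) ≠ e' / (Q * Q) := by
      by_contra! hcon
      obtain ⟨h1, h2, h3⟩ := hcon
      rw [← Nat.div_div_eq_div_mul, ← Nat.div_div_eq_div_mul] at h3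
      have h4 : e / Q = e' / Q := by
        rw [← Nat.div_add_mod (e / Q) Q, ← Nat.div_add_mod (e' / Q) Q, h2, h3]
      exact hne (by rw [← Nat.div_add_mod e Q, ← Nat.div_add_mod e' Q, h1, h4])
    have hsub : ∀ x x' : ℕ, x < Q → x' < Q → x ≠ x' →
        (∀ j < K * T, hash G Q K j e = hash G Q K j e' → G j x = G j x') →
        #{j ∈ range (K * T) | hash G Q K j e = hash G Q K j e'} ≤ 4 * T := by
      intro x x' hx hx' hxx h
      refine le_trans (card_le_card ?_) (hG.card_collisions_le hK0 hT hx hx' hxx)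
      intro j hj
      simp only [mem_filter, mem_range] at hj ⊢
      exact ⟨hj.1, h j hj.1 hj.2⟩
    rcases hdiff with h | h | h
    · exact hsub _ _ (Nat.mod_lt _ hQ) (Nat.mod_lt _ hQ) h fun j hj hh => (hcomp j hj hh).1
    · exact hsub _ _ (Nat.mod_lt _ hQ) (Nat.mod_lt _ hQ) h fun j hj hh => (hcomp j hj hh).2.1
    · exact hsub _ _ (hd e hlt) (hd e' hlt') h fun j hj hh => (hcomp j hj hh).2.2
  -- ordered pairs are counted twice, so we use unordered ones
  set P := {p ∈ E.offDiag | p.1 < p.2} with hP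
  have hPcard : 2 * #P ≤ k * (k - 1) := by
    have h1 : #{p ∈ E.offDiag | p.2 < p.1} = #P := by
      refine card_bij (fun p _ => p.swap) ?_ ?_ ?_
      · rintro ⟨a, b⟩ h
        simp only [hP, mem_filter, mem_offDiag, Prod.swap] at h ⊢
        exact ⟨⟨h.1.2.1, h.1.1, h.1.2.2.symm⟩, h.2⟩
      · rintro a _ b _ h; exact Prod.swap_injective h
      · rintro ⟨a, b⟩ h
        refine ⟨(b, a), ?_, rfl⟩
        simp only [hP, mem_filter, mem_offDiag] at h ⊢
        exact ⟨⟨h.1.2.1, h.1.1, h.1.2.2.symm⟩, h.2⟩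
    have h2 : #P + #{p ∈ E.offDiag | p.2 < p.1} = #E.offDiag := by
      rw [← card_filter_add_card_filter_not (s := E.offDiag) (fun p => p.1 < p.2)]
      congr 2
      refine filter_congr ?_
      rintro ⟨a, b⟩ h
      simp only [mem_offDiag] at h
      have := h.2.2
      constructor
      · intro h; simp at h ⊢; omega
      · intro h; simp at h ⊢; omega
    rw [offDiag_card] at h2
    have h3 : #E * #E - #E ≤ k * (k - 1) := by
      rw [← Nat.mul_sub_one]
      exact Nat.mul_le_mul hcard (by omega)
    omega
  -- At most `k * (k - 1) / 2` pairs spoil `4 * T` rows each, together fewer than the `2 * k ^ 2 *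
  -- T` rows. This dictates `K = 2 * k ^ 2`.
  have hbad : #(P.biUnion fun p => {j ∈ range (K * T) |
      hash G Q K j p.1 = hash G Q K j p.2}) < #(range (K * T)) := by
    refine lt_of_le_of_lt card_biUnion_le ?_
    refine lt_of_le_of_lt (sum_le_sum fun p hp => hpair p (mem_of_mem_filter p hp)) ?_
    rw [sum_const, smul_eq_mul, card_range]
    obtain ⟨l, rfl⟩ : ∃ l, k = l + 1 := ⟨k - 1, by omega⟩
    simp only [Nat.add_sub_cancel] at hPcard
    calc #P * (4 * T) = 2 * #P * (2 * T) := by ring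
      _ ≤ (l + 1) * l * (2 * T) := Nat.mul_le_mul_right _ hPcard
      _ < 2 * (l + 1) ^ 2 * T := by nlinarith
  obtain ⟨j, hj, hj'⟩ := exists_mem_notMem_of_card_lt_card hbad
  refine ⟨j, mem_range.1 hj, ?_⟩
  intro e he e' he' h
  by_contra hne
  refine hj' (mem_biUnion.2 ?_)
  rcases lt_or_gt_of_ne hne with hlt | hlt
  · exact ⟨(e, e'), by simp [hP, hlt, hne, mem_coe.1 he, mem_coe.1 he'], by simp [mem_range.1 hj, h]⟩
  · exact ⟨(e', e), by simp [hP, hlt, Ne.symm hne, mem_coe.1 he, mem_coe.1 he'],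
      by simp [mem_range.1 hj, h]⟩

/-- The colour of `x` after `i` blocks have been considered: the blocks are intervals that start at
`dig D c i % (N + 1)`, and block `i` has the colours `i * s, …, i * s + s - 1`. -/
def color (F : ℕ → ℕ → ℕ) (N s D c x : ℕ) : ℕ → ℕ
  | 0 => 0
  | i + 1 => if dig D c i % (N + 1) ≤ x then i * s + F (dig D c i / (N + 1)) x
      else color F N s D c x i

theorem color_lt {F : ℕ → ℕ → ℕ} {N s R c x : ℕ} (hF : ∀ j < R, ∀ x < N, F j x < s) (hR : 0 < R)
    (hx : x < N) (hs : 0 < s) {l : ℕ} (hl : 0 < l) :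
    color F N s ((N + 1) * R) c x l < l * s := by
  induction l with
  | zero => omega
  | succ l ih =>
    rw [color]
    split_ifs with h
    · have h1 : dig ((N + 1) * R) c l / (N + 1) < R :=
        Nat.div_lt_of_lt_mul (Nat.mod_lt _ (by positivity))
      have := hF _ h1 x hx
      rw [Nat.succ_mul l s]; omega
    · rcases Nat.eq_zero_or_pos l with rfl | hl'
      · simpa [color] using hs
      · have := ih hl'
        rw [Nat.succ_mul l s]; omega

/-- Every small set gets different colours for some choice of the blocks and functions. -/
theorem exists_color_injOn {F : ℕ → ℕ → ℕ} {N s R l : ℕ} (hs : 0 < s)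
    (hF : ∀ j < R, ∀ x < N, F j x < s)
    (hsep : ∀ X : Finset ℕ, (∀ x ∈ X, x < N) → #X ≤ s → ∃ j < R, Set.InjOn (F j) X)
    {Y : Finset ℕ} (hY : ∀ x ∈ Y, x < N) (hcard : #Y ≤ l * s) :
    ∃ c < ((N + 1) * R) ^ l, Set.InjOn (fun x => color F N s ((N + 1) * R) c x l) Y := by
  set D := (N + 1) * R with hD
  -- Block `i` shall consist of the elements of `Y` whose position lies in `[i * s, i * s + s)`.
  set rk : ℕ → ℕ := fun x => #{y ∈ Y | y < x} with hrk
  have hmono : ∀ {x y}, x ≤ y → rk x ≤ rk y := fun hxy =>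
    card_le_card fun z hz => by
      simp only [mem_filter] at hz ⊢
      exact ⟨hz.1, by omega⟩
  have hstrict : ∀ {x y}, x ∈ Y → x < y → rk x < rk y := by
    intro x y hx hxy
    refine card_lt_card ⟨fun z hz => ?_, fun h => ?_⟩
    · simp only [mem_filter] at hz ⊢
      exact ⟨hz.1, by omega⟩
    · have := h (mem_filter.2 ⟨hx, hxy⟩)
      simp at this
  have hinj : Set.InjOn rk Y := by
    intro x hx y hy h
    rcases lt_trichotomy x y with h' | h' | h'
    · exact absurd h (hstrict hx h').ne
    · exact h'
    · exact absurd h (hstrict hy h').ne'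
  have hrklt : ∀ x ∈ Y, rk x < l * s := by
    intro x hx
    refine lt_of_lt_of_le (card_lt_card ⟨filter_subset _ _, fun h => ?_⟩) hcard
    have := h hx
    simp at this
  have hblock : ∀ i, ∃ j < R, Set.InjOn (F j) ({x ∈ Y | rk x / s = i} : Finset ℕ) := by
    intro i
    refine hsep _ (fun x hx => hY x (mem_of_mem_filter x hx)) ?_
    have : #({x ∈ Y | rk x / s = i}.image rk) ≤ #(Ico (i * s) (i * s + s)) := by
      refine card_le_card fun r hr => ?_
      obtain ⟨x, hx, rfl⟩ := mem_image.1 hr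
      have h1 := (mem_filter.1 hx).2
      have h2 := Nat.div_add_mod (rk x) s
      have h3 := Nat.mod_lt (rk x) hs
      rw [h1, mul_comm] at h2
      exact mem_Ico.2 ⟨by omega, by omega⟩
    rw [card_image_of_injOn (hinj.mono (by intro x hx; exact (mem_filter.1 hx).1))] at this
    simpa using this
  choose fi hfi hfinj using hblock
  -- Block `i` starts at the least element with position at least `i * s`. If there is none, the
  -- start is `N`, which no point reaches; this is why a start has `N + 1` possible values.
  have hbreak : ∀ i, ∃ b ≤ N, ∀ x ∈ Y, b ≤ x ↔ i * s ≤ rk x := by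
    intro i
    by_cases hne : ({x ∈ Y | i * s ≤ rk x} : Finset ℕ).Nonempty
    · have hmem := min'_mem _ hne
      rw [mem_filter] at hmem
      refine ⟨min' _ hne, (hY _ hmem.1).le, fun x hx => ⟨fun h => hmem.2.trans (hmono h), fun h => ?_⟩⟩
      exact min'_le _ _ (mem_filter.2 ⟨hx, h⟩)
    · refine ⟨N, le_rfl, fun x hx => ⟨fun h => absurd (hY x hx) (by omega), fun h => ?_⟩⟩
      exact absurd ⟨x, mem_filter.2 ⟨hx, h⟩⟩ hne
  choose b hb hbiff using hbreak
  obtain ⟨c, hc, hdig⟩ := exists_dig_eq (N := D) (s := l) (y := fun i => b i + (N + 1) * fi i)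
    (fun i _ => by
      have h1 := hb i
      have h2 : fi i + 1 ≤ R := hfi i
      calc b i + (N + 1) * fi i < (N + 1) * (fi i + 1) := by rw [mul_add]; omega
        _ ≤ D := Nat.mul_le_mul_left _ h2)
  refine ⟨c, hc, ?_⟩
  -- `color` uses the last block that starts at or before `x`, and for elements of `Y` this is the
  -- block of their position.
  have hcol : ∀ x ∈ Y, ∀ i ≤ l, rk x / s < i →
      color F N s D c x i = rk x / s * s + F (fi (rk x / s)) x := by
    intro x hx i
    induction i with
    | zero => intro _ h; exact absurd h (Nat.not_lt_zero _)
    | succ i ih =>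
      intro hi hlt
      have hb' := hb i
      rw [color, hdig i (by omega), Nat.add_mul_mod_self_left, Nat.mod_eq_of_lt (by omega),
        Nat.add_mul_div_left _ _ (by omega), Nat.div_eq_of_lt (by omega), zero_add]
      split_ifs with h
      · have h1 := (hbiff i x hx).1 h
        have h2 : i ≤ rk x / s := (Nat.le_div_iff_mul_le hs).2 h1
        have h3 : rk x / s = i := by omega
        rw [h3]
      · have h1 : ¬ i * s ≤ rk x := fun h' => h ((hbiff i x hx).2 h')
        have h2 : ¬ i ≤ rk x / s := fun h' => h1 ((Nat.le_div_iff_mul_le hs).1 h')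
        exact ih (by omega) (by omega)
  intro x hx y hy h
  have hx' := hrklt x hx
  have hy' := hrklt y hy
  dsimp only at h
  rw [hcol x hx l le_rfl (Nat.div_lt_of_lt_mul (by linarith)),
    hcol y hy l le_rfl (Nat.div_lt_of_lt_mul (by linarith))] at h
  obtain ⟨h1, h2⟩ := mul_add_inj (hF _ (hfi _) x (hY x hx)) (hF _ (hfi _) y (hY y hy)) h
  rw [← h1] at h2
  exact hfinj (rk x / s) (mem_filter.2 ⟨hx, rfl⟩) (mem_filter.2 ⟨hy, h1.symm⟩) h2

end HashFamily

/-! ## Reachability of configurations -/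

namespace RouteSearch

open Finset

/-- Sets the bit with value `b` in `Y`. -/
def addBit (Y b : ℕ) : ℕ := if Y / b % 2 = 0 then Y + b else Y

/-- The machine has no bitwise operations; where the bit is known to be unset, addition replaces
disjunction, and the masks can be examined bit by bit. -/
theorem add_two_pow_eq_or {Y c : ℕ} (h : Y / 2 ^ c % 2 = 0) : Y + 2 ^ c = Y ||| 2 ^ c := by
  set a := Y / 2 ^ c / 2 with ha
  set b := Y % 2 ^ c with hb
  have hb' : b < 2 ^ c := Nat.mod_lt _ (by positivity)
  have hY : Y = 2 ^ (c + 1) * a + b := by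
    have h1 := Nat.div_add_mod Y (2 ^ c)
    have h2 := Nat.div_add_mod (Y / 2 ^ c) 2
    rw [h, add_zero] at h2
    rw [← h2] at h1
    rw [← h1, pow_succ, mul_assoc]
  have hb2 : 2 ^ c * 1 + b < 2 ^ (c + 1) := by rw [pow_succ]; omega
  have h3 : Y + 2 ^ c = 2 ^ (c + 1) * a + (2 ^ c * 1 + b) := by rw [hY]; ring
  rw [h3, Nat.two_pow_add_eq_or_of_lt hb2, Nat.two_pow_add_eq_or_of_lt hb', hY,
    Nat.two_pow_add_eq_or_of_lt (by omega), mul_one, Nat.or_assoc, Nat.or_comm b]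

theorem addBit_two_pow (Y c : ℕ) : addBit Y (2 ^ c) = Y ||| 2 ^ c := by
  unfold addBit
  split_ifs with h
  · exact add_two_pow_eq_or h
  · apply Nat.eq_of_testBit_eq
    intro j
    rw [Nat.testBit_or, Nat.testBit_two_pow]
    by_cases hj : c = j
    · subst hj
      have : Y.testBit c = true := by
        rw [Nat.testBit_eq_decide_div_mod_eq]
        have := Nat.mod_two_eq_zero_or_one (Y / 2 ^ c)
        simp; omega
      simp [this]
    · simp [hj]

/-- The value `0` serves as the bit of a vertex that is no waypoint; this works because division by
zero gives zero. -/
theorem addBit_zero (Y : ℕ) : addBit Y 0 = Y := by simp [addBit]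

theorem or_two_pow_div {Y c u : ℕ} (h : c < u) : (Y ||| 2 ^ c) / 2 ^ u = Y / 2 ^ u := by
  apply Nat.eq_of_testBit_eq
  intro j
  rw [Nat.testBit_div_two_pow, Nat.testBit_div_two_pow, Nat.testBit_or, Nat.testBit_two_pow]
  simp; omega

theorem testBit_add_two_pow {Y u j : ℕ} (h : j < u) : (Y + 2 ^ u).testBit j = Y.testBit j := by
  rw [add_comm, Nat.testBit_two_pow_add_gt h]

/-- The data of a search: edges `0, …, m - 1`, copies `0, …, k - 1` of every edge, the value of the
bit that belongs to each copy and each vertex, the increment for every step, a strict bound for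
the masks, and the start. -/
structure Search where
  m : ℕ
  k : ℕ
  src : ℕ → ℕ
  dst : ℕ → ℕ
  wgt : ℕ → ℕ
  cap : ℕ → ℕ
  bit : ℕ → ℕ → ℕ
  wbit : ℕ → ℕ
  inc : ℕ
  tot : ℕ
  start : ℕ

/-- The mask after traversing copy `i` of the edge `e`. -/
def Search.next (S : Search) (Y e i : ℕ) : ℕ := addBit (Y + S.bit e i + S.inc) (S.wbit (S.dst e))

/-- The vertex `v` can be reached with mask `Y` and weight `d`. -/
inductive Reach (S : Search) : ℕ → ℕ → ℕ → Prop
  | start : Reach S S.start (S.wbit S.start) 0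
  | step {Y d e i : ℕ} (h : Reach S (S.src e) Y d) (he : e < S.m) (hi : i < S.k)
      (hcap : i < S.cap e) (hbit : Y / S.bit e i % 2 = 0) (hlt : S.next Y e i < S.tot) :
      Reach S (S.dst e) (S.next Y e i) (d + S.wgt e)

/-- The search `S` belongs to the instance `I`, where copies of edges have the colours `col` and
the waypoints are numbered by `idx`. -/
structure Fits (I : DWRP) (k t : ℕ) (w₀ : Fin I.n) (idx : Fin I.n → ℕ) (col : ℕ → ℕ → ℕ)
    (S : Search) : Prop where
  m_eq : S.m = I.m
  k_eq : S.k = k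
  src : ∀ e : Fin I.m, S.src e = I.src e
  dst : ∀ e : Fin I.m, S.dst e = I.dst e
  wgt : ∀ e : Fin I.m, S.wgt e = I.weight e
  cap : ∀ e : Fin I.m, S.cap e = I.capacity e
  bit : ∀ (e : Fin I.m) (i : ℕ), i < k → S.bit e i = 2 ^ col e i
  col_lt : ∀ (e : Fin I.m) (i : ℕ), i < k → col e i < t
  wbit : ∀ v : Fin I.n, S.wbit v = if v ∈ I.waypoints then 2 ^ (t + idx v) else 0
  inc : S.inc = 2 ^ (t + #I.waypoints)
  tot : S.tot = 2 ^ (t + #I.waypoints) * (k + 1)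
  start : S.start = w₀
  mem : w₀ ∈ I.waypoints
  bij : Set.BijOn idx I.waypoints (Set.Iio #I.waypoints)

variable {I : DWRP}

theorem isWalk_append {u v w : Fin I.n} {es es' : List (Fin I.m)} (h : I.IsWalk u es v)
    (h' : I.IsWalk v es' w) : I.IsWalk u (es ++ es') w := by
  induction es generalizing u with
  | nil => cases h; exact h'
  | cons e es ih => exact ⟨h.1, ih h.2⟩

theorem isWalk_of_append {u w : Fin I.n} {es es' : List (Fin I.m)} (h : I.IsWalk u (es ++ es') w) :
    ∃ v, I.IsWalk u es v ∧ I.IsWalk v es' w := by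
  induction es generalizing u with
  | nil => exact ⟨u, rfl, h⟩
  | cons e es ih =>
    obtain ⟨v, h1, h2⟩ := ih h.2
    exact ⟨v, ⟨h.1, h1⟩, h2⟩

theorem isWalk_end {u v : Fin I.n} {es : List (Fin I.m)} (h : I.IsWalk u es v) :
    v = u ∨ ∃ e ∈ es, I.dst e = v := by
  induction es generalizing u with
  | nil => exact Or.inl h.symm
  | cons e es ih =>
    rcases ih h.2 with h1 | ⟨e', h1, h2⟩
    · exact Or.inr ⟨e, by simp, h1.symm⟩
    · exact Or.inr ⟨e', by simp [h1], h2⟩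

variable {k t : ℕ} {w₀ : Fin I.n} {idx : Fin I.n → ℕ} {col : ℕ → ℕ → ℕ} {S : Search}

/-- Bits below `t` are colours and the next `#I.waypoints` bits are waypoints. The increment acts
above them, so it does not interfere. -/
theorem Fits.testBit_next (hS : Fits I k t w₀ idx col S) {Y i : ℕ} {e : Fin I.m} (hi : i < k)
    (hbit : Y / S.bit e i % 2 = 0) {j : ℕ} (hj : j < t + #I.waypoints) :
    (S.next Y e i).testBit j = true ↔ Y.testBit j = true ∨ j = col e i ∨
      (I.dst e ∈ I.waypoints ∧ j = t + idx (I.dst e)) := by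
  rw [hS.bit e i hi] at hbit
  rw [Search.next, hS.dst, hS.wbit, hS.bit e i hi, hS.inc, add_two_pow_eq_or hbit]
  split_ifs with hw
  · rw [addBit_two_pow, Nat.testBit_or, testBit_add_two_pow hj, Nat.testBit_or,
      Nat.testBit_two_pow, Nat.testBit_two_pow]
    simp only [Bool.or_eq_true, decide_eq_true_eq, hw, true_and, or_assoc, @eq_comm ℕ j]
  · rw [addBit_zero, testBit_add_two_pow hj, Nat.testBit_or, Nat.testBit_two_pow]
    simp only [Bool.or_eq_true, decide_eq_true_eq, hw, false_and, or_false, @eq_comm ℕ j]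

/-- The part of the mask above colours and waypoints counts steps, as setting a lower bit never
causes a carry. -/
theorem Fits.next_div (hS : Fits I k t w₀ idx col S) {Y i : ℕ} {e : Fin I.m} (hi : i < k)
    (hbit : Y / S.bit e i % 2 = 0) :
    S.next Y e i / 2 ^ (t + #I.waypoints) = Y / 2 ^ (t + #I.waypoints) + 1 := by
  have hc := hS.col_lt e i hi
  rw [hS.bit e i hi] at hbit
  have h1 : (Y + 2 ^ col e i + 2 ^ (t + #I.waypoints)) / 2 ^ (t + #I.waypoints) =
      Y / 2 ^ (t + #I.waypoints) + 1 := by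
    rw [Nat.add_div_right _ (by positivity), add_two_pow_eq_or hbit, or_two_pow_div (by omega)]
  rw [Search.next, hS.dst, hS.wbit, hS.bit e i hi, hS.inc]
  split_ifs with hw
  · have := hS.bij.mapsTo (mem_coe.2 hw)
    rw [Set.mem_Iio] at this
    rw [addBit_two_pow, or_two_pow_div (by omega), h1]
  · rw [addBit_zero, h1]

theorem Fits.start_div (hS : Fits I k t w₀ idx col S) :
    S.wbit S.start / 2 ^ (t + #I.waypoints) = 0 := by
  rw [hS.start, hS.wbit, if_pos hS.mem]
  have := hS.bij.mapsTo (mem_coe.2 hS.mem)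
  rw [Set.mem_Iio] at this
  exact Nat.div_eq_of_lt (Nat.pow_lt_pow_right (by norm_num) (by omega))

/-- A configuration that can be reached comes from a walk. -/
theorem Fits.exists_walk (hS : Fits I k t w₀ idx col S) {v Y d : ℕ} (h : Reach S v Y d) :
    ∃ (x : Fin I.n) (zs : List (Fin I.m × ℕ)), (x : ℕ) = v ∧
      I.IsWalk w₀ (zs.map Prod.fst) x ∧ ((zs.map Prod.fst).map I.weight).sum = d ∧
      zs.length = Y / 2 ^ (t + #I.waypoints) ∧ zs.Nodup ∧
      (∀ z ∈ zs, z.2 < I.capacity z.1 ∧ col z.1 z.2 < t ∧ Y.testBit (col z.1 z.2) = true) ∧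
      ∀ x ∈ I.waypoints, Y.testBit (t + idx x) = true → x = w₀ ∨ ∃ e ∈ zs.map Prod.fst, I.dst e = x := by
  induction h with
  | start =>
    refine ⟨w₀, [], hS.start.symm, rfl, rfl, hS.start_div.symm, by simp, by simp, ?_⟩
    intro x hx hbit
    rw [hS.start, hS.wbit, if_pos hS.mem, Nat.testBit_two_pow] at hbit
    left
    refine hS.bij.injOn (mem_coe.2 hx) (mem_coe.2 hS.mem) ?_
    simp at hbit; omega
  | @step Y d e i h he hi hcap hbit hlt ih =>
    obtain ⟨x, zs, h1, h2, h3, h4, h5, h6, h7⟩ := ih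
    rw [hS.m_eq] at he
    rw [hS.k_eq] at hi
    obtain ⟨e, rfl⟩ : ∃ e' : Fin I.m, (e' : ℕ) = e := ⟨⟨e, he⟩, rfl⟩
    have hx : I.src e = x := Fin.ext (by rw [h1, hS.src])
    have hc := hS.col_lt e i hi
    refine ⟨I.dst e, zs ++ [(e, i)], (hS.dst e).symm, ?_, ?_, ?_, ?_, ?_, ?_⟩
    · rw [List.map_append]
      exact isWalk_append h2 ⟨hx, rfl⟩
    · simp [hS.wgt] at h3 ⊢
      exact h3
    · rw [List.length_append, h4, hS.next_div hi hbit]; rfl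
    -- The colour of a copy used before is set in the mask, whereas the colour of the new copy is
    -- not; so the copy is new.
    · rw [List.nodup_append]
      refine ⟨h5, by simp, ?_⟩
      rintro z hz z' hz' rfl
      obtain rfl : z = (e, i) := by simpa using hz'
      have := (h6 _ hz).2.2
      rw [Nat.testBit_eq_decide_div_mod_eq] at this
      rw [hS.bit e i hi] at hbit
      simp [hbit] at this
    · intro z hz
      rcases List.mem_append.1 hz with hz | hz
      · refine ⟨(h6 z hz).1, ?_⟩
        have hk := (h6 z hz).2.1
        exact ⟨hk, (hS.testBit_next hi hbit (by omega)).2 (Or.inl (h6 z hz).2.2)⟩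
      · obtain rfl : z = (e, i) := by simpa using hz
        refine ⟨by simpa [hS.cap] using hcap, hc, ?_⟩
        exact (hS.testBit_next hi hbit (by dsimp only; omega)).2 (Or.inr (Or.inl rfl))
    · intro x hx hb
      have hi' := hS.bij.mapsTo (mem_coe.2 hx)
      rw [Set.mem_Iio] at hi'
      rw [hS.testBit_next hi hbit (by omega)] at hb
      rcases hb with hb | hb | ⟨hw, hb⟩
      · rcases h7 x hx hb with h | ⟨e', h, h'⟩
        · exact Or.inl h
        · exact Or.inr ⟨e', by simp at h ⊢; tauto, h'⟩
      · omega
      · refine Or.inr ⟨e, by simp, ?_⟩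
        exact (hS.bij.injOn (mem_coe.2 hx) (mem_coe.2 hw) (by omega)).symm

/-- The copies used are distinct and have indices below the capacity, so each edge is used often
enough only as its capacity allows. The bound `S.tot` limits the step counter to `k`. -/
theorem Fits.hasSolution (hS : Fits I k t w₀ idx col S) {Y d : ℕ} (h : Reach S w₀ Y d)
    (hY : Y < S.tot) (hfull : Y / 2 ^ t % 2 ^ #I.waypoints = 2 ^ #I.waypoints - 1)
    (hd : d ≤ I.budget) : I.HasSolutionOfSize k := by
  obtain ⟨x, zs, h1, h2, h3, h4, h5, h6, h7⟩ := hS.exists_walk h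
  obtain rfl : x = w₀ := Fin.ext h1
  refine ⟨x, zs.map Prod.fst, ⟨h2, ?_, ?_, h3.le.trans hd⟩, ?_⟩
  · intro y hy
    refine h7 y hy ?_
    have hi' := hS.bij.mapsTo (mem_coe.2 hy)
    rw [Set.mem_Iio] at hi'
    have := congrArg (fun a => a.testBit (idx y)) hfull
    simp only [Nat.testBit_mod_two_pow, Nat.testBit_div_two_pow, Nat.testBit_two_pow_sub_one] at this
    simpa [hi', add_comm] using this
  · intro e
    have h8 : (zs.map Prod.fst).count e = ((zs.filter (fun z => z.1 = e)).map Prod.snd).length := by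
      rw [List.count, List.countP_map, List.length_map, List.countP_eq_length_filter]
      congr 1
    have h9 : ((zs.filter (fun z => z.1 = e)).map Prod.snd).Nodup := by
      refine List.Nodup.map_on ?_ (h5.filter _)
      rintro ⟨a, b⟩ ha ⟨c, d⟩ hc hbd
      simp at ha hc hbd
      simp [ha.2, hc.2, hbd]
    rw [h8, ← List.toFinset_card_of_nodup h9]
    calc _ ≤ #(range (I.capacity e)) := by
          refine card_le_card fun j hj => ?_
          simp only [List.mem_toFinset, List.mem_map, List.mem_filter] at hj
          obtain ⟨z, ⟨hz, hze⟩, rfl⟩ := hj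
          have := (h6 z hz).1
          simp at hze
          rw [hze] at this
          exact mem_range.2 this
      _ = I.capacity e := card_range _
  · rw [List.length_map, h4]
    rw [hS.tot] at hY
    have := Nat.div_lt_of_lt_mul hY
    omega

/-- A solution can be started in any waypoint. -/
theorem exists_isSolution_at {u : Fin I.n} {es : List (Fin I.m)} (h : I.IsSolution u es)
    (hw : w₀ ∈ I.waypoints) : ∃ es', I.IsSolution w₀ es' ∧ es'.length = es.length := by
  rcases h.visits w₀ hw with rfl | ⟨e, he, rfl⟩
  · exact ⟨es, h, rfl⟩
  obtain ⟨l₁, l₂, rfl⟩ := List.append_of_mem he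
  obtain ⟨v, h1, h2, h3⟩ := isWalk_of_append h.closed
  -- The closed walk is rotated to start at the head of `e`; this permutes its edges, so weight,
  -- length and multiplicities are unchanged.
  have hperm : (l₂ ++ (l₁ ++ [e])).Perm (l₁ ++ e :: l₂) := by
    refine List.perm_append_comm.trans ?_
    simp
  refine ⟨l₂ ++ (l₁ ++ [e]), ⟨isWalk_append h3 (isWalk_append h1 ⟨h2, rfl⟩), ?_, ?_, ?_⟩,
    hperm.length_eq⟩
  · intro x hx
    rcases h.visits x hx with rfl | ⟨e', he', hxe⟩
    · rcases isWalk_end h3 with h4 | ⟨e', h4, h5⟩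
      · exact Or.inl h4
      · exact Or.inr ⟨e', by simp [h4], h5⟩
    · exact Or.inr ⟨e', hperm.mem_iff.2 he', hxe⟩
  · intro e'
    rw [hperm.count_eq]
    exact h.within_capacity e'
  · rw [(hperm.map _).sum_eq]
    exact h.within_budget

/-- The copies of edges that a walk uses. -/
def copies (es : List (Fin I.m)) : Finset (ℕ × ℕ) :=
  univ.biUnion fun e : Fin I.m => (range (es.count e)).image fun i => ((e : ℕ), i)

theorem mem_copies {es : List (Fin I.m)} {z : ℕ × ℕ} :
    z ∈ copies es ↔ ∃ e : Fin I.m, (e : ℕ) = z.1 ∧ z.2 < es.count e := by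
  obtain ⟨a, b⟩ := z
  simp only [copies, mem_biUnion, mem_univ, true_and, mem_image, mem_range, Prod.mk.injEq]
  constructor
  · rintro ⟨e, i, hi, rfl, rfl⟩; exact ⟨e, rfl, hi⟩
  · rintro ⟨e, rfl, hi⟩; exact ⟨e, b, hi, rfl, rfl⟩

theorem card_copies_le (es : List (Fin I.m)) : #(copies es) ≤ es.length := by
  refine card_biUnion_le.trans ?_
  calc ∑ e : Fin I.m, #((range (es.count e)).image fun i => ((e : ℕ), i))
      ≤ ∑ e : Fin I.m, es.count e := sum_le_sum fun e _ => by
        simpa using card_image_le (s := range (es.count e)) (f := fun i => ((e : ℕ), i))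
    _ = es.length := by
      have := Multiset.sum_count_eq_card (s := univ) (m := (es : Multiset (Fin I.m)))
        (fun a _ => mem_univ a)
      simpa using this

/-- A walk whose copies of edges have different colours can be found. -/
theorem Fits.exists_reach_prefix (hS : Fits I k t w₀ idx col S) {es : List (Fin I.m)}
    (hlen : es.length ≤ k) (hcap : ∀ e, es.count e ≤ I.capacity e)
    (hinj : Set.InjOn (fun z : ℕ × ℕ => col z.1 z.2) (copies es)) :
    ∀ (pre : List (Fin I.m)) {x : Fin I.n}, pre <+: es → I.IsWalk w₀ pre x →
      ∃ Y, Reach S x Y (pre.map I.weight).sum ∧ Y / 2 ^ (t + #I.waypoints) = pre.length ∧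
        (∀ j < t, Y.testBit j = true → ∃ e i, i < pre.count e ∧ col e i = j) ∧
        ∀ y ∈ I.waypoints, (y = w₀ ∨ ∃ e ∈ pre, I.dst e = y) → Y.testBit (t + idx y) = true := by
  intro pre
  induction pre using List.reverseRecOn with
  | nil =>
    rintro x - rfl
    refine ⟨S.wbit S.start, ?_, hS.start_div, ?_, ?_⟩
    · have := Reach.start (S := S)
      nth_rw 1 [hS.start] at this
      exact this
    · intro j hj hb
      rw [hS.start, hS.wbit, if_pos hS.mem, Nat.testBit_two_pow] at hb
      simp at hb; omega
    · rintro y hy (rfl | ⟨e, h, -⟩)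
      · rw [hS.start, hS.wbit, if_pos hS.mem, Nat.testBit_two_pow]; simp
      · simp at h
  | append_singleton pre e ih =>
    intro x hpre hwalk
    obtain ⟨v, hv, hsrc, hdst⟩ := isWalk_of_append hwalk
    cases hdst
    obtain ⟨Y, h1, h2, h3, h4⟩ := ih ((List.prefix_append _ _).trans hpre) hv
    -- The next occurrence of `e` uses the copy numbered by its earlier occurrences.
    set i := pre.count e with hi
    have hcount : i < es.count e := by
      have := hpre.sublist.count_le e
      simp at this
      omega
    have hik : i < k := lt_of_lt_of_le hcount ((List.count_le_length).trans hlen)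
    have hc := hS.col_lt e i hik
    -- If the colour were taken, injectivity would make the copy that took it equal to `(e, i)`, but
    -- only the copies `0, …, i - 1` of `e` have been used.
    have hbit : Y / S.bit e i % 2 = 0 := by
      by_contra hne
      have hb : Y.testBit (col e i) = true := by
        rw [hS.bit e i hik] at hne
        rw [Nat.testBit_eq_decide_div_mod_eq]
        simp; omega
      obtain ⟨e', i', hi', hcol⟩ := h3 _ hc hb
      have hlt : i' < es.count e' :=
        lt_of_lt_of_le hi' (((List.prefix_append _ _).trans hpre).sublist.count_le e')
      have := hinj (mem_coe.2 (mem_copies.2 ⟨e', rfl, hlt⟩) : ((e' : ℕ), i') ∈ _)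
        (mem_coe.2 (mem_copies.2 ⟨e, rfl, hcount⟩) : ((e : ℕ), i) ∈ _) hcol
      simp only [Prod.mk.injEq] at this
      obtain ⟨h5, rfl⟩ := this
      obtain rfl := Fin.ext h5
      omega
    have hlen' : pre.length + 1 ≤ k := by
      have := hpre.length_le
      simp at this
      omega
    have hdiv := hS.next_div hik hbit
    have hlt : S.next Y e i < S.tot := by
      rw [hS.tot, mul_comm]
      refine (Nat.div_lt_iff_lt_mul (by positivity)).1 ?_
      rw [hdiv, h2]; omega
    refine ⟨S.next Y e i, ?_, ?_, ?_, ?_⟩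
    · have := Reach.step (S := S) (e := e) (i := i) (Y := Y) (d := (pre.map I.weight).sum)
        (by rw [hS.src, hsrc]; exact h1) (by rw [hS.m_eq]; exact e.2) (by rwa [hS.k_eq])
        (by rw [hS.cap]; exact lt_of_lt_of_le hcount (hcap e)) hbit hlt
      rw [hS.dst, hS.wgt] at this
      simpa using this
    · rw [hdiv, h2]; simp
    · intro j hj hb
      rw [hS.testBit_next hik hbit (by omega)] at hb
      rcases hb with hb | rfl | ⟨-, hb⟩
      · obtain ⟨e', i', h5, h6⟩ := h3 j hj hb
        exact ⟨e', i', by simp; omega, h6⟩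
      · exact ⟨e, i, by simp [hi], rfl⟩
      · omega
    · intro y hy hv
      have hi' := hS.bij.mapsTo (mem_coe.2 hy)
      rw [Set.mem_Iio] at hi'
      rw [hS.testBit_next hik hbit (by omega)]
      rcases hv with hv | ⟨e', he', rfl⟩
      · exact Or.inl (h4 y hy (Or.inl hv))
      · rcases List.mem_append.1 he' with he' | he'
        · exact Or.inl (h4 _ hy (Or.inr ⟨e', he', rfl⟩))
        · obtain rfl : e' = e := by simpa using he'
          exact Or.inr (Or.inr ⟨hy, rfl⟩)

/-- If a solution exists, it is found with every colouring that separates a certain small set. -/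
theorem exists_copies (h : I.HasSolutionOfSize k) (hw : w₀ ∈ I.waypoints) :
    ∃ Z : Finset (ℕ × ℕ), #Z ≤ k ∧ (∀ z ∈ Z, z.1 < I.m ∧ z.2 < k) ∧
      ∀ {t : ℕ} {idx : Fin I.n → ℕ} {col : ℕ → ℕ → ℕ} {S : Search}, Fits I k t w₀ idx col S →
        Set.InjOn (fun z : ℕ × ℕ => col z.1 z.2) Z →
        ∃ Y d, Reach S w₀ Y d ∧ Y < S.tot ∧ d ≤ I.budget ∧
          Y / 2 ^ t % 2 ^ #I.waypoints = 2 ^ #I.waypoints - 1 := by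
  obtain ⟨u, es₀, h0, hlen₀⟩ := h
  obtain ⟨es, hes, hlen⟩ := exists_isSolution_at h0 hw
  rw [← hlen] at hlen₀
  -- The set is fixed by the solution before any colouring is considered, so a colouring can be
  -- chosen to separate it.
  refine ⟨copies es, (card_copies_le es).trans hlen₀, ?_, ?_⟩
  · intro z hz
    obtain ⟨e, h1, h2⟩ := mem_copies.1 hz
    exact ⟨h1 ▸ e.2, lt_of_lt_of_le h2 (List.count_le_length.trans hlen₀)⟩
  · intro t idx col S hS hinj
    obtain ⟨Y, h1, h2, h3, h4⟩ := hS.exists_reach_prefix hlen₀ hes.within_capacity hinj es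
      List.prefix_rfl hes.closed
    refine ⟨Y, _, h1, ?_, hes.within_budget, ?_⟩
    · rw [hS.tot, mul_comm]
      refine (Nat.div_lt_iff_lt_mul (by positivity)).1 ?_
      omega
    · apply Nat.eq_of_testBit_eq
      intro j
      rw [Nat.testBit_mod_two_pow, Nat.testBit_div_two_pow, Nat.testBit_two_pow_sub_one]
      by_cases hj : j < #I.waypoints
      · obtain ⟨y, hy, rfl⟩ := hS.bij.surjOn (Set.mem_Iio.2 hj)
        simp [hj, add_comm (idx y), h4 y hy (hes.visits y hy)]
      · simp [hj]

/-! ### Bounds -/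

/-- As masks strictly increase, their natural order is a topological order of the configurations,
and the search needs no priority queue. -/
theorem Search.lt_next {S : Search} {Y e i : ℕ} (hinc : 0 < S.inc) : Y < S.next Y e i := by
  unfold Search.next addBit
  split_ifs <;> omega

/-- There are at most `Y` steps up to mask `Y`. This crude estimate only limits the size of the
table entries. -/
theorem Reach.weight_le {S : Search} {B v Y d : ℕ} (hinc : 0 < S.inc)
    (hB : ∀ e < S.m, S.wgt e ≤ B) (h : Reach S v Y d) : d ≤ Y * B := by
  induction h with
  | start => simp
  | @step Y d e i h he hi hcap hbit hlt ih =>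
    have h1 := S.lt_next (Y := Y) (e := e) (i := i) hinc
    have h2 := hB e he
    calc d + S.wgt e ≤ Y * B + B := by omega
      _ = (Y + 1) * B := by ring
      _ ≤ _ := Nat.mul_le_mul_right _ h1

end RouteSearch

namespace RouteSearch

/-! ### Tables of distances -/

/-- The entry for copy `i` of `e` from mask `Y` has been taken into account in the table `A`. -/
def Closed (S : Search) (n : ℕ) (A : ℕ → ℕ) (Y e i : ℕ) : Prop :=
  i < S.cap e → Y / S.bit e i % 2 = 0 → S.next Y e i < S.tot → 0 < A (Y * n + S.src e) →
    0 < A (S.next Y e i * n + S.dst e) ∧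
      A (S.next Y e i * n + S.dst e) ≤ A (Y * n + S.src e) + S.wgt e

/-- The table `A` contains for every vertex and every mask zero or one more than the weight of
some way to reach it, and all entries before `(Y, e, i)` have been taken into account. -/
structure Table (S : Search) (n Y e i : ℕ) (A : ℕ → ℕ) : Prop where
  sound : ∀ v < n, ∀ Y' < S.tot, 0 < A (Y' * n + v) → ∃ d, Reach S v Y' d ∧ A (Y' * n + v) = d + 1
  start : A (S.wbit S.start * n + S.start) = 1
  closed : ∀ Y' e' i', e' < S.m → i' < S.k →
    (Y' < Y ∨ Y' = Y ∧ (e' < e ∨ e' = e ∧ i' < i)) → Closed S n A Y' e' i'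

/-- Lowers the entry at `c` to `a`. -/
def lower (A : ℕ → ℕ) (c a : ℕ) : ℕ → ℕ :=
  if A c = 0 ∨ a < A c then Function.update A c a else A

theorem lower_of_ne (A : ℕ → ℕ) {c a c' : ℕ} (h : c' ≠ c) : lower A c a c' = A c' := by
  unfold lower; split_ifs <;> simp [h]

theorem lower_le (A : ℕ → ℕ) {c a : ℕ} (ha : 0 < a) (c' : ℕ) (h : 0 < A c') :
    0 < lower A c a c' ∧ lower A c a c' ≤ A c' := by
  by_cases hc : c' = c
  · subst hc
    unfold lower
    split_ifs with h'
    · simp; omega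
    · omega
  · rw [lower_of_ne A hc]; omega

theorem lower_self (A : ℕ → ℕ) {c a : ℕ} (ha : 0 < a) : 0 < lower A c a c ∧ lower A c a c ≤ a := by
  unfold lower
  split_ifs with h'
  · simp; omega
  · omega

theorem cell_inj {n Y v Y' v' : ℕ} (hv : v < n) (hv' : v' < n) (h : Y * n + v = Y' * n + v') :
    Y = Y' ∧ v = v' := by
  have hn : 0 < n := by omega
  have h1 : (Y * n + v) / n = Y := by
    rw [add_comm, Nat.add_mul_div_right _ _ hn, Nat.div_eq_of_lt hv, zero_add]
  have h2 : (Y' * n + v') / n = Y' := by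
    rw [add_comm, Nat.add_mul_div_right _ _ hn, Nat.div_eq_of_lt hv', zero_add]
  have : Y = Y' := by rw [← h1, ← h2, h]
  subst this
  exact ⟨rfl, by omega⟩

/-- Bounds for the numbers of a search on `n` vertices with weights at most `B`. -/
structure Search.Bounded (S : Search) (n B : ℕ) : Prop where
  src_lt : ∀ e < S.m, S.src e < n
  dst_lt : ∀ e < S.m, S.dst e < n
  start_lt : S.start < n
  wgt_le : ∀ e < S.m, S.wgt e ≤ B
  bit_le : ∀ e < S.m, ∀ i < S.k, S.bit e i ≤ S.inc
  wbit_le : ∀ v < n, S.wbit v ≤ S.inc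
  inc_pos : 0 < S.inc
  inc_lt : S.inc < S.tot

variable {S : Search} {n B : ℕ}

/-- An edge whose tail is not reached with mask `Y` has nothing to contribute, since `Closed`
presupposes a positive entry. -/
theorem Table.skip {Y e : ℕ} {A : ℕ → ℕ} (h : Table S n Y e 0 A)
    (h0 : ¬ 0 < A (Y * n + S.src e)) : Table S n Y (e + 1) 0 A where
  sound := h.sound
  start := h.start
  closed Y' e' i' he hi hlt := by
    by_cases hc : Y' = Y ∧ e' = e
    · obtain ⟨rfl, rfl⟩ := hc
      intro _ _ _ h4
      exact absurd h4 h0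
    · exact h.closed Y' e' i' he hi (by omega)

theorem Table.next_edge {Y e : ℕ} {A : ℕ → ℕ} (h : Table S n Y e S.k A) :
    Table S n Y (e + 1) 0 A where
  sound := h.sound
  start := h.start
  closed Y' e' i' he hi hlt := h.closed Y' e' i' he hi (by omega)

theorem Table.next_mask {Y : ℕ} {A : ℕ → ℕ} (h : Table S n Y S.m 0 A) :
    Table S n (Y + 1) 0 0 A where
  sound := h.sound
  start := h.start
  closed Y' e' i' he hi hlt := h.closed Y' e' i' he hi (by omega)

theorem Table.init (hs : S.start < n) {A : ℕ → ℕ} (hA : ∀ c < S.tot * n, A c = 0) :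
    Table S n 0 0 0 (Function.update A (S.wbit S.start * n + S.start) 1) where
  sound v hv Y' hY h := by
    by_cases hc : Y' * n + v = S.wbit S.start * n + S.start
    · obtain ⟨rfl, rfl⟩ := cell_inj hv hs hc
      exact ⟨0, .start, by simp⟩
    · rw [Function.update_of_ne hc, hA _ (by nlinarith)] at h
      omega
  start := by simp
  closed Y' e' i' he hi hlt := by omega

theorem Table.step_skip {Y e i : ℕ} {A : ℕ → ℕ} (h : Table S n Y e i A)
    (h0 : ¬ (i < S.cap e ∧ Y / S.bit e i % 2 = 0 ∧ S.next Y e i < S.tot)) :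
    Table S n Y e (i + 1) A where
  sound := h.sound
  start := h.start
  closed Y' e' i' he hi hlt := by
    by_cases hc : Y' = Y ∧ e' = e ∧ i' = i
    · obtain ⟨rfl, rfl, rfl⟩ := hc
      intro h1 h2 h3
      exact absurd ⟨h1, h2, h3⟩ h0
    · exact h.closed Y' e' i' he hi (by omega)

/-- The target has a larger mask, so all entries for masks up to `Y` are final and the sources
already handled keep their values. Targets can only decrease, which preserves their inequalities. -/
theorem Table.step_lower (hS : S.Bounded n B) {Y e i d : ℕ} {A : ℕ → ℕ} (h : Table S n Y e i A)
    (he : e < S.m) (hi : i < S.k) (hd : A (Y * n + S.src e) = d) (hd0 : 0 < d)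
    (h1 : i < S.cap e) (h2 : Y / S.bit e i % 2 = 0) (h3 : S.next Y e i < S.tot) :
    Table S n Y e (i + 1) (lower A (S.next Y e i * n + S.dst e) (d + S.wgt e)) ∧
      lower A (S.next Y e i * n + S.dst e) (d + S.wgt e) (Y * n + S.src e) = d := by
  have hlt := Search.lt_next (Y := Y) (e := e) (i := i) hS.inc_pos
  have hpos : 0 < d + S.wgt e := by omega
  have hold : ∀ Y' ≤ Y, ∀ v < n,
      lower A (S.next Y e i * n + S.dst e) (d + S.wgt e) (Y' * n + v) = A (Y' * n + v) := by
    intro Y' hY' v hv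
    refine lower_of_ne A fun hc => ?_
    have := (cell_inj hv (hS.dst_lt e he) hc).1
    omega
  refine ⟨⟨?_, ?_, ?_⟩, by rw [hold Y le_rfl _ (hS.src_lt e he), hd]⟩
  · intro v hv Y' hYt hA
    by_cases hc : Y' * n + v = S.next Y e i * n + S.dst e
    · by_cases hl : A (S.next Y e i * n + S.dst e) = 0 ∨
          d + S.wgt e < A (S.next Y e i * n + S.dst e)
      · obtain ⟨rfl, rfl⟩ := cell_inj hv (hS.dst_lt e he) hc
        obtain ⟨d', hd', hd''⟩ := h.sound _ (hS.src_lt e he) Y (by omega) (by omega)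
        refine ⟨d' + S.wgt e, .step hd' he hi h1 h2 h3, ?_⟩
        simp [lower, hl]; omega
      · rw [lower, if_neg hl] at hA ⊢
        exact h.sound v hv Y' hYt hA
    · rw [lower_of_ne A hc] at hA ⊢
      exact h.sound v hv Y' hYt hA
  · have := lower_le A hpos (c := S.next Y e i * n + S.dst e) _
      (show 0 < A (S.wbit S.start * n + S.start) by rw [h.start]; omega)
    rw [h.start] at this
    omega
  · intro Y' e' i' he' hi' hlt' g1 g2 g3 g4
    have hY' : Y' ≤ Y := by omega
    rw [hold Y' hY' _ (hS.src_lt e' he')] at g4 ⊢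
    by_cases hc : Y' = Y ∧ e' = e ∧ i' = i
    · obtain ⟨rfl, rfl, rfl⟩ := hc
      rw [hd]
      exact lower_self A hpos
    · obtain ⟨k1, k2⟩ := h.closed Y' e' i' he' hi' (by omega) g1 g2 g3 g4
      obtain ⟨k3, k4⟩ := lower_le A hpos (c := S.next Y e i * n + S.dst e) _ k1
      exact ⟨k3, k4.trans k2⟩

/-- Along a way to the configuration each step is covered by closedness, because all its masks are
below `S.tot`. -/
theorem Table.complete (hS : S.Bounded n B) {A : ℕ → ℕ} (h : Table S n S.tot 0 0 A) {v Y d : ℕ}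
    (hr : Reach S v Y d) (hY : Y < S.tot) : 0 < A (Y * n + v) ∧ A (Y * n + v) ≤ d + 1 := by
  induction hr with
  | start => rw [h.start]; omega
  | @step Y d e i hr he hi hcap hbit hlt ih =>
    have hY' := Search.lt_next (Y := Y) (e := e) (i := i) hS.inc_pos
    obtain ⟨k1, k2⟩ := ih (by omega)
    obtain ⟨k3, k4⟩ := h.closed Y e i he hi (Or.inl (by omega)) hcap hbit hlt k1
    exact ⟨k3, by omega⟩

theorem Table.le (hS : S.Bounded n B) {Y e i : ℕ} {A : ℕ → ℕ} (h : Table S n Y e i A) {v Y' : ℕ}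
    (hv : v < n) (hY : Y' < S.tot) : A (Y' * n + v) ≤ Y' * B + 1 := by
  rcases Nat.eq_zero_or_pos (A (Y' * n + v)) with h0 | h0
  · omega
  · obtain ⟨d, hd, hd'⟩ := h.sound v hv Y' hY h0
    have := hd.weight_le hS.inc_pos hS.wgt_le
    omega

end RouteSearch

namespace LoopLang

open RouteSearch

/-! ### The program for a search -/

/-- The table is reused for every colouring and must be cleared; the single entry `1` stands for
weight zero at the start. -/
def clearCmd : Cmd :=
  .rep .a (♯.tot * ♯.n) (.put .dist ♯.a 0) ;;
  .put .dist (.get .wbit ♯.w0 * ♯.n + ♯.w0) 1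

/-- Traverses copy `i` of the edge `e` from `src` with mask `Y`. -/
def copyCmd : Cmd :=
  .ite (.lt ♯.i ♯.cap) (
    .set .c (.get .code (♯.e * ♯.k + ♯.i)) ;;
    .ite (.eq (♯.Y / ♯.c % .lit 2) 0) (
      (.set .Y' (♯.Y + ♯.c + ♯.two_u) ;; .set .p (.get .wbit ♯.dst) ;;
        .ite (.eq (♯.Y' / ♯.p % .lit 2) 0) (.set .Y' (♯.Y' + ♯.p)) .skip) ;;
      .ite (.lt ♯.Y' ♯.tot) (
        (.set .c' (♯.Y' * ♯.n + ♯.dst) ;; .set .num (♯.d + ♯.wgt) ;;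
          .set .y (.get .dist ♯.c')) ;;
        .ite (.eq ♯.y 0) (.put .dist ♯.c' ♯.num)
          (.ite (.lt ♯.num ♯.y) (.put .dist ♯.c' ♯.num) .skip)) .skip) .skip) .skip

/-- The offsets `4, …, 7` follow the layout of `DWRP.encode`. Copies are tried only if the tail of
the edge is reached. -/
def edgeCmd : Cmd :=
  .set .src (.inp (.lit 4 + .lit 4 * ♯.e)) ;; .set .d (.get .dist (♯.Y * ♯.n + ♯.src)) ;;
  .ite (.lt 0 ♯.d) (
    (.set .dst (.inp (.lit 5 + .lit 4 * ♯.e)) ;; .set .wgt (.inp (.lit 6 + .lit 4 * ♯.e)) ;;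
      .set .cap (.inp (.lit 7 + .lit 4 * ♯.e))) ;;
    .rep .i ♯.k copyCmd) .skip

def searchCmd : Cmd := clearCmd ;; .rep .Y ♯.tot (.rep .e ♯.m edgeCmd)

/-- The search described by a state. -/
def St.search (σ : St) : Search where
  m := σ.reg .m
  k := σ.reg .k
  src e := σ.inp (4 + 4 * e)
  dst e := σ.inp (5 + 4 * e)
  wgt e := σ.inp (6 + 4 * e)
  cap e := σ.inp (7 + 4 * e)
  bit e i := σ.arr .code (e * σ.reg .k + i)
  wbit := σ.arr .wbit
  inc := σ.reg .two_u
  tot := σ.reg .tot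
  start := σ.reg .w0

theorem Frame.search {P : Cmd} {σ τ : St} {S : Search} (h : Frame P σ τ)
    (hP : ([.m, .k, .two_u, .tot, .w0].all fun x => !P.writes x) = true)
    (hP' : ([.code, .wbit].all fun A => !P.stores A) = true) (hσ : σ.search = S) :
    τ.search = S := by
  simp at hP hP'
  simp [← hσ, St.search, h.reg .m hP.1, h.reg .k hP.2.1, h.reg .two_u hP.2.2.1,
    h.reg .tot hP.2.2.2.1, h.reg .w0 hP.2.2.2.2, h.inp, h.arr .code hP'.1, h.arr .wbit hP'.2]

theorem St.search_set {σ : St} {x : Var} {a : ℕ} {S : Search}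
    (hx : ([.m, .k, .two_u, .tot, .w0].all fun y => !decide (y = x)) = true)
    (hσ : σ.search = S) : (σ.set x a).search = S := by
  simp at hx
  simp [← hσ, St.search, hx]

/-- All numbers that occur in a search are below `V`. -/
structure Search.Small (S : Search) (n B V len : ℕ) : Prop extends S.Bounded n B where
  cells_lt : (S.tot + 1) * (n + 1) < V
  weights_lt : (S.tot + 1) * (B + 1) < V
  masks_lt : S.tot + 3 * S.inc < V
  copies_lt : S.m * S.k < V
  len_le : 4 + 4 * S.m ≤ len
  len_lt : len < V

theorem Search.Small.cell_lt {S : Search} {n B V len Y v : ℕ} (hS : Search.Small S n B V len)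
    (hY : Y < S.tot) (hv : v < n) : Y * n < V ∧ Y * n + v < V := by
  have := hS.cells_lt
  constructor <;> nlinarith

theorem spec_copyCmd {V len n B Y e i d : ℕ} {S : Search} (hS : Search.Small S n B V len) {σ : St}
    (hσ : σ.search = S) (he : e < S.m) (hi : i < S.k) (hY : Y < S.tot) (hd0 : 0 < d)
    (g : σ.Has [(.n, n), (.Y, Y), (.e, e), (.i, i), (.d, d), (.dst, S.dst e), (.wgt, S.wgt e),
      (.cap, S.cap e)])
    (hT : Table S n Y e i (σ.arr .dist)) (hd : σ.arr .dist (Y * n + S.src e) = d) :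
    Spec V len copyCmd 150 σ (fun τ => Table S n Y e (i + 1) (τ.arr .dist) ∧
      τ.arr .dist (Y * n + S.src e) = d) := by
  have skip : ¬ (i < S.cap e ∧ Y / S.bit e i % 2 = 0 ∧ S.next Y e i < S.tot) → ∀ τ : St,
      τ.arr .dist = σ.arr .dist → Spec V len .skip 1 τ (fun τ => Table S n Y e (i + 1) (τ.arr .dist) ∧
      τ.arr .dist (Y * n + S.src e) = d) := by
    intro h0 τ hτ
    refine Spec.flat 1 rfl (by decide) le_rfl trivial ?_
    simp [Cmd.run, hτ, hT.step_skip h0, hd]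
  have hidx : e * S.k + i < V := by
    have := hS.copies_lt
    nlinarith
  have hek : e * S.k < V := by omega
  have hbit := hS.bit_le e he i hi
  have hwb := hS.wbit_le _ (hS.dst_lt e he)
  have hm := hS.masks_lt
  have hds := hS.dst_lt e he
  have hdle := hT.le hS.toBounded (Y' := Y) (hS.src_lt e he) hY
  rw [hd] at hdle
  have hdw : d + S.wgt e < V := by
    have := hS.wgt_le e he
    have := hS.weights_lt
    nlinarith
  have g' := g
  simp [St.Has] at g'
  refine Spec.ite (t := 140) (by simp) (by simp) ?_ ?_ (by simp)
  swap
  · intro h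
    refine (skip (fun h' => h ?_) σ rfl).le (by omega)
    simpa [g'] using h'.1
  intro h1
  replace h1 : i < S.cap e := by simpa [g'] using h1
  have hk : σ.reg .k = S.k := by rw [← hσ]; rfl
  refine Spec.flat_seq (c := 20) (t₂ := 120) rfl (by decide)
    (by simp [Cmd.Ok, g', hk, hidx, hek]) ?_ (by omega)
  intro τ₁ hτ₁ fr₁
  have hc : τ₁.reg .c = S.bit e i := by
    rw [hτ₁, ← hσ]
    simp [Cmd.run, g', St.search]
  have g1 := (g.frame fr₁ rfl).cons hc
  have hσ1 := fr₁.search rfl rfl hσ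
  have hD1 := fr₁.arr .dist rfl
  clear hτ₁ hc g g' hk
  have g' := g1
  simp [St.Has] at g'
  refine Spec.ite (t := 110) (by simp) (by simp) ?_ ?_ (by simp)
  swap
  · intro h
    refine (skip (fun h' => h ?_) τ₁ hD1).le (by omega)
    simpa [g'] using h'.2.1
  intro h2
  replace h2 : Y / S.bit e i % 2 = 0 := by simpa [g'] using h2
  have hinc : τ₁.reg .two_u = S.inc := by rw [← hσ1]; rfl
  have hwbit : τ₁.arr .wbit = S.wbit := by rw [← hσ1]; rfl
  refine Spec.flat_seq (c := 40) (t₂ := 70) rfl (by decide) ?_ ?_ (by omega)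
  · have h3 : Y + S.bit e i < V := by omega
    have h4 : Y + S.bit e i + S.inc < V := by omega
    have h5 : Y + S.bit e i + S.inc + S.wbit (S.dst e) < V := by omega
    by_cases h : (Y + S.bit e i + S.inc) / S.wbit (S.dst e) % 2 = 0
    · simp [Cmd.Ok, Cmd.run, g', hinc, hwbit, h, h3, h4, h5]
    · simp [Cmd.Ok, Cmd.run, g', hinc, hwbit, h, h3, h4]
  intro τ₂ hτ₂ fr₂
  have hY2 : τ₂.reg .Y' = S.next Y e i := by
    rw [hτ₂]
    by_cases h : (Y + S.bit e i + S.inc) / S.wbit (S.dst e) % 2 = 0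
    · simp [Cmd.run, g', hinc, hwbit, h, Search.next, addBit]
    · simp [Cmd.run, g', hinc, hwbit, h, Search.next, addBit]
  have g2 := (g1.frame fr₂ rfl).cons hY2
  have hσ2 := fr₂.search rfl rfl hσ1
  have hD2 := (fr₂.arr .dist rfl).trans hD1
  clear hτ₂ hY2 g1 g' hinc hwbit fr₂ fr₁
  have g' := g2
  simp [St.Has] at g'
  have htot : τ₂.reg .tot = S.tot := by rw [← hσ2]; rfl
  refine Spec.ite (t := 60) (by simp) (by simp) ?_ ?_ (by simp)
  swap
  · intro h
    refine (skip (fun h' => h ?_) τ₂ hD2).le (by omega)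
    simpa [g', htot] using h'.2.2
  intro h3
  replace h3 : S.next Y e i < S.tot := by simpa [g', htot] using h3
  obtain ⟨c1, c2⟩ := hS.cell_lt h3 hds
  have key := hT.step_lower hS.toBounded he hi hd hd0 h1 h2 h3
  refine Spec.flat 60 rfl (by decide) le_rfl ?_ ?_
  · by_cases h4 : σ.arr .dist (S.next Y e i * n + S.dst e) = 0
    · simp [Cmd.Ok, Cmd.run, g', hD2, c1, c2, hdw, h4]
    · simp [Cmd.Ok, Cmd.run, g', hD2, c1, c2, hdw, h4]
  · convert key using 2 <;>
    by_cases h4 : σ.arr .dist (S.next Y e i * n + S.dst e) = 0 <;>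
    by_cases h5 : d + S.wgt e < σ.arr .dist (S.next Y e i * n + S.dst e) <;>
    simp [Cmd.run, g', hD2, h4, h5, lower]

theorem spec_edgeCmd {V len n B Y e : ℕ} {S : Search} (hS : Search.Small S n B V len) {σ : St}
    (hσ : σ.search = S) (he : e < S.m) (hY : Y < S.tot) (g : σ.Has [(.n, n), (.Y, Y), (.e, e)])
    (hT : Table S n Y e 0 (σ.arr .dist)) :
    Spec V len edgeCmd (S.k * 155 + 100) σ (fun τ => Table S n Y (e + 1) 0 (τ.arr .dist)) := by
  have g' := g
  simp [St.Has] at g'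
  have hlen := hS.len_le
  have hlen' := hS.len_lt
  obtain ⟨c1, c2⟩ := hS.cell_lt hY (hS.src_lt e he)
  have hin (τ : St) (hτ : τ.search = S) : τ.inp (4 + 4 * e) = S.src e ∧ τ.inp (5 + 4 * e) = S.dst e ∧
      τ.inp (6 + 4 * e) = S.wgt e ∧ τ.inp (7 + 4 * e) = S.cap e := by rw [← hτ]; simp [St.search]
  have d1 := hin σ hσ
  refine Spec.flat_seq (c := 10) (t₂ := S.k * 155 + 80) rfl (by decide) ?_ ?_ (by omega)
  · simp [Cmd.Ok, g']; omega
  intro τ₁ hτ₁ fr₁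
  have h1 : τ₁.reg .src = S.src e := by simp [hτ₁, Cmd.run, g', d1]
  have g1 := (g.frame fr₁ rfl).cons h1
  have hσ1 := fr₁.search rfl rfl hσ
  rw [← fr₁.arr .dist rfl] at hT
  clear hτ₁ h1 g g' fr₁
  have g' := g1
  simp [St.Has] at g'
  refine Spec.flat_seq (c := 20) (t₂ := S.k * 155 + 60) rfl (by decide) ?_ ?_ (by omega)
  · simp [Cmd.Ok, g', c1, c2]
  intro τ₂ hτ₂ fr₂
  have h1 : τ₂.reg .d = τ₁.arr .dist (Y * n + S.src e) := by simp [hτ₂, Cmd.run, g']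
  have g2 := (g1.frame fr₂ rfl).cons h1
  have hσ2 := fr₂.search rfl rfl hσ1
  rw [← fr₂.arr .dist rfl] at hT g2
  clear hτ₂ h1 g1 g' fr₂ hσ1
  have g' := g2
  simp [St.Has] at g'
  refine Spec.ite (t := S.k * 155 + 50) (by simp) (by simp) ?_ ?_ (by simp; omega)
  swap
  · intro h
    refine Spec.flat 1 rfl (by decide) (by omega) trivial ?_
    refine hT.skip ?_
    simpa [g'] using h
  intro h0
  replace h0 : 0 < τ₂.arr .dist (Y * n + S.src e) := by simpa [g'] using h0
  have d2 := hin τ₂ hσ2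
  refine Spec.flat_seq (c := 30) (t₂ := S.k * 155 + 10) rfl (by decide) ?_ ?_ (by omega)
  · simp [Cmd.Ok, Cmd.run, g']; omega
  intro τ₃ hτ₃ fr₃
  have h1 : τ₃.reg .dst = S.dst e := by simp [hτ₃, Cmd.run, g', d2]
  have h2 : τ₃.reg .wgt = S.wgt e := by simp [hτ₃, Cmd.run, g', d2]
  have h3 : τ₃.reg .cap = S.cap e := by simp [hτ₃, Cmd.run, g', d2]
  have g3 := (((g2.frame fr₃ rfl).cons h1).cons h2).cons h3
  have hσ3 := fr₃.search rfl rfl hσ2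
  have hD := fr₃.arr .dist rfl
  clear hτ₃ h1 h2 h3 g2 g' fr₃ d2
  set d := τ₂.arr .dist (Y * n + S.src e) with hd
  refine Spec.rep (N := S.k) (t := 150)
    (fun i τ => Table S n Y e i (τ.arr .dist) ∧ τ.arr .dist (Y * n + S.src e) = d)
    (by simp) (by rw [← hσ3]; rfl) (by rw [hD]; exact ⟨hT, rfl⟩) ?_
    (fun τ _ h => h.1.next_edge) (by simp [Exp.cost])
  rintro i hi τ fr ⟨hI, hI'⟩
  have g4 := ((g3.frame fr rfl).set (x := .i) (a := i) rfl).cons (x := .i) (a := i) (by simp)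
  refine spec_copyCmd hS (St.search_set rfl (fr.search rfl rfl hσ3)) he hi hY h0 ?_ hI hI'
  intro p hp
  refine g4 p ?_
  simp at hp ⊢
  tauto

theorem spec_clearCmd {V len n B : ℕ} {S : Search} (hS : Search.Small S n B V len) {σ : St}
    (hσ : σ.search = S) (g : σ.Has [(.n, n)]) :
    Spec V len clearCmd (S.tot * n * 20 + 50) σ (fun τ => Table S n 0 0 0 (τ.arr .dist)) := by
  have hcell := hS.cells_lt
  have hn : σ.reg .n = n := g (.n, n) (by simp)
  have htot : σ.reg .tot = S.tot := by rw [← hσ]; rfl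
  refine Spec.seq (t₁ := S.tot * n * 20 + 10) (t₂ := 40)
    (mid := fun τ => ∀ c < S.tot * n, τ.arr .dist c = 0) ?_ ?_ (by omega)
  · refine Spec.rep (N := S.tot * n) (t := 10)
      (fun j τ => ∀ c < j, τ.arr .dist c = 0) ?_ (by simp [hn, htot]) (by simp) ?_
      (fun _ _ h => h) (by simp; omega)
    · simp [hn, htot]; nlinarith
    · intro j hj τ fr hI
      refine Spec.flat 10 rfl (by decide) le_rfl (by simp [Cmd.Ok]) ?_
      intro c hc
      by_cases h : c = j
      · simp [Cmd.run, h]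
      · simp [Cmd.run, Function.update_of_ne h]
        exact hI c (by omega)
  · intro τ fr hτ
    have hσ1 := fr.search rfl rfl hσ
    have h1 : τ.reg .n = n := (fr.reg .n rfl).trans hn
    have h2 : τ.reg .w0 = S.start := by rw [← hσ1]; rfl
    have h3 : τ.arr .wbit = S.wbit := by rw [← hσ1]; rfl
    have h4 : S.wbit S.start < S.tot := (hS.wbit_le _ hS.start_lt).trans_lt hS.inc_lt
    obtain ⟨c1, c2⟩ := hS.cell_lt h4 hS.start_lt
    refine Spec.flat 40 rfl (by decide) le_rfl ?_ ?_
    · simp [Cmd.Ok, h1, h2, h3, c1, c2]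
    · simp only [Cmd.run, Exp.eval_add, Exp.eval_mul, Exp.eval_get, Exp.eval_var, h1, h2, h3,
        St.put_arr, if_true]
      exact Table.init hS.start_lt hτ

theorem spec_searchCmd {V len n B : ℕ} {S : Search} (hS : Search.Small S n B V len) {σ : St}
    (hσ : σ.search = S) (g : σ.Has [(.n, n)]) :
    Spec V len searchCmd (S.tot * (n * 20 + S.m * (S.k * 155 + 105) + 10) + 60) σ
      (fun τ => Table S n S.tot 0 0 (τ.arr .dist)) := by
  refine Spec.seq (spec_clearCmd hS hσ g)
    (t₂ := S.tot * (S.m * (S.k * 155 + 105) + 9) + 4) ?_ (by nlinarith)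
  intro τ fr hT
  have g1 := g.frame fr rfl
  have hσ1 := fr.search rfl rfl hσ
  clear fr g hσ
  refine Spec.rep (N := S.tot) (t := S.m * (S.k * 155 + 105) + 4)
    (fun Y τ => Table S n Y 0 0 (τ.arr .dist))
    (by simp) (by rw [← hσ1]; rfl) hT ?_ (fun τ _ h => h) (by simp [Exp.cost])
  intro Y hY τ₁ fr hT
  have g2 := ((g1.frame fr rfl).set (x := .Y) (a := Y) rfl).cons (x := .Y) (a := Y) (by simp)
  have hσ2 := St.search_set (x := .Y) (a := Y) rfl (fr.search rfl rfl hσ1)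
  clear fr g1 hσ1
  refine Spec.rep (N := S.m) (t := S.k * 155 + 100)
    (fun e τ => Table S n Y e 0 (τ.arr .dist))
    (by simp) (by rw [← hσ2]; rfl) hT ?_ (fun τ _ h => h.next_mask) (by simp [Exp.cost])
  intro e he τ₂ fr hT
  have g3 := ((g2.frame fr rfl).set (x := .e) (a := e) rfl).cons (x := .e) (a := e) (by simp)
  have hσ3 := St.search_set (x := .e) (a := e) rfl (fr.search rfl rfl hσ2)
  refine spec_edgeCmd hS hσ3 he hY ?_ hT
  intro p hp
  refine g3 p ?_
  simp at hp ⊢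
  tauto

/-- Sets `out` to one if the table contains a solution. -/
def verdictCmd : Cmd :=
  .rep .Y ♯.tot (.ite (.eq (♯.Y / ♯.two_t % (♯.full + 1)) ♯.full) (
    .set .d (.get .dist (♯.Y * ♯.n + ♯.w0)) ;;
    .ite (.lt 0 ♯.d) (.ite (.lt ♯.d (♯.b + .lit 2)) (.set .out 1) .skip) .skip) .skip)

open Classical in
theorem spec_verdictCmd {V len n B b two_t full o : ℕ} {S : Search}
    (hS : Search.Small S n B V len) {σ : St} (hσ : σ.search = S)
    (g : σ.Has [(.n, n), (.b, b), (.two_t, two_t), (.full, full), (.out, o)])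
    (hT : Table S n S.tot 0 0 (σ.arr .dist)) (hfull : full + 1 < V) (hb : b + 2 < V) :
    Spec V len verdictCmd (S.tot * 70 + 10) σ (fun τ => τ.reg .out =
      if ∃ Y d, Reach S S.start Y d ∧ Y < S.tot ∧ Y / two_t % (full + 1) = full ∧ d ≤ b
        then 1 else o) := by
  -- Entries are one more than weights, so weight at most `b` means an entry below `b + 2`.
  have key : ∀ Y < S.tot, (∃ d, Reach S S.start Y d ∧ d ≤ b) ↔
      0 < σ.arr .dist (Y * n + S.start) ∧ σ.arr .dist (Y * n + S.start) < b + 2 := by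
    intro Y hY
    constructor
    · rintro ⟨d, h1, h2⟩
      have := hT.complete hS.toBounded h1 hY
      omega
    · rintro ⟨h1, h2⟩
      obtain ⟨d, h3, h4⟩ := hT.sound _ hS.start_lt Y hY h1
      exact ⟨d, h3, by omega⟩
  refine Spec.rep (N := S.tot) (t := 60)
    (fun j τ => τ.reg .out = if ∃ Y < j, Y / two_t % (full + 1) = full ∧
      ∃ d, Reach S S.start Y d ∧ d ≤ b then 1 else o)
    (by simp) (by rw [← hσ]; rfl) ?_ ?_ ?_ (by simp [Exp.cost]; omega)
  · simpa using g (.out, o) (by simp)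
  · intro Y hY τ fr hI
    have g1 := ((((show σ.Has [(.n, n), (.b, b), (.two_t, two_t), (.full, full)] from
      fun p hp => g p (by simp at hp ⊢; tauto)).frame fr rfl).set
        (x := .Y) (a := Y) rfl).cons (x := .Y) (a := Y) (by simp))
    have hσ1 := St.search_set (x := .Y) (a := Y) rfl (fr.search rfl rfl hσ)
    have hD : (τ.set .Y Y).arr .dist = σ.arr .dist := fr.arr .dist rfl
    have hI' : (τ.set .Y Y).reg .out = τ.reg .out := by simp
    rw [← hI'] at hI
    clear fr hI' g
    generalize τ.set .Y Y = τ at *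
    have g' := g1
    simp [St.Has] at g'
    have h2 : τ.reg .w0 = S.start := by rw [← hσ1]; rfl
    obtain ⟨c1, c2⟩ := hS.cell_lt hY hS.start_lt
    have hsplit : (∃ Y' < Y + 1, Y' / two_t % (full + 1) = full ∧
        ∃ d, Reach S S.start Y' d ∧ d ≤ b) ↔ (∃ Y' < Y, Y' / two_t % (full + 1) = full ∧
        ∃ d, Reach S S.start Y' d ∧ d ≤ b) ∨ (Y / two_t % (full + 1) = full ∧
        0 < σ.arr .dist (Y * n + S.start) ∧ σ.arr .dist (Y * n + S.start) < b + 2) := by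
      rw [← key Y hY]
      constructor
      · rintro ⟨Y', h1, h2⟩
        rcases Nat.lt_succ_iff_lt_or_eq.1 h1 with h | rfl
        · exact Or.inl ⟨Y', h, h2⟩
        · exact Or.inr h2
      · rintro (⟨Y', h1, h2⟩ | h)
        · exact ⟨Y', by omega, h2⟩
        · exact ⟨Y, by omega, h⟩
    simp only [hsplit]
    refine Spec.flat 60 rfl (by decide) le_rfl ?_ ?_
    · simp [Cmd.Ok, Cmd.run, g', h2, hD, c1, c2, hfull]
      intro _ _
      omega
    · by_cases h3 : Y / two_t % (full + 1) = full <;>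
      by_cases h4 : 0 < σ.arr .dist (Y * n + S.start) <;>
      by_cases h5 : σ.arr .dist (Y * n + S.start) < b + 2 <;>
      simp [Cmd.run, g', h2, hD, h3, h4, h5, hI]
  · intro τ _ hI
    rw [hI]
    refine if_congr ?_ rfl rfl
    constructor
    · rintro ⟨Y, h1, h2, d, h3, h4⟩; exact ⟨Y, d, h3, h1, h2, h4⟩
    · rintro ⟨Y, d, h3, h1, h2, h4⟩; exact ⟨Y, h1, h2, d, h3, h4⟩

end LoopLang

namespace LoopLang

open HashFamily RouteSearch

/-! ### The program for the colours of the copies of edges -/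

theorem mul_add_lt {a b i k : ℕ} (ha : a < b) (hi : i < k) : a * k + i < b * k :=
  calc a * k + i < (a + 1) * k := by rw [Nat.succ_mul]; omega
    _ ≤ b * k := Nat.mul_le_mul_right k ha

/-- Sets `pw` to a power. -/
def powCmd (b : Exp) (y : Var) : Cmd :=
  (.set .base b ;; .set .pw 1) ;; .rep .expo ♯y (.set .pw (♯.pw * ♯.base))

theorem spec_powCmd {V len b N : ℕ} {β : Exp} {y : Var} {σ : St} (hβ : β.Ok V len σ)
    (hβ' : β.eval σ = b) (hβc : β.cost ≤ 2) (hy : σ.reg y = N) (hy1 : y ≠ .base) (hy2 : y ≠ .pw)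
    (hb : 0 < b) (hV : b ^ N < V) :
    Spec V len (powCmd β y) (N * 15 + 10) σ (fun τ => τ.reg .pw = b ^ N) := by
  refine Spec.seq (t₁ := 3) (t₂ := N * 15 + 4)
    (mid := fun τ => τ.reg .base = b ∧ τ.reg .pw = 1 ∧ τ.reg y = N) ?_ ?_ (by omega)
  · refine ⟨?_, ?_, ?_⟩
    · simp [Cmd.Ok, hβ]
    · simp [Cmd.cost]; omega
    · simp [Cmd.run, hβ', hy1, hy2, hy]
  · rintro τ - ⟨h1, h2, h3⟩
    refine Spec.rep (N := N) (t := 10) (fun j τ => τ.reg .pw = b ^ j) (by simp) (by simp [h3])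
      (by simp [h2]) ?_ (fun _ _ h => h) (by simp)
    intro j hj τ' fr hI
    have h4 : τ'.reg .base = b := (fr.reg .base rfl).trans h1
    have h5 : b ^ j * b < V := by
      rw [← pow_succ]
      exact lt_of_le_of_lt (Nat.pow_le_pow_right hb hj) hV
    refine Spec.flat 10 rfl (by decide) le_rfl ?_ ?_
    · simp [Cmd.Ok, h4, hI, h5]
    · simp [Cmd.run, h4, hI, pow_succ]

/-- Sets `col` to the colour of `id`. -/
def colorCmd : Cmd :=
  (.set .col 0 ;; .set .cur ♯.jj) ;;
  .rep .z ♯.ell (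
    (.set .d (♯.cur % ♯.D) ;; .set .cur (♯.cur / ♯.D)) ;;
    .ite (.lt ♯.id (♯.d % (♯.Kc + 1))) .skip
      (.set .col (♯.z * ♯.s + .get .colors (♯.d / (♯.Kc + 1) * ♯.Kc + ♯.id))))

def hashCmd : Cmd :=
  .set .h ((.get .hashes (♯.j * ♯.Q + ♯.e % ♯.Q) * ♯.K +
    .get .hashes (♯.j * ♯.Q + ♯.e / ♯.Q % ♯.Q)) * ♯.K +
    .get .hashes (♯.j * ♯.Q + ♯.e / (♯.Q * ♯.Q)))

/-- Computes the codes of all copies of edges. -/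
def codeCmd : Cmd :=
  .rep .e ♯.m (hashCmd ;;
    .rep .i ♯.k (.set .id (♯.h * ♯.k + ♯.i) ;; colorCmd ;; powCmd (.lit 2) .col ;;
      .put .code (♯.e * ♯.k + ♯.i) ♯.pw))

theorem spec_colorCmd {V len jj ell D Kc s R id : ℕ} {F : ℕ → ℕ → ℕ} {σ : St}
    (hD : D = (Kc + 1) * R) (hR : 0 < R) (hid : id < Kc)
    (hF : ∀ r < R, ∀ x < Kc, F r x < s) (hV : R * Kc < V) (hV' : Kc + 1 < V) (hV'' : ell * s < V)
    (hσ : ∀ r < R, ∀ x < Kc, σ.arr .colors (r * Kc + x) = F r x)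
    (g : σ.Has [(.jj, jj), (.ell, ell), (.D, D), (.Kc, Kc), (.s, s), (.id, id)]) :
    Spec V len colorCmd (ell * 70 + 20) σ (fun τ => τ.reg .col = color F Kc s D jj id ell) := by
  have g' := g
  simp [St.Has] at g'
  refine Spec.flat_seq (c := 5) (t₂ := ell * 70 + 10) rfl (by decide) (by simp [Cmd.Ok]) ?_
    (by omega)
  intro τ₁ hτ₁ fr₁
  have h1 : τ₁.reg .col = 0 := by simp [hτ₁, Cmd.run]
  have h2 : τ₁.reg .cur = jj := by simp [hτ₁, Cmd.run, g']
  have g1 := g.frame fr₁ rfl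
  rw [← fr₁.arr .colors rfl] at hσ
  clear hτ₁ fr₁ g g'
  refine Spec.rep (N := ell) (t := 60)
    (fun l τ => τ.reg .col = color F Kc s D jj id l ∧ τ.reg .cur = jj / D ^ l) (by simp)
    (by simpa using g1 (.ell, ell) (by simp)) ⟨h1, by simp [h2]⟩ ?_ (fun _ _ h => h.1)
    (by simp; omega)
  rintro l hl τ fr ⟨hI, hI'⟩
  have g2 := ((g1.frame fr rfl).set (x := .z) (a := l) rfl).cons (x := .z) (a := l) (by simp)
  have h3 : (τ.set .z l).reg .col = color F Kc s D jj id l := by simp [hI]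
  have h4 : (τ.set .z l).reg .cur = jj / D ^ l := by simp [hI']
  have hσ' : ∀ r < R, ∀ x < Kc, (τ.set .z l).arr .colors (r * Kc + x) = F r x := by
    rw [St.set_arr, fr.arr .colors rfl]; exact hσ
  clear fr g1 hI hI' hσ
  generalize τ.set .z l = τ at *
  have g' := g2
  simp [St.Has] at g'
  have hd : jj / D ^ l % D / (Kc + 1) < R :=
    Nat.div_lt_of_lt_mul (by rw [← hD]; exact Nat.mod_lt _ (by rw [hD]; positivity))
  have h5 := hσ' _ hd _ hid
  have h6 := hF _ hd _ hid
  have h7 : jj / D ^ l % D / (Kc + 1) * Kc + id < V := by nlinarith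
  have h8 : l * s + F (jj / D ^ l % D / (Kc + 1)) id < V := by nlinarith
  have h9 : jj / D ^ l % D / (Kc + 1) * Kc < V := by omega
  have h10 : l * s < V := by omega
  have hdig : dig D jj l = jj / D ^ l % D := rfl
  refine Spec.flat 60 rfl (by decide) le_rfl ?_ ?_
  · simp [Cmd.Ok, Cmd.run, g', h4, hV', h5, h7, h8, h9, h10]
  · by_cases h : id < jj / D ^ l % D % (Kc + 1)
    · simp [Cmd.run, g', h3, h4, h, color, hdig, div_pow_succ, not_le.2 h]
    · simp [Cmd.run, g', h4, h, color, hdig, div_pow_succ, not_lt.1 h, h5]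

theorem spec_hashCmd {V len j Q K e : ℕ} {G : ℕ → ℕ → ℕ} {σ : St}
    (he : e < Q ^ 3) (hQ : 0 < Q) (hG : ∀ x < Q, G j x < K) (hV1 : K ^ 3 < V)
    (hV4 : (j + 1) * Q < V) (hV5 : Q * Q < V)
    (hσG : ∀ x < Q, σ.arr .hashes (j * Q + x) = G j x)
    (g : σ.Has [(.j, j), (.e, e), (.Q, Q), (.K, K)]) :
    Spec V len hashCmd 90 σ (fun τ => τ.reg .h = hash G Q K j e) := by
  have g' := g
  simp [St.Has] at g'
  have x1 : e % Q < Q := Nat.mod_lt _ hQ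
  have x2 : e / Q % Q < Q := Nat.mod_lt _ hQ
  have x3 : e / (Q * Q) < Q := Nat.div_lt_of_lt_mul (by calc e < Q ^ 3 := he
                                                        _ = _ := by ring)
  have hjQ : (j + 1) * Q = j * Q + Q := Nat.succ_mul j Q
  have y1 : j * Q + e % Q < V := by omega
  have y2 : j * Q + e / Q % Q < V := by omega
  have y3 : j * Q + e / (Q * Q) < V := by omega
  have y4 : j * Q < V := by omega
  have z1 : hash G Q K j e < V := (hash_lt hQ he hG).trans hV1
  have hK : 0 < K := by have := hG _ x1; omega
  unfold HashFamily.hash at z1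
  have z2 : (G j (e % Q) * K + G j (e / Q % Q)) * K < V := by omega
  have z3 : G j (e % Q) * K + G j (e / Q % Q) < V :=
    (Nat.le_mul_of_pos_right _ hK).trans_lt z2
  have z4 : G j (e % Q) * K < V := by omega
  refine Spec.flat 90 rfl (by decide) le_rfl ?_ ?_
  · simp [hashCmd, Cmd.Ok, g', hσG, x1, x2, x3, y1, y2, y3, y4, z1, z2, z3, z4, hV5]
  · simp [hashCmd, Cmd.run, g', hσG, x1, x2, x3, HashFamily.hash]

theorem spec_codeCmd {V len j jj m k Q K Kc ell s R D : ℕ} {G F : ℕ → ℕ → ℕ} {σ : St}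
    (hD : D = (Kc + 1) * R) (hR : 0 < R) (hs : 0 < s) (hell : 0 < ell) (hKc : K ^ 3 * k = Kc)
    (hm : m ≤ Q ^ 3) (hQ : 0 < Q) (hG : ∀ x < Q, G j x < K) (hF : ∀ r < R, ∀ x < Kc, F r x < s)
    (hV1 : R * Kc < V) (hV2 : Kc + 1 < V) (hV3 : 2 ^ (ell * s) < V) (hV4 : (j + 1) * Q < V)
    (hV5 : Q * Q < V) (hV6 : m * k < V) (hV7 : K ^ 3 < V)
    (hσG : ∀ x < Q, σ.arr .hashes (j * Q + x) = G j x)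
    (hσF : ∀ r < R, ∀ x < Kc, σ.arr .colors (r * Kc + x) = F r x)
    (g : σ.Has [(.j, j), (.jj, jj), (.m, m), (.k, k), (.Q, Q), (.K, K), (.ell, ell), (.D, D),
      (.Kc, Kc), (.s, s)]) :
    Spec V len codeCmd (m * (k * (ell * 70 + ell * s * 15 + 80) + 110) + 10) σ
      (fun τ => ∀ e < m, ∀ i < k, τ.arr .code (e * k + i) =
        2 ^ color F Kc s D jj (hash G Q K j e * k + i) ell) := by
  have hVl : ell * s < V := Nat.lt_two_pow_self.trans hV3
  refine Spec.rep (N := m) (t := k * (ell * 70 + ell * s * 15 + 80) + 100)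
    (fun a τ => ∀ e < a, ∀ i < k, τ.arr .code (e * k + i) =
      2 ^ color F Kc s D jj (hash G Q K j e * k + i) ell) (by simp)
    (by simpa using g (.m, m) (by simp)) (by simp) ?_ (fun _ _ h => h) (by simp; nlinarith)
  intro e he τ fr hI
  have g1 := ((g.frame fr rfl).set (x := .e) (a := e) rfl).cons (x := .e) (a := e) (by simp)
  rw [← fr.arr .hashes rfl] at hσG
  rw [← fr.arr .colors rfl] at hσF
  clear g fr
  rw [← τ.set_arr .e e] at hI hσG hσF
  generalize τ.set .e e = τ at *
  have he' : e < Q ^ 3 := he.trans_le hm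
  have hh := hash_lt hQ he' hG
  refine Spec.seq (spec_hashCmd he' hQ hG hV7 hV4 hV5 hσG
    (fun p hp => g1 p (by simp at hp ⊢; tauto)))
    (t₂ := k * (ell * 70 + ell * s * 15 + 80) + 10) ?_ (by omega)
  intro τ₁ fr₁ hτ₁
  have g2 := (g1.frame fr₁ rfl).cons hτ₁
  rw [← fr₁.arr .colors rfl] at hσF
  rw [← fr₁.arr .code rfl] at hI
  clear fr₁ hτ₁ g1 hσG
  -- The cells `e * k + i` are ordered lexicographically, so the inner invariant can say that all
  -- cells before the current one are done.
  have hfin : ∀ i ≤ k, ∀ e' < e + 1, ∀ i' < k, e' * k + i' < e * k + i ↔ e' < e ∨ e' = e ∧ i' < i := by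
    intro i hi e' he' i' hi'
    constructor
    · intro h
      rcases Nat.lt_succ_iff_lt_or_eq.1 he' with h' | rfl
      · exact Or.inl h'
      · exact Or.inr ⟨rfl, by omega⟩
    · rintro (h | ⟨rfl, h⟩)
      · exact Nat.lt_add_right i (mul_add_lt h hi')
      · omega
  refine Spec.rep (N := k) (t := ell * 70 + ell * s * 15 + 70)
    (fun i τ => ∀ e' < e + 1, ∀ i' < k, e' * k + i' < e * k + i → τ.arr .code (e' * k + i') =
      2 ^ color F Kc s D jj (hash G Q K j e' * k + i') ell) (by simp)
    (by simpa using g2 (.k, k) (by simp)) ?_ ?_ ?_ (by simp; nlinarith)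
  · intro e' he' i' hi' h
    rw [hfin 0 (by omega) e' he' i' hi'] at h
    exact hI e' (by omega) i' hi'
  · intro i hi τ₂ fr₂ hI
    have g3 := ((g2.frame fr₂ rfl).set (x := .i) (a := i) rfl).cons (x := .i) (a := i) (by simp)
    rw [← fr₂.arr .colors rfl] at hσF
    clear fr₂ g2
    rw [← τ₂.set_arr .i i] at hI hσF
    generalize τ₂.set .i i = τ₂ at *
    have g' := g3
    simp [St.Has] at g'
    have hid : hash G Q K j e * k + i < Kc := hKc ▸ mul_add_lt hh hi
    have hid' : hash G Q K j e * k < V := by omega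
    have hek : e * k + i < V := (mul_add_lt he hi).trans hV6
    have hek' : e * k < V := by omega
    refine Spec.flat_seq (c := 8) (t₂ := ell * 70 + ell * s * 15 + 60) rfl (by decide) ?_ ?_
      (by omega)
    · simp [Cmd.Ok, g', hid']; omega
    intro τ₃ hτ₃ fr₃
    have h1 : τ₃.reg .id = hash G Q K j e * k + i := by simp [hτ₃, Cmd.run, g']
    have g4 := (g3.frame fr₃ rfl).cons h1
    rw [← fr₃.arr .colors rfl] at hσF
    rw [← fr₃.arr .code rfl] at hI
    clear fr₃ hτ₃ g3 g' h1
    refine Spec.seq (spec_colorCmd hD hR hid hF hV1 hV2 hVl hσF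
      (fun p hp => g4 p (by simp at hp ⊢; tauto))) (t₂ := ell * s * 15 + 40) ?_ (by omega)
    intro τ₄ fr₄ hcol
    have g5 := (g4.frame fr₄ rfl).cons hcol
    rw [← fr₄.arr .code rfl] at hI
    have hlt := color_lt (c := jj) hF hR hid hs hell
    rw [← hD] at hlt
    clear fr₄ g4 hσF
    refine Spec.seq (spec_powCmd (b := 2) (by simp) rfl (by decide) hcol (by decide) (by decide)
      (by decide) ((Nat.pow_le_pow_right (by decide) hlt.le).trans_lt hV3)) (t₂ := 25) ?_
      (by omega)
    intro τ₅ fr₅ hpow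
    have g6 := (g5.frame fr₅ rfl).cons hpow
    rw [← fr₅.arr .code rfl] at hI
    clear fr₅ g5
    have g' := g6
    simp [St.Has] at g'
    refine Spec.flat 25 rfl (by decide) le_rfl ?_ ?_
    · simp [Cmd.Ok, g', hek, hek']
    · intro e' he' i' hi' h
      by_cases hc : e' * k + i' = e * k + i
      · obtain ⟨rfl, rfl⟩ := cell_inj hi' hi hc
        simp [Cmd.run, g']
      · rw [← hI e' he' i' hi' (by omega)]
        simp [Cmd.run, g', Function.update_of_ne hc]
  · intro τ₂ _ h e' he' i' hi'
    refine h e' he' i' hi' ((hfin k le_rfl e' he' i' hi').2 ?_)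
    omega

end LoopLang

/-! ### The loop over all colourings -/

namespace LoopLang

open HashFamily RouteSearch

/-- Tries all colourings. -/
def mainCmd : Cmd := .rep .j ♯.M (.rep .jj ♯.L (codeCmd ;; searchCmd ;; verdictCmd))

/-- The input describes the instance `I` and the bound `k`. -/
structure Encodes (I : DWRP) (k : ℕ) (inp : ℕ → ℕ) : Prop where
  n : inp 0 = I.n
  m : inp 1 = I.m
  k : inp 2 = k
  budget : inp 3 = I.budget
  src : ∀ e : Fin I.m, inp (4 + 4 * e) = I.src e
  dst : ∀ e : Fin I.m, inp (5 + 4 * e) = I.dst e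
  weight : ∀ e : Fin I.m, inp (6 + 4 * e) = I.weight e
  capacity : ∀ e : Fin I.m, inp (7 + 4 * e) = I.capacity e
  waypoint : ∀ v : Fin I.n, inp (4 + 4 * I.m + v) = if v ∈ I.waypoints then 1 else 0

/-- The numbers that determine a colouring of the copies of edges. -/
structure Scheme where
  Q : ℕ
  K : ℕ
  Kc : ℕ
  ell : ℕ
  s : ℕ
  R : ℕ
  G : ℕ → ℕ → ℕ
  F : ℕ → ℕ → ℕ

/-- The number of values of a digit that determines the colours of a block. -/
def Scheme.D (z : Scheme) : ℕ := (z.Kc + 1) * z.R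

/-- The colour of copy `i` of the edge `e`. -/
def Scheme.col (z : Scheme) (k j c e i : ℕ) : ℕ :=
  color z.F z.Kc z.s z.D c (hash z.G z.Q z.K j e * k + i) z.ell

/-- The properties of a scheme for `m` edges and `k` copies of each. -/
structure Scheme.Valid (z : Scheme) (m k M : ℕ) : Prop where
  R_pos : 0 < z.R
  s_pos : 0 < z.s
  ell_pos : 0 < z.ell
  Kc_eq : z.K ^ 3 * k = z.Kc
  m_le : m ≤ z.Q ^ 3
  Q_pos : 0 < z.Q
  G_lt : ∀ j < M, ∀ x < z.Q, z.G j x < z.K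
  F_lt : ∀ r < z.R, ∀ x < z.Kc, z.F r x < z.s

/-- All numbers that occur in the main loop are below `V`. -/
structure Scheme.Small (z : Scheme) (I : DWRP) (k M B V len : ℕ) : Prop where
  colors_lt : z.R * z.Kc < V
  Kc_lt : z.Kc + 1 < V
  code_lt : 2 ^ (z.ell * z.s) < V
  hashes_lt : M * z.Q < V
  sq_lt : z.Q * z.Q < V
  hash_lt : z.K ^ 3 < V
  copies_lt : I.m * k < V
  cells_lt : (2 ^ (z.ell * z.s + I.waypoints.card) * (k + 1) + 1) * (I.n + 1) < V
  weights_lt : (2 ^ (z.ell * z.s + I.waypoints.card) * (k + 1) + 1) * (B + 1) < V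
  masks_lt : 2 ^ (z.ell * z.s + I.waypoints.card) * (k + 1) +
    3 * 2 ^ (z.ell * z.s + I.waypoints.card) < V
  full_lt : 2 ^ I.waypoints.card < V
  budget_lt : I.budget + 2 < V
  len_eq : 4 + 4 * I.m ≤ len
  len_lt : len < V
  weight_le : ∀ e, I.weight e ≤ B

/-- The values of the variables for the main loop. -/
def Scheme.vars (z : Scheme) (I : DWRP) (k w₀ M L : ℕ) : List (Var × ℕ) :=
  [(.n, I.n), (.m, I.m), (.k, k), (.b, I.budget), (.w0, w₀), (.M, M), (.L, L), (.Q, z.Q), (.K, z.K),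
    (.Kc, z.Kc), (.ell, z.ell), (.s, z.s), (.D, z.D),
    (.two_u, 2 ^ (z.ell * z.s + I.waypoints.card)),
    (.tot, 2 ^ (z.ell * z.s + I.waypoints.card) * (k + 1)), (.two_t, 2 ^ (z.ell * z.s)),
    (.full, 2 ^ I.waypoints.card - 1)]

/-- The contents of the arrays for the main loop. -/
structure Scheme.Arrays (z : Scheme) (I : DWRP) (M : ℕ) (idx : Fin I.n → ℕ) (σ : St) : Prop where
  hashes : ∀ j < M, ∀ x < z.Q, σ.arr .hashes (j * z.Q + x) = z.G j x
  colors : ∀ r < z.R, ∀ x < z.Kc, σ.arr .colors (r * z.Kc + x) = z.F r x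
  wbit : ∀ v : Fin I.n, σ.arr .wbit v = if v ∈ I.waypoints then 2 ^ (z.ell * z.s + idx v) else 0

theorem Scheme.Arrays.frame {z : Scheme} {I : DWRP} {M : ℕ} {idx : Fin I.n → ℕ} {σ τ : St}
    {P : Cmd} (h : z.Arrays I M idx σ) (fr : Frame P σ τ)
    (hP : ([.hashes, .colors, .wbit].all fun A => !P.stores A) = true) : z.Arrays I M idx τ := by
  simp at hP
  exact ⟨by rw [fr.arr .hashes hP.1]; exact h.hashes, by rw [fr.arr .colors hP.2.1]; exact h.colors,
    by rw [fr.arr .wbit hP.2.2]; exact h.wbit⟩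

variable {I : DWRP} {k M L B V len : ℕ} {w₀ : Fin I.n} {z : Scheme} {idx : Fin I.n → ℕ} {σ : St}

theorem Scheme.fits (hz : z.Valid I.m k M) (hw : w₀ ∈ I.waypoints)
    (hidx : Set.BijOn idx I.waypoints (Set.Iio I.waypoints.card)) (hin : Encodes I k σ.inp)
    (g : σ.Has (z.vars I k w₀ M L)) (ha : z.Arrays I M idx σ) {j c : ℕ} (hj : j < M)
    (hcode : ∀ e < I.m, ∀ i < k, σ.arr .code (e * k + i) = 2 ^ z.col k j c e i) :
    Fits I k (z.ell * z.s) w₀ idx (z.col k j c) σ.search := by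
  simp [St.Has, Scheme.vars] at g
  refine { m_eq := ?_, k_eq := ?_, src := ?_, dst := ?_, wgt := ?_, cap := ?_, bit := ?_,
           col_lt := ?_, wbit := ?_, inc := ?_, tot := ?_, start := ?_, mem := hw, bij := hidx }
  · simp [St.search, g]
  · simp [St.search, g]
  · exact hin.src
  · exact hin.dst
  · exact hin.weight
  · exact hin.capacity
  · intro e i hi
    simp [St.search, g, hcode e e.2 i hi]
  · intro e i hi
    refine color_lt hz.F_lt hz.R_pos ?_ hz.s_pos hz.ell_pos
    rw [← hz.Kc_eq]
    exact mul_add_lt (hash_lt hz.Q_pos (e.2.trans_le hz.m_le) (hz.G_lt j hj)) hi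
  · exact ha.wbit
  · simp [St.search, g]
  · simp [St.search, g]
  · simp [St.search, g]

theorem _root_.RouteSearch.Fits.small {t : ℕ} {col : ℕ → ℕ → ℕ} {S : Search}
    (hS : Fits I k t w₀ idx col S) (hk : 0 < k) (ht : t = z.ell * z.s)
    (hs : z.Small I k M B V len) : Search.Small S I.n B V len where
  src_lt e he := by
    rw [hS.m_eq] at he; have := hS.src ⟨e, he⟩; simp at this; rw [this]; exact Fin.is_lt _
  dst_lt e he := by
    rw [hS.m_eq] at he; have := hS.dst ⟨e, he⟩; simp at this; rw [this]; exact Fin.is_lt _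
  start_lt := by rw [hS.start]; exact w₀.2
  wgt_le e he := by
    rw [hS.m_eq] at he; have := hS.wgt ⟨e, he⟩; simp at this; rw [this]; exact hs.weight_le _
  bit_le e he i hi := by
    rw [hS.m_eq] at he
    rw [hS.k_eq] at hi
    have := hS.bit ⟨e, he⟩ i hi
    simp at this
    rw [this, hS.inc]
    have := hS.col_lt ⟨e, he⟩ i hi
    simp at this
    exact Nat.pow_le_pow_right (by decide) (by omega)
  wbit_le v hv := by
    have := hS.wbit ⟨v, hv⟩
    simp at this
    rw [this, hS.inc]
    split_ifs with h
    · have := hS.bij.mapsTo h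
      simp at this
      exact Nat.pow_le_pow_right (by decide) (by omega)
    · exact Nat.zero_le _
  inc_pos := by rw [hS.inc]; positivity
  inc_lt := by
    rw [hS.inc, hS.tot]
    have : 0 < 2 ^ (t + I.waypoints.card) := by positivity
    nlinarith
  cells_lt := by rw [hS.tot, ht]; exact hs.cells_lt
  weights_lt := by rw [hS.tot, ht]; exact hs.weights_lt
  masks_lt := by rw [hS.tot, hS.inc, ht]; exact hs.masks_lt
  copies_lt := by rw [hS.m_eq, hS.k_eq]; exact hs.copies_lt
  len_le := by rw [hS.m_eq]; exact hs.len_eq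
  len_lt := hs.len_lt

/-- The time for one colouring. -/
def roundTime (n m k ell s tot : ℕ) : ℕ :=
  m * (k * (ell * 70 + ell * s * 15 + 80) + 110) +
    tot * (n * 20 + m * (k * 155 + 105) + 80) + 80

/-- `Wit` abbreviates that the present colouring is good. A positive answer is right for every
colouring; only finding a solution depends on `Wit`. -/
theorem spec_round (hz : z.Valid I.m k M) (hk : 0 < k) (hs : z.Small I k M B V len)
    (hw : w₀ ∈ I.waypoints) (hidx : Set.BijOn idx I.waypoints (Set.Iio I.waypoints.card))
    (hin : Encodes I k σ.inp) {j c o : ℕ} (hj : j < M)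
    (g : σ.Has ((.out, o) :: (.jj, c) :: (.j, j) :: z.vars I k w₀ M L)) (ha : z.Arrays I M idx σ)
    {Wit : Prop} (hWit : Wit → ∀ S, Fits I k (z.ell * z.s) w₀ idx (z.col k j c) S →
      ∃ Y d, Reach S w₀ Y d ∧ Y < S.tot ∧ d ≤ I.budget ∧
        Y / 2 ^ (z.ell * z.s) % 2 ^ I.waypoints.card = 2 ^ I.waypoints.card - 1) :
    Spec V len (codeCmd ;; searchCmd ;; verdictCmd) (roundTime I.n I.m k z.ell z.s
      (2 ^ (z.ell * z.s + I.waypoints.card) * (k + 1))) σ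
      (fun τ => (τ.reg .out = o ∨ τ.reg .out = 1 ∧ I.HasSolutionOfSize k) ∧
        (o = 1 ∨ Wit → τ.reg .out = 1)) := by
  have hjQ : (j + 1) * z.Q < V := (Nat.mul_le_mul_right _ hj).trans_lt hs.hashes_lt
  refine Spec.seq (spec_codeCmd (G := z.G) (F := z.F) (j := j) (jj := c) (D := z.D) (m := I.m)
    (k := k) (K := z.K) (ell := z.ell) rfl hz.R_pos hz.s_pos
    hz.ell_pos hz.Kc_eq hz.m_le hz.Q_pos (hz.G_lt j hj) hz.F_lt hs.colors_lt hs.Kc_lt hs.code_lt hjQ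
    hs.sq_lt hs.copies_lt hs.hash_lt (ha.hashes j hj) ha.colors
    (fun p hp => g p (by simp [Scheme.vars] at hp ⊢; tauto)))
    (t₂ := 2 ^ (z.ell * z.s + I.waypoints.card) * (k + 1) *
      (I.n * 20 + I.m * (k * 155 + 105) + 80) + 70) ?_ (by unfold roundTime; omega)
  intro τ₁ fr₁ hcode
  have g1 := g.frame fr₁ rfl
  have hin1 : Encodes I k τ₁.inp := fr₁.inp ▸ hin
  have ha1 := ha.frame fr₁ rfl
  have hfit := Scheme.fits (σ := τ₁) (L := L) hz hw hidx hin1 (fun p hp => g1 p (by simp [hp])) ha1 hj hcode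
  clear fr₁ g ha hin hcode
  have hsm := hfit.small hk rfl hs
  have hm : τ₁.search.m = I.m := hfit.m_eq
  have hk' : τ₁.search.k = k := hfit.k_eq
  have htot := hfit.tot
  have hst := hfit.start
  generalize hS : τ₁.search = S at *
  refine Spec.seq (spec_searchCmd hsm hS (fun p hp => g1 p (by simp [Scheme.vars] at hp ⊢; tauto)))
    (t₂ := S.tot * 70 + 10) ?_ ?_
  swap
  · rw [hm, hk', ← htot]; nlinarith
  intro τ₂ fr₂ hT
  have g2 := g1.frame fr₂ rfl
  have hS2 := fr₂.search rfl rfl hS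
  have h1 : 1 ≤ 2 ^ I.waypoints.card := Nat.one_le_two_pow
  have h2 : 2 ^ I.waypoints.card - 1 + 1 = 2 ^ I.waypoints.card := by omega
  refine (spec_verdictCmd (b := I.budget) (two_t := 2 ^ (z.ell * z.s))
    (full := 2 ^ I.waypoints.card - 1) (o := o) hsm hS2
    (fun p hp => g2 p (by simp [Scheme.vars] at hp ⊢; tauto)) hT
    (by rw [h2]; exact hs.full_lt) hs.budget_lt).mono le_rfl ?_
  intro τ₃ _ h
  rw [h2, hst] at h
  rw [h]
  constructor
  · split_ifs with h
    · obtain ⟨Y, d, h3, h4, h5, h6⟩ := h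
      exact Or.inr ⟨rfl, hfit.hasSolution h3 h4 h5 h6⟩
    · exact Or.inl rfl
  · rintro (rfl | h)
    · simp
    · obtain ⟨Y, d, h3, h4, h5, h6⟩ := hWit h S hfit
      rw [if_pos ⟨Y, d, h3, h4, h6, h5⟩]

/-- The flag `out` is never reset, so it records whether some colouring was successful. For
instances without a solution `Wit` may be taken false. -/
theorem spec_mainCmd (hz : z.Valid I.m k M) (hk : 0 < k) (hs : z.Small I k M B V len)
    (hw : w₀ ∈ I.waypoints) (hidx : Set.BijOn idx I.waypoints (Set.Iio I.waypoints.card))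
    (hin : Encodes I k σ.inp) (g : σ.Has (z.vars I k w₀ M L)) (hout : σ.reg .out = 0)
    (ha : z.Arrays I M idx σ)
    {Wit : ℕ → ℕ → Prop} (hWit : ∀ j c, Wit j c → ∀ S,
      Fits I k (z.ell * z.s) w₀ idx (z.col k j c) S →
      ∃ Y d, Reach S w₀ Y d ∧ Y < S.tot ∧ d ≤ I.budget ∧
        Y / 2 ^ (z.ell * z.s) % 2 ^ I.waypoints.card = 2 ^ I.waypoints.card - 1) :
    Spec V len mainCmd (M * (L * (roundTime I.n I.m k z.ell z.s
      (2 ^ (z.ell * z.s + I.waypoints.card) * (k + 1)) + 5) + 10) + 10) σ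
      (fun τ => (τ.reg .out = 0 ∨ τ.reg .out = 1 ∧ I.HasSolutionOfSize k) ∧
        ((∃ j < M, ∃ c < L, Wit j c) → τ.reg .out = 1)) := by
  refine Spec.rep (N := M) (t := L * (roundTime I.n I.m k z.ell z.s
      (2 ^ (z.ell * z.s + I.waypoints.card) * (k + 1)) + 5) + 5)
    (fun a τ => (τ.reg .out = 0 ∨ τ.reg .out = 1 ∧ I.HasSolutionOfSize k) ∧
        ((∃ j < a, ∃ c < L, Wit j c) → τ.reg .out = 1))
    (by simp) (by simpa using g (.M, M) (by simp [Scheme.vars])) (by simp [hout]) ?_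
    (fun _ _ h => h) (by simp)
  rintro j hj τ fr ⟨hI, hI'⟩
  have g1 := ((g.frame fr rfl).set (x := .j) (a := j) rfl).cons (x := .j) (a := j) (by simp)
  have hin1 : Encodes I k (τ.set .j j).inp := fr.inp ▸ hin
  have ha1 := ha.frame fr rfl
  replace ha1 : z.Arrays I M idx (τ.set .j j) := ⟨ha1.1, ha1.2, ha1.3⟩
  clear fr g hin hout ha
  have ho : (τ.set .j j).reg .out = τ.reg .out := rfl
  rw [← ho] at hI hI'
  generalize τ.set .j j = τ at *
  refine Spec.rep (N := L) (t := roundTime I.n I.m k z.ell z.s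
      (2 ^ (z.ell * z.s + I.waypoints.card) * (k + 1)))
    (fun a τ => (τ.reg .out = 0 ∨ τ.reg .out = 1 ∧ I.HasSolutionOfSize k) ∧
        ((∃ j' < j, ∃ c < L, Wit j' c) ∨ (∃ c < a, Wit j c) → τ.reg .out = 1))
    (by simp) (by simpa using g1 (.L, L) (by simp [Scheme.vars])) ?_ ?_ ?_ (by simp)
  · refine ⟨hI, ?_⟩
    rintro (h | ⟨c, h, -⟩)
    · exact hI' h
    · omega
  · rintro c hc τ₁ fr ⟨hI, hI'⟩
    have g2 := ((g1.frame fr rfl).set (x := .jj) (a := c) rfl).cons (x := .jj) (a := c) (by simp)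
    have hin1 : Encodes I k (τ₁.set .jj c).inp := fr.inp ▸ hin1
    have ha1 := ha1.frame fr rfl
    replace ha1 : z.Arrays I M idx (τ₁.set .jj c) := ⟨ha1.1, ha1.2, ha1.3⟩
    clear fr g1
    have ho : (τ₁.set .jj c).reg .out = τ₁.reg .out := rfl
    rw [← ho] at hI hI'
    generalize τ₁.set .jj c = τ₁ at *
    refine (spec_round hz hk hs hw hidx hin1 hj (g2.cons rfl) ha1 (hWit j c)).mono le_rfl ?_
    rintro τ₂ - ⟨h1, h2⟩
    constructor
    · rcases h1 with h1 | h1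
      · rw [h1]; exact hI
      · exact Or.inr h1
    · rintro (h | ⟨c', h, h'⟩)
      · exact h2 (Or.inl (hI' (Or.inl h)))
      · rcases Nat.lt_succ_iff_lt_or_eq.1 h with h | rfl
        · exact h2 (Or.inl (hI' (Or.inr ⟨c', h, h'⟩)))
        · exact h2 (Or.inr h')
  · rintro τ₁ - ⟨h1, h2⟩
    refine ⟨h1, ?_⟩
    rintro ⟨j', h, h'⟩
    rcases Nat.lt_succ_iff_lt_or_eq.1 h with h | rfl
    · exact h2 (Or.inl ⟨j', h, h'⟩)
    · exact h2 (Or.inr h')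

end LoopLang

/-! ### The parameters of the algorithm -/

namespace Param

/-- The least number whose cube is at least `m`. -/
def root (m : ℕ) : ℕ := Nat.find (p := fun Q => m ≤ Q ^ 3) ⟨m, Nat.le_self_pow (by decide) m⟩

theorem le_root_pow (m : ℕ) : m ≤ root m ^ 3 :=
  Nat.find_spec (p := fun Q => m ≤ Q ^ 3) ⟨m, Nat.le_self_pow (by decide) m⟩

theorem lt_root_iff {m a : ℕ} : a < root m ↔ a ^ 3 < m := by
  constructor
  · intro h
    exact not_le.1 (Nat.find_min (p := fun Q => m ≤ Q ^ 3) ⟨m, Nat.le_self_pow (by decide) m⟩ h)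
  · intro h
    by_contra! h'
    exact absurd ((le_root_pow m).trans (Nat.pow_le_pow_left h' 3)) (by omega)

theorem root_le (m : ℕ) : root m ≤ m :=
  Nat.find_min' _ (Nat.le_self_pow (by decide) m)

/-- For `k ≥ 2` the power `2 ^ lam k` lies between `k` and `2 * k`; the estimates use it in place of
`k`, since its powers have simple exponents. -/
def lam (k : ℕ) : ℕ := Nat.clog 2 k
/-- The number of blocks of colours. -/
def ell (k : ℕ) : ℕ := 10 * lam k
/-- The number of colours of a block. -/
def blk (k : ℕ) : ℕ := k / ell k + 1
-- The range of the hash functions, chosen large enough for `Good.exists_hash_injOn`.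
def K (k : ℕ) : ℕ := 2 * k ^ 2
/-- The number of values of the hash functions of copies. -/
def Kc (k : ℕ) : ℕ := K k ^ 3 * k
/-- The number of colourings of a block. -/
def R (k : ℕ) : ℕ := (blk k ^ blk k / (blk k).factorial + 1) * (10 * lam k * blk k)
-- A digit encodes one of `Kc k + 1` starts of a block and one of `R k` functions on it.
def D (k : ℕ) : ℕ := (Kc k + 1) * R k
def T (m : ℕ) : ℕ := Nat.clog 2 (root m)
/-- The number of hash functions. -/
def M (m k : ℕ) : ℕ := K k * T m

end Param

/-! ### Computing the parameters -/

namespace LoopLang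

open HashFamily

theorem clog_le_self (N : ℕ) : Nat.clog 2 N ≤ N :=
  Nat.clog_le_of_le_pow Nat.lt_two_pow_self.le

/-- Sets `x` to the logarithm of `y`, rounded up. -/
def clogCmd (x y : Var) : Cmd :=
  (.set x 0 ;; .set .p 1) ;;
  .rep .z ♯y (.ite (.lt ♯.p ♯y) (.set .p (♯.p + ♯.p) ;; .set x (♯x + 1)) .skip)

/-- Loops have their number of rounds fixed in advance, so `N` rounds are made and the value stops
growing at the logarithm; linear time is good enough here. -/
theorem spec_clogCmd {V len N : ℕ} {x y : Var} {σ : St} (hx1 : x ≠ .p) (hx2 : x ≠ .z) (hy1 : y ≠ .p)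
    (hy2 : y ≠ .z) (hxy : y ≠ x) (hy : σ.reg y = N) (hV : 2 * N + 2 < V) :
    Spec V len (clogCmd x y) (N * 30 + 10) σ (fun τ => τ.reg x = Nat.clog 2 N) := by
  refine Spec.seq (t₁ := 2) (t₂ := N * 30 + 4)
    (mid := fun τ => τ.reg x = 0 ∧ τ.reg .p = 1 ∧ τ.reg y = N) ?_ ?_ (by omega)
  · refine ⟨by simp [Cmd.Ok], by simp [Cmd.cost], ?_⟩
    simp [Cmd.run, hx1, hy1, hxy, hy]
  · rintro τ - ⟨h1, h2, h3⟩
    refine Spec.rep (N := N) (t := 25) (fun j τ => τ.reg x = min j (Nat.clog 2 N) ∧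
      τ.reg .p = 2 ^ min j (Nat.clog 2 N) ∧ τ.reg y = N) (by simp) (by simp [h3])
      (by simp [h1, h2, h3]) ?_ ?_ (by simp)
    · rintro j hj τ' - ⟨e1, e2, e3⟩
      have hiff : 2 ^ min j (Nat.clog 2 N) < N ↔ min j (Nat.clog 2 N) < Nat.clog 2 N :=
        (Nat.lt_clog_iff_pow_lt (by decide)).symm
      have hc := clog_le_self N
      by_cases h : min j (Nat.clog 2 N) < Nat.clog 2 N
      · have h' := hiff.2 h
        have h4 : min (j + 1) (Nat.clog 2 N) = min j (Nat.clog 2 N) + 1 := by omega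
        refine ⟨?_, ?_, ?_⟩
        · simp [Cmd.Ok, Cmd.run, hx1, hx2, hy2, e1, e2, e3, h']
          omega
        · simp [Cmd.cost, hy2, e2, e3, h']
        · simp [Cmd.run, hx1, hx1.symm, hx2, hy1, hy2, hxy, e1, e2, e3, h', h4, pow_succ]
          omega
      · have h' := mt hiff.1 h
        have h4 : min (j + 1) (Nat.clog 2 N) = min j (Nat.clog 2 N) := by omega
        refine ⟨?_, ?_, ?_⟩
        · simp [Cmd.Ok, hy2, e2, e3, h']
        · simp [Cmd.cost, hy2, e2, e3, h']
        · simp [Cmd.run, hx2, hy2, e1, e2, e3, h', h4]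
    · rintro τ' - ⟨e1, -⟩
      rw [e1, min_eq_right (clog_le_self N)]

/-- Sets `Q` to the cube root of `m`, rounded up. -/
def rootCmd : Cmd :=
  .set .Q 0 ;; .rep .z ♯.m (.ite (.lt (♯.Q * ♯.Q * ♯.Q) ♯.m) (.set .Q (♯.Q + 1)) .skip)

theorem spec_rootCmd {V len m : ℕ} {σ : St} (hm : σ.reg .m = m) (hV : Param.root m ^ 3 < V)
    (hV' : m + 1 < V) :
    Spec V len rootCmd (m * 30 + 10) σ (fun τ => τ.reg .Q = Param.root m) := by
  refine Spec.flat_seq (c := 1) (t₂ := m * 30 + 5) rfl (by decide) trivial ?_ (by omega)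
  intro τ hτ fr
  have h1 : τ.reg .m = m := (fr.reg .m rfl).trans hm
  have h2 : τ.reg .Q = 0 := by simp [hτ, Cmd.run]
  clear hτ fr
  refine Spec.rep (N := m) (t := 25) (fun j τ => τ.reg .Q = min j (Param.root m))
    (by simp) (by simp [h1]) (by simp [h2]) ?_ ?_ (by simp)
  · intro j hj τ' fr hI
    have h3 : τ'.reg .m = m := (fr.reg .m rfl).trans h1
    set a := min j (Param.root m) with ha
    have hiff : a < Param.root m ↔ a * a * a < m := by
      rw [Param.lt_root_iff]; ring_nf
    have h4 : a * a * a ≤ Param.root m ^ 3 :=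
      calc a * a * a = a ^ 3 := by ring
        _ ≤ _ := Nat.pow_le_pow_left (min_le_right _ _) 3
    have h5 : a * a ≤ a * a * a := by
      rcases Nat.eq_zero_or_pos a with h | h
      · simp [h]
      · exact Nat.le_mul_of_pos_right _ h
    have h6 : a * a * a < V := by omega
    have h7 : a * a < V := by omega
    have hr := Param.root_le m
    refine Spec.flat 25 rfl (by decide) le_rfl ?_ ?_
    · simp [Cmd.Ok, hI, h6, h7]
      intro _
      omega
    · by_cases h : a < Param.root m
      · simp [Cmd.run, hI, h3, hiff.1 h]; omega
      · simp [Cmd.run, hI, h3, mt hiff.2 h]; omega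
  · intro τ' _ h
    rw [h, min_eq_right (Param.root_le m)]

/-- Sets `p` to the factorial of `s`. -/
def factCmd : Cmd := .set .p 1 ;; .rep .z ♯.s (.set .p (♯.p * (♯.z + 1)))

theorem spec_factCmd {V len s : ℕ} {σ : St} (hs : σ.reg .s = s) (hV : s.factorial < V)
    (hV' : s + 1 < V) :
    Spec V len factCmd (s * 15 + 10) σ (fun τ => τ.reg .p = s.factorial) := by
  refine Spec.flat_seq (c := 1) (t₂ := s * 15 + 5) rfl (by decide) trivial ?_ (by omega)
  intro τ hτ fr
  have h1 : τ.reg .s = s := (fr.reg .s rfl).trans hs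
  have h2 : τ.reg .p = 1 := by simp [hτ, Cmd.run]
  clear hτ fr
  refine Spec.rep (N := s) (t := 10) (fun j τ => τ.reg .p = j.factorial)
    (by simp) (by simp [h1]) (by simp [h2]) ?_ (fun _ _ h => h) (by simp)
  intro j hj τ' fr hI
  have h3 : j.factorial * (j + 1) < V := by
    rw [mul_comm, ← Nat.factorial_succ]
    exact (Nat.factorial_le hj).trans_lt hV
  refine Spec.flat 10 rfl (by decide) le_rfl ?_ ?_
  · simp [Cmd.Ok, hI, h3]; omega
  · simp [Cmd.run, hI, Nat.factorial_succ, mul_comm]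

/-- Computes the parameters from `k`, `lam` and `T`. -/
def sizesCmd : Cmd :=
  (.set .ell (.lit 10 * ♯.lam) ;; .set .s (♯.k / ♯.ell + 1) ;; .set .K (.lit 2 * (♯.k * ♯.k)) ;;
    .set .M (♯.K * ♯.T) ;; .set .Kc (♯.K * ♯.K * ♯.K * ♯.k)) ;;
  powCmd ♯.s .s ;; factCmd ;;
  (.set .R ((♯.pw / ♯.p + 1) * (.lit 10 * ♯.lam * ♯.s)) ;; .set .D ((♯.Kc + 1) * ♯.R)) ;;
  powCmd ♯.D .ell ;; (.set .L ♯.pw ;; .set .t (♯.ell * ♯.s)) ;;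
  powCmd (.lit 2) .t ;; .set .two_t ♯.pw

open Param in
/-- The numbers below `V` in the computation of the parameters. -/
structure SizesSmall (m k V : ℕ) : Prop where
  k_lt : 10 * lam k < V
  s_lt : blk k < V
  M_lt : M m k < V
  Kc_lt : Kc k + 1 < V
  s_pow_lt : blk k ^ blk k + 1 < V
  D_lt : D k < V
  D_pow_lt : D k ^ ell k < V
  t_lt : 2 ^ (ell k * blk k) < V

open Param in
theorem spec_sizesCmd {V len m k : ℕ} {σ : St} (hk : 2 ≤ k) (hV : SizesSmall m k V)
    (g : σ.Has [(.k, k), (.lam, lam k), (.T, T m)]) :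
    Spec V len sizesCmd ((blk k + ell k + ell k * blk k) * 30 + 200) σ (fun τ =>
      τ.Has [(.ell, ell k), (.s, blk k), (.K, K k), (.M, M m k), (.Kc, Kc k), (.R, R k), (.D, D k),
        (.L, D k ^ ell k), (.two_t, 2 ^ (ell k * blk k))]) := by
  obtain ⟨v1, v2, v3, v4, v5, v6, v7, v8⟩ := hV
  have hlam : 0 < lam k := Nat.clog_pos (by decide) hk
  have hell : 0 < ell k := by unfold ell; omega
  have hs : 0 < blk k := Nat.succ_pos _
  have hK : 0 < K k := by unfold K; positivity
  have hKc : 0 < Kc k := by unfold Kc; positivity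
  have hR : 0 < R k := by unfold R; positivity
  have hD : 0 < D k := by unfold D; positivity
  have g' := g
  simp [St.Has] at g'
  refine Spec.flat_seq (c := 70) (t₂ := (blk k + ell k + ell k * blk k) * 30 + 130) rfl (by decide)
    ?_ ?_ (by omega)
  · have e1 : k / (10 * lam k) + 1 = blk k := rfl
    have e2 : 2 * (k * k) = K k := by unfold K; ring
    have e3 : K k * T m = M m k := rfl
    have e4 : K k * K k * K k * k = Kc k := by unfold Kc; ring
    have w1 : K k * K k * K k ≤ Kc k := by rw [← e4]; exact Nat.le_mul_of_pos_right _ (by omega)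
    have w2 : K k * K k ≤ K k * K k * K k := Nat.le_mul_of_pos_right _ hK
    have w3 : K k ≤ K k * K k := Nat.le_mul_of_pos_right _ hK
    have w4 : k * k ≤ K k := by rw [← e2]; omega
    simp [Cmd.Ok, Cmd.run, g', e1, e2, e3, e4]
    omega
  intro τ₁ hτ₁ fr₁
  have g1 : τ₁.Has [(.lam, lam k), (.ell, ell k), (.s, blk k), (.K, K k), (.M, M m k),
      (.Kc, Kc k)] := by
    have e2 : 2 * (k * k) = K k := by unfold K; ring
    have e4 : K k * K k * K k * k = Kc k := by unfold Kc; ring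
    simp [St.Has, hτ₁, Cmd.run, g', e2, e4, ell, blk, M]
  clear hτ₁ fr₁ g' g
  refine Spec.seq (spec_powCmd (b := blk k) (N := blk k) (by simp)
    (by simpa using g1 (.s, blk k) (by simp)) (by simp) (g1 (.s, blk k) (by simp)) (by decide)
    (by decide) hs (by omega)) (t₂ := (blk k + ell k + ell k * blk k * 2) * 15 + 110) ?_ (by omega)
  intro τ₂ fr₂ h2
  have g2 := (g1.frame fr₂ rfl).cons h2
  clear fr₂ g1
  have hfact : (blk k).factorial ≤ blk k ^ blk k := Nat.factorial_le_pow _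
  refine Spec.seq (spec_factCmd (s := blk k) (g2 (.s, blk k) (by simp)) (by omega) (by
    have := Nat.le_self_pow hs.ne' (blk k); omega))
    (t₂ := (ell k + ell k * blk k * 2) * 15 + 100) ?_ (by omega)
  intro τ₃ fr₃ h3
  have g3 := (g2.frame fr₃ rfl).cons h3
  clear fr₃ g2
  have g' := g3
  simp [St.Has] at g'
  refine Spec.flat_seq (c := 30) (t₂ := (ell k + ell k * blk k) * 15 + 60) rfl (by decide)
    ?_ ?_ (by omega)
  · have e1 : (blk k ^ blk k / (blk k).factorial + 1) * (10 * lam k * blk k) = R k := rfl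
    have e2 : (Kc k + 1) * R k = D k := rfl
    have w1 : R k ≤ D k := by rw [← e2]; exact Nat.le_mul_of_pos_left _ (by omega)
    have w2 : 10 * lam k * blk k ≤ R k := by
      rw [← e1]; exact Nat.le_mul_of_pos_left _ (Nat.succ_pos _)
    have w3 : blk k ^ blk k / (blk k).factorial ≤ blk k ^ blk k := Nat.div_le_self _ _
    simp [Cmd.Ok, Cmd.run, g', e1, e2]
    exact ⟨⟨by omega, ⟨v1, w2.trans_lt (w1.trans_lt v6)⟩, w1.trans_lt v6⟩, v4, v6⟩
  intro τ₄ hτ₄ fr₄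
  have hRD : τ₄.reg .R = R k ∧ τ₄.reg .D = D k := by
    simp [hτ₄, Cmd.run, g', R, D]
  have g4 := ((g3.frame fr₄ rfl).cons hRD.1).cons hRD.2
  clear hτ₄ fr₄ g' g3
  refine Spec.seq (spec_powCmd (b := D k) (N := ell k) (by simp)
    (by simpa using g4 (.D, D k) (by simp)) (by simp) (g4 (.ell, ell k) (by simp)) (by decide)
    (by decide) hD (by omega)) (t₂ := (ell k * blk k) * 15 + 40) ?_ (by omega)
  intro τ₅ fr₅ h5
  have g5 := (St.Has.frame (show τ₄.Has [(.D, D k), (.R, R k), (.p, (blk k).factorial),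
    (.lam, lam k), (.ell, ell k), (.s, blk k), (.K, K k), (.M, M m k), (.Kc, Kc k)] from
    fun p hp => g4 p (by simp at hp ⊢; tauto)) fr₅ rfl).cons h5
  clear fr₅ g4
  have g' := g5
  simp [St.Has] at g'
  refine Spec.flat_seq (c := 10) (t₂ := (ell k * blk k) * 15 + 20) rfl (by decide)
    ?_ ?_ (by omega)
  · have := Nat.lt_two_pow_self (n := ell k * blk k)
    simp [Cmd.Ok, Cmd.run, g']
    omega
  intro τ₆ hτ₆ fr₆
  have h6 : τ₆.reg .L = D k ^ ell k ∧ τ₆.reg .t = ell k * blk k := by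
    simp [hτ₆, Cmd.run, g']
  have g6 := ((g5.frame fr₆ rfl).cons h6.1).cons h6.2
  clear hτ₆ fr₆ g' g5
  refine Spec.seq (spec_powCmd (b := 2) (N := ell k * blk k) (by simp) rfl (by decide)
    (g6 (.t, ell k * blk k) (by simp)) (by decide)
    (by decide) (by decide) (by omega)) (t₂ := 5) ?_ (by omega)
  intro τ₇ fr₇ h7
  have g7 := (St.Has.frame (show τ₆.Has [(.L, D k ^ ell k), (.D, D k), (.R, R k),
    (.ell, ell k), (.s, blk k), (.K, K k), (.M, M m k), (.Kc, Kc k)] from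
    fun p hp => g6 p (by simp at hp ⊢; tauto)) fr₇ rfl).cons h7
  refine Spec.flat 5 rfl (by decide) le_rfl ?_ ?_
  · simp [Cmd.Ok]
  · simp [St.Has] at g7
    simp [St.Has, Cmd.run, g7]

end LoopLang

/-! ### Numbering the waypoints and separating the copies -/

namespace LoopLang

open HashFamily RouteSearch Param

/-- The number of waypoints before `v`. -/
def rank (I : DWRP) (v : ℕ) : ℕ := (I.waypoints.filter fun u => u.val < v).card

theorem rank_zero (I : DWRP) : rank I 0 = 0 := by simp [rank]

theorem rank_n (I : DWRP) : rank I I.n = I.waypoints.card := by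
  simp [rank, Finset.filter_true_of_mem]

theorem rank_succ (I : DWRP) (v : Fin I.n) :
    rank I (v + 1) = if v ∈ I.waypoints then rank I v + 1 else rank I v := by
  unfold rank
  split_ifs with h
  · rw [← Finset.card_insert_of_notMem (s := I.waypoints.filter fun u => u.val < v.val) (a := v)
      (by simp)]
    congr 1
    ext u
    simp only [Finset.mem_filter, Finset.mem_insert, Nat.lt_succ_iff_lt_or_eq, Fin.ext_iff]
    constructor
    · rintro ⟨h1, h2 | h2⟩
      · exact Or.inr ⟨h1, h2⟩
      · exact Or.inl h2
    · rintro (h1 | ⟨h1, h2⟩)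
      · have : u = v := Fin.ext h1
        exact ⟨this ▸ h, Or.inr h1⟩
      · exact ⟨h1, Or.inl h2⟩
  · congr 1
    ext u
    simp only [Finset.mem_filter, Nat.lt_succ_iff_lt_or_eq]
    constructor
    · rintro ⟨h1, h2 | h2⟩
      · exact ⟨h1, h2⟩
      · have : u = v := Fin.ext h2
        exact absurd (this ▸ h1) h
    · rintro ⟨h1, h2⟩
      exact ⟨h1, Or.inl h2⟩

theorem rank_mono (I : DWRP) {v w : ℕ} (h : v ≤ w) : rank I v ≤ rank I w :=
  Finset.card_le_card fun u hu => by
    simp only [Finset.mem_filter] at hu ⊢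
    exact ⟨hu.1, by omega⟩

theorem rank_lt_rank (I : DWRP) {v : Fin I.n} (hv : v ∈ I.waypoints) {w : ℕ} (h : v.val < w) :
    rank I v < rank I w := by
  have h1 := rank_mono I (show v.val + 1 ≤ w from h)
  rw [rank_succ, if_pos hv] at h1
  omega

theorem bijOn_rank (I : DWRP) :
    Set.BijOn (fun v : Fin I.n => rank I v) I.waypoints (Set.Iio I.waypoints.card) := by
  have hmaps : ∀ v ∈ I.waypoints, rank I v ∈ Finset.range I.waypoints.card := by
    intro v hv
    have := rank_lt_rank I hv v.2
    rw [rank_n] at this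
    simpa using this
  have hinj : Set.InjOn (fun v : Fin I.n => rank I v) I.waypoints := by
    intro v hv w hw h
    by_contra hne
    rcases lt_or_gt_of_ne hne with h' | h'
    · exact absurd h (rank_lt_rank I hv h').ne
    · exact absurd h (rank_lt_rank I hw h').ne'
  refine ⟨fun v hv => by simpa using hmaps v hv, hinj, ?_⟩
  have := Finset.surjOn_of_injOn_of_card_le (fun v : Fin I.n => rank I v) hmaps hinj (by simp)
  simpa using this

def readCmd : Cmd :=
  .set .n (.inp 0) ;; .set .m (.inp 1) ;; .set .k (.inp (.lit 2)) ;; .set .b (.inp (.lit 3))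

/-- Sets `q` to the number of waypoints. -/
def countCmd : Cmd :=
  .rep .v ♯.n (.ite (.lt 0 (.inp (.lit 4 + .lit 4 * ♯.m + ♯.v))) (.set .q (♯.q + 1)) .skip)

/-- Computes the bits of the waypoints. -/
def waypointCmd : Cmd :=
  .set .pw ♯.two_t ;;
  .rep .v ♯.n (.ite (.lt 0 (.inp (.lit 4 + .lit 4 * ♯.m + ♯.v)))
    (.put .wbit ♯.v ♯.pw ;; .set .pw (♯.pw + ♯.pw) ;; .set .w0 ♯.v) (.put .wbit ♯.v 0)) ;;
  .set .two_u ♯.pw ;; .set .tot (♯.two_u * (♯.k + 1)) ;; .set .full (♯.two_u / ♯.two_t - 1)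

variable {I : DWRP} {k V len : ℕ} {σ : St}

theorem spec_countCmd (hin : Encodes I k σ.inp) (hlen : 4 + 4 * I.m + I.n ≤ len) (hlen' : len < V)
    (g : σ.Has [(.n, I.n), (.m, I.m), (.q, 0)]) :
    Spec V len countCmd (I.n * 30 + 10) σ (fun τ => τ.reg .q = I.waypoints.card) := by
  refine Spec.rep (N := I.n) (t := 25) (fun j τ => τ.reg .q = rank I j) (by simp)
    (by simpa using g (.n, I.n) (by simp)) ?_ ?_ ?_ (by simp)
  · rw [rank_zero]; exact g (.q, 0) (by simp)
  · intro j hj τ fr hI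
    have h1 : τ.reg .m = I.m := (fr.reg .m rfl).trans (g (.m, I.m) (by simp))
    have h2 := hin.waypoint ⟨j, hj⟩
    rw [← fr.inp] at h2
    simp only at h2
    have h3 := rank_succ I ⟨j, hj⟩
    simp only at h3
    have h4 := rank_mono I hj.le
    have h5 : rank I I.n ≤ I.n := by
      rw [rank_n]; exact (Finset.card_le_univ _).trans (by simp)
    have h6 := rank_mono I hj.le
    refine Spec.flat 25 rfl (by decide) le_rfl ?_ ?_
    · simp [Cmd.Ok, h1, hI]; omega
    · by_cases h : ⟨j, hj⟩ ∈ I.waypoints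
      · simp [Cmd.run, h1, h2, h, h3, hI]
      · simp [Cmd.run, h1, h2, h, h3, hI]
  · intro τ _ h
    rw [h, rank_n]

/-- The running power is `2 ^ t` times two to the number of waypoints seen, so it supplies their
bits one after another and ends as the increment of the step counter. The start is the last
waypoint. -/
theorem spec_waypointCmd {t : ℕ} (hin : Encodes I k σ.inp) (hlen : 4 + 4 * I.m + I.n ≤ len)
    (hlen' : len < V) (hV : 2 ^ (t + I.waypoints.card) * (k + 1) < V)
    (hne : I.waypoints.Nonempty)
    (g : σ.Has [(.n, I.n), (.m, I.m), (.k, k), (.two_t, 2 ^ t)]) :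
    Spec V len waypointCmd (I.n * 40 + 50) σ (fun τ =>
      (∃ w₀ ∈ I.waypoints, τ.reg .w0 = w₀) ∧
      τ.Has [(.two_u, 2 ^ (t + I.waypoints.card)), (.tot, 2 ^ (t + I.waypoints.card) * (k + 1)),
        (.full, 2 ^ I.waypoints.card - 1)] ∧
      ∀ v : Fin I.n, τ.arr .wbit v = if v ∈ I.waypoints then 2 ^ (t + rank I v) else 0) := by
  refine Spec.flat_seq (c := 2) (t₂ := I.n * 40 + 40) rfl (by decide) (by simp [Cmd.Ok]) ?_ (by omega)
  intro τ hτ fr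
  have h1 : τ.reg .pw = 2 ^ t := by simpa [hτ, Cmd.run] using g (.two_t, 2 ^ t) (by simp)
  have g1 := g.frame fr rfl
  have hin1 : Encodes I k τ.inp := fr.inp ▸ hin
  clear hτ fr g hin
  have hpow : 2 ^ (t + I.waypoints.card) < V := (Nat.le_mul_of_pos_right _ (by omega)).trans_lt hV
  refine Spec.seq (t₁ := I.n * 40 + 4) (t₂ := 30)
    (mid := fun τ => τ.reg .pw = 2 ^ (t + I.waypoints.card) ∧
      (∃ w₀ ∈ I.waypoints, τ.reg .w0 = w₀) ∧
      ∀ v : Fin I.n, τ.arr .wbit v = if v ∈ I.waypoints then 2 ^ (t + rank I v) else 0) ?_ ?_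
    (by omega)
  · refine Spec.rep (N := I.n) (t := 35) (fun j τ => τ.reg .pw = 2 ^ (t + rank I j) ∧
        ((∃ u ∈ I.waypoints, u.val < j) → ∃ w₀ ∈ I.waypoints, τ.reg .w0 = w₀) ∧
        ∀ v : Fin I.n, v.val < j →
          τ.arr .wbit v = if v ∈ I.waypoints then 2 ^ (t + rank I v) else 0)
      (by simp) (by simpa using g1 (.n, I.n) (by simp)) ?_ ?_ ?_ (by simp)
    · simp [rank_zero, h1]
    · rintro j hj τ₁ fr ⟨i1, i2, i3⟩
      have h1 : τ₁.reg .m = I.m := (fr.reg .m rfl).trans (g1 (.m, I.m) (by simp))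
      have h2 := hin1.waypoint ⟨j, hj⟩
      rw [← fr.inp] at h2
      simp only at h2
      have h3 := rank_succ I ⟨j, hj⟩
      simp only at h3
      clear g1 hin1 fr
      refine Spec.flat 35 rfl (by decide) le_rfl ?_ ?_
      · by_cases h : ⟨j, hj⟩ ∈ I.waypoints
        · have h5 : 2 ^ (t + rank I j) + 2 ^ (t + rank I j) ≤ 2 ^ (t + I.waypoints.card) := by
            have : rank I j < rank I I.n := rank_lt_rank I h hj
            rw [rank_n] at this
            rw [← two_mul, ← pow_succ']
            exact Nat.pow_le_pow_right (by decide) (by omega)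
          simp [Cmd.Ok, Cmd.run, h1, i1, h2, h]
          omega
        · simp [Cmd.Ok, h1, h2, h]
          omega
      · by_cases h : ⟨j, hj⟩ ∈ I.waypoints
        · refine ⟨?_, ?_, ?_⟩
          · simp [Cmd.run, h1, i1, h2, h, h3, ← add_assoc, pow_succ]; omega
          · intro _
            exact ⟨_, h, by simp [Cmd.run, h1, h2, h]⟩
          · intro v hv
            rcases Nat.lt_succ_iff_lt_or_eq.1 hv with hv | hv
            · rw [← i3 v hv]
              simp [Cmd.run, h1, h2, h, Function.update_of_ne hv.ne]
            · have : v = ⟨j, hj⟩ := Fin.ext hv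
              subst this
              simp [Cmd.run, h1, h2, h, i1]
        · refine ⟨?_, ?_, ?_⟩
          · simp [Cmd.run, h1, i1, h2, h, h3]
          · rintro ⟨u, hu, huj⟩
            rcases Nat.lt_succ_iff_lt_or_eq.1 huj with hv | hv
            · obtain ⟨w, hw, hw'⟩ := i2 ⟨u, hu, hv⟩
              exact ⟨w, hw, by simp [Cmd.run, h1, h2, h, hw']⟩
            · have : u = ⟨j, hj⟩ := Fin.ext hv
              exact absurd (this ▸ hu) h
          · intro v hv
            rcases Nat.lt_succ_iff_lt_or_eq.1 hv with hv | hv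
            · rw [← i3 v hv]
              simp [Cmd.run, h1, h2, h, Function.update_of_ne hv.ne]
            · have : v = ⟨j, hj⟩ := Fin.ext hv
              subst this
              simp [Cmd.run, h1, h2, h]
    · rintro τ₁ - ⟨i1, i2, i3⟩
      obtain ⟨u, hu⟩ := hne
      exact ⟨by rw [i1, rank_n], i2 ⟨u, hu, u.2⟩, fun v => i3 v v.2⟩
  · rintro τ₁ fr ⟨i1, ⟨w, hw, i2⟩, i3⟩
    have g2 := g1.frame fr rfl
    simp [St.Has] at g2
    have hk : k + 1 < V := (Nat.le_mul_of_pos_left _ (by positivity)).trans_lt hV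
    refine Spec.flat 30 rfl (by decide) le_rfl ?_ ⟨⟨w, hw, ?_⟩, ?_, ?_⟩
    · simp [Cmd.Ok, Cmd.run, g2, i1, hV, hk]
    · simp [Cmd.run, i2]
    · simp [St.Has, Cmd.run, g2, i1, pow_add]
    · intro v
      rw [← i3 v]
      simp [Cmd.run]

/-- Some colouring is injective on a given set of copies of edges. -/
theorem Scheme.exists_injOn {z : Scheme} {m k T l : ℕ} (hG : Good z.Q 2 (2 * k ^ 2) 1 2 z.G (2 * k ^ 2 * T))
    (hF : Good z.Kc z.s z.s 0 1 z.F z.R) (hK : z.K = 2 * k ^ 2) (hKc : z.Kc = z.K ^ 3 * k)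
    (hk : 0 < k) (hT0 : 0 < T) (hT : z.Q ≤ 2 ^ T) (hm : m ≤ z.Q ^ 3) (hs : 0 < z.s) (hl : 0 < l)
    (hQ : 0 < z.Q)
    (hN : z.Kc ^ z.s ≤ 2 ^ l) (hR : (z.s ^ z.s / z.s.factorial + 1) * l ≤ z.R) (hsN : z.s ≤ z.Kc)
    (hks : k ≤ z.ell * z.s) {Z : Finset (ℕ × ℕ)} (hZ : Z.card ≤ k)
    (hZ' : ∀ p ∈ Z, p.1 < m ∧ p.2 < k) :
    ∃ j < 2 * k ^ 2 * T, ∃ c < z.D ^ z.ell, Set.InjOn (fun p : ℕ × ℕ => z.col k j c p.1 p.2) Z := by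
  obtain ⟨j, hj, hinj⟩ := hG.exists_hash_injOn hk hT0 hT (E := Z.image Prod.fst)
    (by
      intro e he
      obtain ⟨p, hp, rfl⟩ := Finset.mem_image.1 he
      exact (hZ' p hp).1.trans_le hm)
    (Finset.card_image_le.trans hZ)
  -- Hash and copy number together name a copy by a number below `Kc`, so the second stage no longer
  -- depends on `m`.
  set id : ℕ × ℕ → ℕ := fun p => hash z.G z.Q z.K j p.1 * k + p.2 with hid
  obtain ⟨c, hc, hinj'⟩ := exists_color_injOn (N := z.Kc) (l := z.ell) hs (fun r hr => (hF r hr).1)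
    (fun X hX hX' => hF.exists_injOn hs hl hN hR hsN hX hX') (Y := Z.image id)
    (by
      intro x hx
      obtain ⟨p, hp, rfl⟩ := Finset.mem_image.1 hx
      rw [hKc]
      refine mul_add_lt (hash_lt hQ ((hZ' p hp).1.trans_le hm) ?_) (hZ' p hp).2
      rw [hK]
      exact (hG j hj).1)
    (Finset.card_image_le.trans (hZ.trans hks))
  refine ⟨j, hj, c, hc, ?_⟩
  intro p hp p' hp' h
  have h1 := hinj' (Finset.mem_coe.2 (Finset.mem_image_of_mem id hp))
    (Finset.mem_coe.2 (Finset.mem_image_of_mem id hp')) h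
  obtain ⟨h2, h3⟩ := mul_add_inj (hZ' p hp).2 (hZ' p' hp').2 h1
  rw [hK] at h2
  have h4 := hinj (Finset.mem_coe.2 (Finset.mem_image_of_mem Prod.fst hp))
    (Finset.mem_coe.2 (Finset.mem_image_of_mem Prod.fst hp')) h2
  exact Prod.ext h4 h3

end LoopLang

/-! ### Estimates for the parameters -/

namespace Param

variable {m k : ℕ}

theorem le_two_pow_lam (k : ℕ) : k ≤ 2 ^ lam k := Nat.le_pow_clog (by decide) k

theorem lam_pos (hk : 2 ≤ k) : 0 < lam k := Nat.clog_pos (by decide) hk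

theorem two_pow_lam_le (hk : 2 ≤ k) : 2 ^ lam k ≤ 2 * k := by
  have h1 := Nat.pow_pred_clog_lt_self (b := 2) (by decide) (show 1 < k by omega)
  have h2 := lam_pos hk
  have h3 : lam k = (Nat.clog 2 k).pred + 1 := by simp only [lam] at h2 ⊢; rw [Nat.pred_eq_sub_one]; omega
  rw [h3, pow_succ]
  omega

theorem lam_le (k : ℕ) : lam k ≤ k := Nat.clog_le_of_le_pow Nat.lt_two_pow_self.le

theorem sq_le_two_pow (a : ℕ) : a ^ 2 ≤ 2 ^ (a + 1) := by
  induction a with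
  | zero => simp
  | succ a ih =>
    rcases lt_or_ge a 3 with h | h
    · interval_cases a <;> simp
    · rw [pow_succ 2 (a + 1)]; nlinarith

/-- Due to this, `2 ^ O(lam k ^ 2)` is also `2 ^ O(k)`, which keeps the words at `O(k + L)` bits. -/
theorem lam_sq_le (hk : 2 ≤ k) : lam k ^ 2 ≤ 4 * k := by
  have h1 := two_pow_lam_le hk
  have h2 := sq_le_two_pow (lam k)
  rw [pow_succ 2] at h2
  omega

theorem lam_le_two_pow (k : ℕ) : lam k ≤ 2 ^ lam k := Nat.lt_two_pow_self.le

theorem blk_le (hk : 2 ≤ k) : blk k ≤ k / 10 + 1 := by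
  have h := lam_pos hk
  have : k / ell k ≤ k / 10 := Nat.div_le_div_left (by unfold ell; omega) (by decide)
  unfold blk
  omega

theorem blk_le_two_pow (hk : 2 ≤ k) : blk k ≤ 2 ^ lam k :=
  (blk_le hk).trans ((by omega : k / 10 + 1 ≤ k).trans (le_two_pow_lam k))

theorem blk_pos (k : ℕ) : 0 < blk k := Nat.succ_pos _

/-- Rounding up the blocks adds at most `10 * lam k` colours to `k`, a polynomial factor in the
number of masks. -/
theorem ell_mul_blk_le (k : ℕ) : ell k * blk k ≤ k + 10 * lam k := by
  unfold blk
  have : ell k * (k / ell k) ≤ k := Nat.mul_div_le _ _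
  rw [mul_add, mul_one]
  have : ell k = 10 * lam k := rfl
  omega

theorem le_ell_mul_blk (hk : 2 ≤ k) : k ≤ ell k * blk k := by
  have h := lam_pos hk
  exact (Nat.lt_mul_div_succ k (show 0 < ell k by unfold ell; omega)).le

theorem K_pos (hk : 2 ≤ k) : 0 < K k := by unfold K; positivity

theorem Kc_pos (hk : 2 ≤ k) : 0 < Kc k := by have := K_pos hk; unfold Kc; positivity

theorem R_pos (hk : 2 ≤ k) : 0 < R k :=
  Nat.mul_pos (Nat.succ_pos _) (Nat.mul_pos (by have := lam_pos hk; omega) (blk_pos k))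

theorem D_pos (hk : 2 ≤ k) : 0 < D k := Nat.mul_pos (Nat.succ_pos _) (R_pos hk)

theorem K_le (k : ℕ) : K k ≤ 2 * (2 ^ lam k) ^ 2 :=
  Nat.mul_le_mul_left 2 (Nat.pow_le_pow_left (le_two_pow_lam k) 2)

/-- `Kc k` is `8 * k ^ 7`. Thus `10 * lam k` bits suffice for the name of a copy; hence the `10` in
`ell` and `R`. -/
theorem Kc_le (hk : 2 ≤ k) : Kc k ≤ (2 ^ lam k) ^ 10 := by
  have h2 : 2 ≤ 2 ^ lam k := by
    calc 2 = 2 ^ 1 := rfl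
      _ ≤ _ := Nat.pow_le_pow_right (by decide) (lam_pos hk)
  calc Kc k = 2 ^ 3 * k ^ 7 := by unfold Kc K; ring
    _ ≤ (2 ^ lam k) ^ 3 * (2 ^ lam k) ^ 7 :=
      Nat.mul_le_mul (Nat.pow_le_pow_left h2 3) (Nat.pow_le_pow_left (le_two_pow_lam k) 7)
    _ = _ := by ring

/-- The exponent is the `l` of `Good.exists_injOn` for which `R` provides enough functions. It
equals `ell k * blk k`, hence is at most `k + 10 * lam k`. -/
theorem Kc_pow_le (hk : 2 ≤ k) : Kc k ^ blk k ≤ 2 ^ (10 * lam k * blk k) := by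
  rw [pow_mul, mul_comm 10, pow_mul]
  exact Nat.pow_le_pow_left (Kc_le hk) _

/-- Rounding up at most doubles the root, because `root m ≤ 2 * (root m - 1)` and `(root m - 1) ^ 3
< m`. -/
theorem root_pow_le (hm : 2 ≤ m) : root m ^ 3 ≤ 8 * m := by
  have h1 : 1 < root m := lt_root_iff.2 (by omega)
  have h2 : (root m - 1) ^ 3 < m := lt_root_iff.1 (by omega)
  calc root m ^ 3 ≤ (2 * (root m - 1)) ^ 3 := Nat.pow_le_pow_left (by omega) 3
    _ = 8 * (root m - 1) ^ 3 := by ring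
    _ ≤ 8 * m := by omega

theorem one_lt_root (hm : 2 ≤ m) : 1 < root m := lt_root_iff.2 (by omega)

theorem T_pos (hm : 2 ≤ m) : 0 < T m := Nat.clog_pos (by decide) (one_lt_root hm)

theorem two_pow_T_le (hm : 2 ≤ m) : 2 ^ T m ≤ 2 * m := by
  have h1 := Nat.pow_pred_clog_lt_self (b := 2) (by decide) (one_lt_root hm)
  have h2 := T_pos hm
  have h3 : T m = (Nat.clog 2 (root m)).pred + 1 := by
    simp only [T] at h2 ⊢; rw [Nat.pred_eq_sub_one]; omega
  have := root_le m
  rw [h3, pow_succ]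
  omega

/-- The number of values of a digit, without using the exact value of `s ^ s / s!`. -/
theorem D_le (hk : 2 ≤ k) : (D k : ℝ) ≤ (2 ^ lam k) ^ 18 * Real.exp (blk k) := by
  set W : ℝ := 2 ^ lam k with hW
  set s := blk k with hs
  have hW2 : 2 ≤ W := by
    calc (2 : ℝ) = 2 ^ 1 := by norm_num
      _ ≤ _ := pow_le_pow_right₀ (by norm_num) (lam_pos hk)
  have h1 : ((Kc k : ℕ) : ℝ) ≤ W ^ 10 := by rw [hW]; exact_mod_cast Kc_le hk
  -- `s ^ s / s!` is one term of the series of `exp s`.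
  have h2 : ((s ^ s / s.factorial : ℕ) : ℝ) ≤ Real.exp s := by
    refine Nat.cast_div_le.trans ?_
    push_cast
    exact Real.pow_div_factorial_le_exp _ (by positivity) _
  have h3 : (1 : ℝ) ≤ Real.exp s := Real.one_le_exp (by positivity)
  have h4 : (lam k : ℝ) ≤ W := by rw [hW]; exact_mod_cast lam_le_two_pow k
  have h5 : (s : ℝ) ≤ W := by rw [hW]; exact_mod_cast blk_le_two_pow hk
  have h6 : (1 : ℝ) ≤ W ^ 10 := one_le_pow₀ (by linarith)
  calc (D k : ℝ) = (Kc k + 1) * ((((s ^ s / s.factorial : ℕ) : ℝ) + 1) * (10 * lam k * s)) := by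
        simp only [D, R]; push_cast; rw [hs]
    _ ≤ (W ^ 10 + W ^ 10) * ((Real.exp s + Real.exp s) * (10 * W * W)) := by gcongr
    _ = 40 * W ^ 12 * Real.exp s := by ring
    _ ≤ W ^ 6 * W ^ 12 * Real.exp s := by
        gcongr
        calc (40 : ℝ) ≤ 2 ^ 6 := by norm_num
          _ ≤ W ^ 6 := by gcongr
    _ = _ := by ring

theorem exp_le_four_pow (a : ℕ) : Real.exp a ≤ 4 ^ a := by
  rw [← Real.exp_one_pow]
  gcongr
  linarith [Real.exp_one_lt_d9]

/-- Over all blocks the factors `exp (blk k)` multiply to `exp (ell k * blk k)`, at most `exp k`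
times `4 ^ (10 * lam k) = (2 ^ lam k) ^ 20`. The polynomial factors give the exponent `18 * 10 * lam
k ^ 2`; they are the source of `k ^ O(log k)`. -/
theorem D_pow_le (hk : 2 ≤ k) :
    (D k : ℝ) ^ ell k ≤ 2 ^ (180 * lam k ^ 2) * (2 ^ lam k) ^ 20 * Real.exp k := by
  calc (D k : ℝ) ^ ell k ≤ ((2 ^ lam k) ^ 18 * Real.exp (blk k)) ^ ell k := by
        gcongr; exact D_le hk
    _ = 2 ^ (180 * lam k ^ 2) * Real.exp ((ell k * blk k : ℕ) : ℝ) := by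
        rw [mul_pow, ← Real.exp_nat_mul, ← pow_mul, ← pow_mul]
        congr 2
        · unfold ell; ring
        · push_cast; ring
    _ ≤ 2 ^ (180 * lam k ^ 2) * Real.exp ((k : ℝ) + (10 * lam k : ℕ)) := by
        gcongr
        exact_mod_cast ell_mul_blk_le k
    _ ≤ 2 ^ (180 * lam k ^ 2) * (Real.exp k * 4 ^ (10 * lam k)) := by
        rw [Real.exp_add]
        gcongr
        exact exp_le_four_pow _
    _ = _ := by
        rw [show (4 : ℝ) = 2 ^ 2 by norm_num, ← pow_mul, ← pow_mul,
          show 2 * (10 * lam k) = lam k * 20 by ring]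
        ring

end Param

namespace LoopLang

open HashFamily RouteSearch Param

/-! ### The algorithm -/

def prepareCmd : Cmd :=
  clogCmd .lam .k ;; rootCmd ;; clogCmd .T .Q ;; sizesCmd ;; waypointCmd

def hashesCmd : Cmd :=
  (.set .gN ♯.Q ;; .set .gs (.lit 2) ;; .set .gr ♯.K ;; .set .gA (♯.Q * ♯.Q) ;; .set .gR ♯.M) ;;
  greedyCmd .hashes 1 2

def colorsCmd : Cmd :=
  powCmd ♯.Kc .s ;;
  (.set .gN ♯.Kc ;; .set .gs ♯.s ;; .set .gr ♯.s ;; .set .gA ♯.pw ;; .set .gR ♯.R) ;;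
  greedyCmd .colors 0 1

/-- Decides the instance given by the input. -/
def decideCmd : Cmd :=
  (readCmd ;; countCmd) ;;
  .ite (.lt ♯.k ♯.q) .skip (prepareCmd ;; hashesCmd ;; colorsCmd ;; mainCmd)

/-- The scheme that is used for `m` edges and the bound `k`. -/
def scheme (m k : ℕ) (G F : ℕ → ℕ → ℕ) : Scheme :=
  ⟨root m, K k, Kc k, ell k, blk k, R k, G, F⟩

def prepareTime (n m k : ℕ) : ℕ :=
  k * 30 + m * 30 + root m * 30 + (blk k + ell k + ell k * blk k) * 30 + n * 40 + 280

def hashesTime (m k : ℕ) : ℕ := greedyTime (root m) 2 (K k) (M m k) + 30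

def colorsTime (k : ℕ) : ℕ := blk k * 15 + greedyTime (Kc k) (blk k) (blk k) (R k) + 40

def mainTime (n m k q : ℕ) : ℕ :=
  M m k * (D k ^ ell k * (roundTime n m k (ell k) (blk k)
    (2 ^ (ell k * blk k + q) * (k + 1)) + 5) + 10) + 10

/-- All numbers that occur in the algorithm are below `V`. -/
structure AlgorithmSmall (I : DWRP) (k B V len : ℕ) : Prop where
  sizes : SizesSmall I.m k V
  search : ∀ G F, (scheme I.m k G F).Small I k (M I.m k) B V len
  len_le : 4 + 4 * I.m + I.n ≤ len
  k_lt : 2 * k + 2 < V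
  m_lt : I.m + 1 < V
  root_lt : 2 * root I.m + 2 < V
  cube_lt : root I.m ^ 3 < V
  tot_lt : 2 ^ (ell k * blk k + I.waypoints.card) * (k + 1) < V
  K_sq_lt : K k ^ 2 < V
  hashes_lt : K k ^ 2 * (4 ^ T I.m * root I.m ^ 2) < V
  pow_lt : blk k ^ blk k * Kc k ^ blk k < V

variable {I : DWRP} {k B V len : ℕ} {σ : St}

theorem spec_prepareCmd (hk : 2 ≤ k) (hs : AlgorithmSmall I k B V len)
    (hin : Encodes I k σ.inp) (hne : I.waypoints.Nonempty)
    (g : σ.Has [(.n, I.n), (.m, I.m), (.k, k), (.b, I.budget), (.out, 0)]) :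
    Spec V len prepareCmd (prepareTime I.n I.m k) σ (fun τ => ∃ w₀ ∈ I.waypoints,
      (∀ G F, τ.Has ((scheme I.m k G F).vars I k w₀ (M I.m k) (D k ^ ell k))) ∧
      τ.Has [(.out, 0), (.R, R k)] ∧
      ∀ v : Fin I.n, τ.arr .wbit v =
        if v ∈ I.waypoints then 2 ^ (ell k * blk k + rank I v) else 0) := by
  have hlen := (hs.search 0 0).len_lt
  refine Spec.seq (spec_clogCmd (N := k) (by decide) (by decide) (by decide) (by decide) (by decide)
    (g (.k, k) (by simp)) hs.k_lt)
    (t₂ := I.m * 30 + root I.m * 30 + (blk k + ell k + ell k * blk k) * 30 + I.n * 40 + 270)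
    ?_ (by unfold prepareTime; omega)
  intro τ₁ fr₁ h1
  have g1 := (g.frame fr₁ rfl).cons h1
  rw [← fr₁.inp] at hin
  clear fr₁ h1 g
  refine Spec.seq (spec_rootCmd (m := I.m) (g1 (.m, I.m) (by simp)) hs.cube_lt hs.m_lt)
    (t₂ := root I.m * 30 + (blk k + ell k + ell k * blk k) * 30 + I.n * 40 + 260)
    ?_ (by omega)
  intro τ₂ fr₂ h2
  have g2 := (g1.frame fr₂ rfl).cons h2
  rw [← fr₂.inp] at hin
  clear fr₂ h2 g1
  refine Spec.seq (spec_clogCmd (N := root I.m) (by decide) (by decide) (by decide) (by decide)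
    (by decide) (g2 (.Q, root I.m) (by simp)) hs.root_lt)
    (t₂ := (blk k + ell k + ell k * blk k) * 30 + I.n * 40 + 250) ?_ (by omega)
  intro τ₃ fr₃ h3
  have g3 := (g2.frame fr₃ rfl).cons h3
  rw [← fr₃.inp] at hin
  clear fr₃ h3 g2
  refine Spec.seq (spec_sizesCmd (m := I.m) hk hs.sizes
    (fun p hp => g3 p (by simp [lam, T] at hp ⊢; tauto))) (t₂ := I.n * 40 + 50) ?_ (by omega)
  intro τ₄ fr₄ h4
  have g4 := g3.frame fr₄ rfl
  rw [← fr₄.inp] at hin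
  clear fr₄ g3
  have g5 : τ₄.Has ([(.ell, ell k), (.s, blk k), (.K, K k), (.M, M I.m k), (.Kc, Kc k), (.R, R k),
      (.D, D k), (.L, D k ^ ell k), (.two_t, 2 ^ (ell k * blk k)), (.Q, root I.m), (.n, I.n),
      (.m, I.m), (.k, k), (.b, I.budget), (.out, 0)]) := by
    simp [St.Has] at h4 g4 ⊢
    simp [h4, g4]
  clear h4 g4
  refine (spec_waypointCmd (t := ell k * blk k) hin hs.len_le hlen hs.tot_lt hne
    (fun p hp => g5 p (by simp at hp ⊢; tauto))).mono le_rfl ?_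
  rintro τ₅ fr₅ ⟨⟨w₀, hw₀, hw₀'⟩, h6, h7⟩
  have g6 := g5.frame fr₅ rfl
  refine ⟨w₀, hw₀, fun G F => ?_, ?_, h7⟩
  · simp [St.Has] at h6 g6
    simp [St.Has, Scheme.vars, scheme, h6, g6, hw₀', Scheme.D, D]
  · simp [St.Has] at g6
    simp [St.Has, g6]

theorem spec_hashesCmd (hk : 2 ≤ k) (hm : 0 < I.m) (hs : AlgorithmSmall I k B V len)
    (g : σ.Has [(.Q, root I.m), (.K, K k), (.M, M I.m k)]) :
    Spec V len hashesCmd (hashesTime I.m k) σ (fun τ =>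
      Good (root I.m) 2 (K k) 1 2 (fun j x => τ.arr .hashes (j * root I.m + x)) (M I.m k)) := by
  have hs' := hs.search 0 0
  have hK : 0 < K k := by unfold K; positivity
  have hQ : 0 < root I.m := lt_root_iff.2 (by simpa using hm)
  refine Spec.flat_seq (c := 30) (t₂ := greedyTime (root I.m) 2 (K k) (M I.m k)) rfl (by decide)
    ?_ ?_ (by unfold hashesTime; omega)
  · simp [St.Has] at g
    have := hs'.sq_lt
    simp [scheme] at this
    simp [Cmd.Ok, Cmd.run, g, this]
  intro τ hτ fr
  refine spec_greedyCmd (s := 2) hQ hK (by decide) hs'.hashes_lt hs.K_sq_lt ?_ ?_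
  · intro f j hj hf
    refine lt_of_le_of_lt (Nat.mul_le_mul_left _ ?_) hs.hashes_lt
    exact hf.sum_weights_le hK le_rfl hj
  · simp [St.Has] at g
    simp [St.Has, greedyParams, hτ, Cmd.run, g, sq]

theorem spec_colorsCmd (hk : 2 ≤ k) (hs : AlgorithmSmall I k B V len)
    (g : σ.Has [(.Kc, Kc k), (.s, blk k), (.R, R k)]) :
    Spec V len colorsCmd (colorsTime k) σ (fun τ =>
      Good (Kc k) (blk k) (blk k) 0 1 (fun j x => τ.arr .colors (j * Kc k + x)) (R k)) := by
  have hs' := hs.search 0 0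
  have hKc : 0 < Kc k := by unfold Kc K; positivity
  have hb : 0 < blk k := Nat.succ_pos _
  have hV1 : Kc k ^ blk k < V := (Nat.le_mul_of_pos_left _ (by positivity)).trans_lt hs.pow_lt
  have hV2 : blk k ^ blk k < V := (Nat.le_mul_of_pos_right _ (by positivity)).trans_lt hs.pow_lt
  refine Spec.seq (spec_powCmd (b := Kc k) (N := blk k) (by simp)
    (by simpa using g (.Kc, Kc k) (by simp)) (by simp) (g (.s, blk k) (by simp)) (by decide)
    (by decide) hKc hV1) (t₂ := greedyTime (Kc k) (blk k) (blk k) (R k) + 30)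
    ?_ (by unfold colorsTime; omega)
  intro τ fr hpw
  have g1 := (g.frame fr rfl).cons hpw
  refine Spec.flat_seq (c := 20) (t₂ := greedyTime (Kc k) (blk k) (blk k) (R k)) rfl (by decide)
    (by simp [Cmd.Ok]) ?_ (by omega)
  intro τ₁ hτ₁ fr₁
  refine spec_greedyCmd hKc hb (by decide) hs'.colors_lt hV2 ?_ ?_
  · intro f j _ _
    refine lt_of_le_of_lt (Nat.mul_le_mul_left _ ?_) hs.pow_lt
    exact sum_weights_le_pow f j
  · simp [St.Has] at g1
    simp [St.Has, greedyParams, hτ₁, Cmd.run, g1]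

theorem spec_readCmd (hin : Encodes I k σ.inp) (h0 : σ.Has [(.q, 0), (.out, 0)])
    (hlen : 4 + 4 * I.m + I.n ≤ len) (hlen' : len < V) :
    Spec V len (readCmd ;; countCmd) (I.n * 30 + 30) σ (fun τ =>
      τ.Has [(.n, I.n), (.m, I.m), (.k, k), (.b, I.budget), (.q, I.waypoints.card), (.out, 0)] ∧
        Encodes I k τ.inp) := by
  refine Spec.flat_seq (c := 20) (t₂ := I.n * 30 + 10) rfl (by decide) ?_ ?_ (by omega)
  · simp [readCmd, Cmd.Ok]; omega
  intro τ hτ fr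
  have g : τ.Has [(.n, I.n), (.m, I.m), (.k, k), (.b, I.budget)] := by
    simp [St.Has, hτ, readCmd, Cmd.run, hin.n, hin.m, hin.k, hin.budget]
  have g1 := h0.frame fr rfl
  rw [← fr.inp] at hin
  refine (spec_countCmd hin hlen hlen' ?_).mono le_rfl ?_
  · simp [St.Has] at g g1 ⊢
    simp [g, g1]
  · intro τ' fr' h
    have g2 := g.frame fr' rfl
    have g3 := fr'.reg .out rfl
    rw [← fr'.inp] at hin
    refine ⟨?_, hin⟩
    simp [St.Has] at g1 g2 ⊢
    simp [g1, g2, g3, h]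

theorem spec_decideCmd_of_lt (hin : Encodes I k σ.inp) (h0 : σ.Has [(.q, 0), (.out, 0)])
    (hlen : 4 + 4 * I.m + I.n ≤ len) (hlen' : len < V) (hq : k < I.waypoints.card) :
    Spec V len decideCmd (I.n * 30 + 60) σ (fun τ => τ.reg .out = 0) := by
  refine Spec.seq (spec_readCmd hin h0 hlen hlen') (t₂ := 20) ?_ (by omega)
  rintro τ - ⟨g, -⟩
  simp [St.Has] at g
  refine Spec.ite (t := 1) (by simp) (by simp) ?_ ?_ (by simp)
  · intro _
    exact Spec.flat 1 rfl (by decide) le_rfl trivial (by simp [Cmd.run, g])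
  · intro h
    simp [g] at h
    omega

theorem spec_decideCmd (hin : Encodes I k σ.inp) (h0 : σ.Has [(.q, 0), (.out, 0)]) (hk : 2 ≤ k)
    (hm : 2 ≤ I.m) (hs : AlgorithmSmall I k B V len) (hq : I.waypoints.card ≤ k)
    (hne : I.waypoints.Nonempty) :
    Spec V len decideCmd (I.n * 30 + 60 + prepareTime I.n I.m k + hashesTime I.m k + colorsTime k +
      mainTime I.n I.m k I.waypoints.card) σ
      (fun τ => (I.HasSolutionOfSize k → τ.reg .out = 1) ∧
        (¬ I.HasSolutionOfSize k → τ.reg .out = 0)) := by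
  have hlen' := (hs.search 0 0).len_lt
  have hlen := hs.len_le
  refine Spec.seq (spec_readCmd hin h0 hlen hlen')
    (t₂ := 20 + prepareTime I.n I.m k + hashesTime I.m k + colorsTime k +
      mainTime I.n I.m k I.waypoints.card) ?_ (by omega)
  clear hin
  · rintro τ - ⟨g, hin⟩
    refine Spec.ite (t := 10 + prepareTime I.n I.m k + hashesTime I.m k + colorsTime k +
      mainTime I.n I.m k I.waypoints.card) (by simp) (by simp) ?_ ?_ (by simp; omega)
    · intro h
      simp [St.Has] at g
      simp [g] at h
      omega
    intro _
    refine Spec.seq (spec_prepareCmd hk hs hin hne (fun p hp => g p (by simp at hp ⊢; tauto)))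
      (t₂ := hashesTime I.m k + colorsTime k + mainTime I.n I.m k I.waypoints.card) ?_ (by omega)
    rintro τ₁ fr₁ ⟨w₀, hw₀, g1, g2, g3⟩
    rw [← fr₁.inp] at hin
    clear fr₁ g
    refine Spec.seq (spec_hashesCmd hk (by omega) hs
      (fun p hp => g1 0 0 p (by simp [Scheme.vars, scheme] at hp ⊢; tauto)))
      (t₂ := colorsTime k + mainTime I.n I.m k I.waypoints.card) ?_ (by omega)
    intro τ₂ fr₂ hG
    replace g1 := fun G F => (g1 G F).frame fr₂ rfl
    replace g2 := g2.frame fr₂ rfl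
    rw [← fr₂.arr .wbit rfl] at g3
    rw [← fr₂.inp] at hin
    clear fr₂
    refine Spec.seq (spec_colorsCmd hk hs (fun p hp => by
      simp only [List.mem_cons, List.not_mem_nil, or_false] at hp
      rcases hp with rfl | rfl | rfl
      · exact g1 0 0 (.Kc, Kc k) (by simp [Scheme.vars, scheme])
      · exact g1 0 0 (.s, blk k) (by simp [Scheme.vars, scheme])
      · exact g2 (.R, R k) (by simp)))
      (t₂ := mainTime I.n I.m k I.waypoints.card) ?_ (by omega)
    intro τ₃ fr₃ hF
    replace g1 := fun G F => (g1 G F).frame fr₃ rfl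
    replace g2 := g2.frame fr₃ rfl
    rw [← fr₃.arr .wbit rfl] at g3
    rw [← fr₃.arr .hashes rfl] at hG
    rw [← fr₃.inp] at hin
    clear fr₃
    -- The functions of the scheme are read off the arrays, so the conditions on the arrays hold by
    -- definition.
    set z := scheme I.m k (fun j x => τ₃.arr .hashes (j * root I.m + x))
      (fun j x => τ₃.arr .colors (j * Kc k + x)) with hz
    have hlam : 0 < lam k := Nat.clog_pos (by decide) hk
    have hQ : 0 < root I.m := lt_root_iff.2 (by simp; omega)
    have hvalid : z.Valid I.m k (M I.m k) :=
      { R_pos := Nat.mul_pos (Nat.succ_pos _) (Nat.mul_pos (by omega) (Nat.succ_pos _))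
        s_pos := Nat.succ_pos _
        ell_pos := by simp only [hz, scheme, ell]; omega
        Kc_eq := rfl
        m_le := le_root_pow _
        Q_pos := hQ
        G_lt := fun j hj => (hG j hj).1
        F_lt := fun j hj => (hF j hj).1 }
    have harr : z.Arrays I (M I.m k) (fun v => rank I v) τ₃ :=
      { hashes := fun _ _ _ _ => rfl
        colors := fun _ _ _ _ => rfl
        wbit := g3 }
    have hT : 0 < T I.m := Nat.clog_pos (by decide) (lt_root_iff.2 (by simp; omega))
    -- If a solution exists, a colouring counts as good when it is injective on the copies of one
    -- fixed solution, and some colouring is. Otherwise soundness alone decides.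
    by_cases hsol : I.HasSolutionOfSize k
    · obtain ⟨Z, hZ, hZ', hZ''⟩ := exists_copies hsol hw₀
      obtain ⟨j, hj, c, hc, hinj⟩ := Scheme.exists_injOn (z := z) (m := I.m) (k := k) (T := T I.m)
        (l := 10 * lam k * blk k) hG hF rfl rfl (by omega) hT (Nat.le_pow_clog (by decide) _)
        (le_root_pow _) (Nat.succ_pos _) (Nat.mul_pos (by omega) (Nat.succ_pos _)) hQ
        (Kc_pow_le hk) le_rfl
        (by
          refine ((Param.blk_le hk).trans (by omega : k / 10 + 1 ≤ k + 1)).trans ?_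
          change k + 1 ≤ (2 * k ^ 2) ^ 3 * k
          have : 1 ≤ k ^ 6 := Nat.one_le_pow _ _ (by omega)
          calc k + 1 ≤ 8 * 1 * k := by omega
            _ ≤ 8 * k ^ 6 * k := by gcongr
            _ = _ := by ring)
        (le_ell_mul_blk hk) hZ hZ'
      refine (spec_mainCmd (Wit := fun j c => Set.InjOn (fun p : ℕ × ℕ => z.col k j c p.1 p.2) Z)
        hvalid (by omega) (hs.search _ _) hw₀ (bijOn_rank I) hin (g1 _ _) (g2 (.out, 0) (by simp))
        harr (fun j c h S hS => hZ'' hS h)).mono le_rfl ?_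
      rintro τ - ⟨-, h⟩
      exact ⟨fun _ => h ⟨j, hj, c, hc, hinj⟩, fun h => absurd hsol h⟩
    · refine (spec_mainCmd (Wit := fun _ _ => False)
        hvalid (by omega) (hs.search _ _) hw₀ (bijOn_rank I) hin (g1 _ _) (g2 (.out, 0) (by simp))
        harr (fun j c h => h.elim)).mono le_rfl ?_
      rintro τ - ⟨h, -⟩
      refine ⟨fun h' => absurd h' hsol, fun _ => ?_⟩
      rcases h with h | h
      · exact h
      · exact absurd h.2 hsol

end LoopLang

/-! ### Bounds for the numbers -/

namespace LoopLang

open Param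

theorem mul_le_two_pow {x y a b : ℕ} (hx : x ≤ 2 ^ a) (hy : y ≤ 2 ^ b) : x * y ≤ 2 ^ (a + b) := by
  rw [pow_add]; exact Nat.mul_le_mul hx hy

theorem add_le_two_pow {x y a : ℕ} (hx : x ≤ 2 ^ a) (hy : y ≤ 2 ^ a) : x + y ≤ 2 ^ (a + 1) := by
  rw [pow_succ]; omega

theorem lt_two_pow_of_le {x a b : ℕ} (hx : x ≤ 2 ^ a) (h : a < b) : x < 2 ^ b :=
  hx.trans_lt (Nat.pow_lt_pow_right (by decide) h)

theorem le_two_pow_of_le {x a b : ℕ} (hx : x ≤ 2 ^ a) (h : a ≤ b) : x ≤ 2 ^ b :=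
  hx.trans (Nat.pow_le_pow_right (by decide) h)

theorem pow_le_two_pow {x a : ℕ} (b : ℕ) (hx : x ≤ 2 ^ a) : x ^ b ≤ 2 ^ (a * b) := by
  rw [pow_mul]; exact Nat.pow_le_pow_left hx b

/-- The exponent is `180 * 4 + 20 + 2`, from `lam k ^ 2 ≤ 4 * k`, `lam k ≤ k` and `e ≤ 4`. -/
theorem D_pow_le_two_pow {k : ℕ} (hk : 2 ≤ k) : D k ^ ell k ≤ 2 ^ (742 * k) := by
  have h1 := D_pow_le hk
  have h2 := lam_sq_le hk
  have h3 := lam_le k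
  have h : ((D k ^ ell k : ℕ) : ℝ) ≤ ((2 ^ (742 * k) : ℕ) : ℝ) := by
    push_cast
    calc (D k : ℝ) ^ ell k ≤ 2 ^ (180 * lam k ^ 2) * (2 ^ lam k) ^ 20 * Real.exp k := h1
      _ ≤ 2 ^ (180 * (4 * k)) * (2 ^ k) ^ 20 * 4 ^ k := by
          gcongr
          · norm_num
          · norm_num
          · exact exp_le_four_pow k
      _ = 2 ^ (742 * k) := by
          rw [show (4 : ℝ) = 2 ^ 2 by norm_num, ← pow_mul, ← pow_mul, ← pow_add, ← pow_add]
          congr 1; ring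
  exact_mod_cast h

/-- The largest demand in `k` is `2 ^ (742 * k)`, from the number of colourings; the remaining
numbers need small multiples of `k` and `L`. The constant `1000` is generous. -/
theorem algorithmSmall {I : DWRP} {k L len : ℕ} (hk : 2 ≤ k) (hm : 2 ≤ I.m) (hn : I.n < 2 ^ L)
    (hmL : I.m < 2 ^ L) (hkL : k < 2 ^ L) (hb : I.budget < 2 ^ L) (hw : ∀ e, I.weight e < 2 ^ L)
    (hq : I.waypoints.card ≤ k) (hlen : len = 4 + 4 * I.m + I.n) :
    AlgorithmSmall I k (2 ^ L) (2 ^ (1000 * (k + L))) len := by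
  have hL : 1 < L := by
    by_contra! h
    have : 2 ^ L ≤ 2 ^ 1 := Nat.pow_le_pow_right (by decide) h
    omega
  have hlam := lam_pos hk
  have hlam' := lam_le k
  have hlsq := lam_sq_le hk
  have hts := ell_mul_blk_le k
  have hell : ell k = 10 * lam k := rfl
  have one {a : ℕ} : 1 ≤ 2 ^ a := Nat.one_le_two_pow
  have hk2 : k ≤ 2 ^ k := Nat.lt_two_pow_self.le
  have htot : 2 ^ (ell k * blk k + I.waypoints.card) * (k + 1) ≤ 2 ^ (13 * k + 1) :=
    (mul_le_two_pow le_rfl (add_le_two_pow hk2 one)).trans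
      (Nat.pow_le_pow_right (by decide) (by omega))
  have hDp := D_pow_le_two_pow hk
  have hD : D k ≤ 2 ^ (742 * k) := (Nat.le_self_pow (by omega) _).trans hDp
  have hKc : Kc k ≤ 2 ^ (10 * k) := by
    refine (Kc_le hk).trans ?_
    rw [← pow_mul]
    exact Nat.pow_le_pow_right (by decide) (by omega)
  have hKcR : R k * Kc k ≤ D k := by
    unfold D; rw [mul_comm]; exact Nat.mul_le_mul_right _ (Nat.le_succ _)
  have hK : K k ≤ 2 ^ (2 * k + 1) := by
    refine (K_le k).trans ?_
    rw [← pow_mul, ← pow_succ']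
    exact Nat.pow_le_pow_right (by decide) (by omega)
  have hK3 : K k ^ 3 ≤ Kc k := Nat.le_mul_of_pos_right _ (by omega)
  have hQ : root I.m ≤ 2 ^ L := (root_le _).trans hmL.le
  have hT : T I.m ≤ 2 ^ L := (clog_le_self _).trans hQ
  have h2T : 2 ^ T I.m ≤ 2 ^ (L + 1) := by
    have := two_pow_T_le hm
    rw [pow_succ]; omega
  have hss : blk k ^ blk k ≤ 2 ^ (2 * k) := by
    refine (pow_le_two_pow _ (blk_le_two_pow hk)).trans (Nat.pow_le_pow_right (by decide) ?_)
    have : 10 * (lam k * blk k) ≤ 11 * k := by rw [← mul_assoc, ← hell]; omega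
    omega
  have hKcs : Kc k ^ blk k ≤ 2 ^ (11 * k) := by
    refine (Kc_pow_le hk).trans (Nat.pow_le_pow_right (by decide) ?_)
    rw [← hell]; omega
  have hM : M I.m k ≤ 2 ^ (2 * k + 1 + L) := mul_le_two_pow hK hT
  have h4T : 4 ^ T I.m ≤ 2 ^ ((L + 1) * 2) := by
    rw [show 4 = 2 ^ 2 from rfl, ← pow_mul, mul_comm, pow_mul]
    exact pow_le_two_pow 2 h2T
  refine
    { sizes :=
        { k_lt := lt_two_pow_of_le (a := 4 + k)
            (mul_le_two_pow (by decide) (hlam'.trans hk2)) (by omega)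
          s_lt := lt_two_pow_of_le (blk_le_two_pow hk) (by omega)
          M_lt := lt_two_pow_of_le hM (by omega)
          Kc_lt := lt_two_pow_of_le (add_le_two_pow hKc one) (by omega)
          s_pow_lt := lt_two_pow_of_le (add_le_two_pow hss one) (by omega)
          D_lt := lt_two_pow_of_le hD (by omega)
          D_pow_lt := lt_two_pow_of_le hDp (by omega)
          t_lt := Nat.pow_lt_pow_right (by decide) (by omega) }
      search := fun G F =>
        { colors_lt := lt_two_pow_of_le (hKcR.trans hD) (by omega)
          Kc_lt := lt_two_pow_of_le (add_le_two_pow hKc one) (by omega)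
          code_lt := Nat.pow_lt_pow_right (by decide) (by simp only [scheme]; omega)
          hashes_lt := lt_two_pow_of_le (mul_le_two_pow hM hQ) (by omega)
          sq_lt := lt_two_pow_of_le (mul_le_two_pow hQ hQ) (by omega)
          hash_lt := lt_two_pow_of_le (hK3.trans hKc) (by omega)
          copies_lt := lt_two_pow_of_le (mul_le_two_pow hmL.le hkL.le) (by omega)
          cells_lt := lt_two_pow_of_le (mul_le_two_pow (add_le_two_pow htot one)
            (add_le_two_pow hn.le one)) (by omega)
          weights_lt := lt_two_pow_of_le (mul_le_two_pow (add_le_two_pow htot one)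
            (add_le_two_pow le_rfl one)) (by omega)
          masks_lt := by
            refine lt_two_pow_of_le (a := 13 * k + 4) (add_le_two_pow
              (le_two_pow_of_le htot (by omega)) ?_) (by omega)
            refine le_two_pow_of_le (mul_le_two_pow (a := 2) (by decide) le_rfl) ?_
            simp only [scheme]; omega
          full_lt := Nat.pow_lt_pow_right (by decide) (by omega)
          budget_lt := lt_two_pow_of_le (add_le_two_pow hb.le
            (le_two_pow_of_le (a := 1) le_rfl hL.le)) (by omega)
          len_eq := by omega
          len_lt := by
            rw [hlen]
            refine lt_two_pow_of_le (a := L + 4) (add_le_two_pow (add_le_two_pow (a := L + 2)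
              (le_two_pow_of_le (a := 2) le_rfl (by omega)) ?_) (le_two_pow_of_le hn.le (by omega)))
              (by omega)
            exact le_two_pow_of_le (mul_le_two_pow (a := 2) le_rfl hmL.le) (by omega)
          weight_le := fun e => (hw e).le }
      len_le := hlen.ge
      k_lt := lt_two_pow_of_le (add_le_two_pow (a := 1 + k) (mul_le_two_pow (a := 1) le_rfl hk2)
        (le_two_pow_of_le (a := 1) le_rfl (by omega))) (by omega)
      m_lt := lt_two_pow_of_le (add_le_two_pow hmL.le one) (by omega)
      root_lt := lt_two_pow_of_le (add_le_two_pow (a := 1 + L) (mul_le_two_pow (a := 1) le_rfl hQ)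
        (le_two_pow_of_le (a := 1) le_rfl (by omega))) (by omega)
      cube_lt := lt_two_pow_of_le (pow_le_two_pow 3 hQ) (by omega)
      tot_lt := lt_two_pow_of_le htot (by omega)
      K_sq_lt := lt_two_pow_of_le (pow_le_two_pow 2 hK) (by omega)
      hashes_lt := lt_two_pow_of_le (mul_le_two_pow (pow_le_two_pow 2 hK)
        (mul_le_two_pow h4T (pow_le_two_pow 2 hQ))) (by omega)
      pow_lt := lt_two_pow_of_le (mul_le_two_pow hss hKcs) (by omega) }

end LoopLang

/-! ### The input -/

namespace DWRP

theorem getD_flatten {l : List (List ℕ)} {c : ℕ} (hl : ∀ x ∈ l, x.length = c) {i j : ℕ}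
    (hj : j < c) (d : List ℕ) (hi : i < l.length) :
    l.flatten.getD (c * i + j) 0 = (l.getD i d).getD j 0 := by
  induction l generalizing i with
  | nil => simp at hi
  | cons a l ih =>
    have ha := hl a (by simp)
    rw [List.flatten_cons]
    cases i with
    | zero =>
      rw [List.getD_append _ _ _ _ (by omega)]
      simp
    | succ i =>
      rw [List.getD_append_right _ _ _ _ (by rw [ha]; nlinarith),
        show c * (i + 1) + j - a.length = c * i + j by rw [ha, mul_add]; omega,
        ih (fun x hx => hl x (by simp [hx])) (by simpa using hi)]
      simp

variable (I : DWRP) (k : ℕ)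

theorem length_flatten_edges : (List.ofFn fun e : Fin I.m =>
    [(I.src e : ℕ), (I.dst e : ℕ), I.weight e, I.capacity e]).flatten.length = 4 * I.m := by
  simp [List.length_flatten, List.map_ofFn, Function.comp_def, mul_comm]

theorem length_encode : (I.encode k).length = 4 + 4 * I.m + I.n := by
  unfold encode
  rw [List.length_append, List.length_append, length_flatten_edges]
  simp

theorem encode_getD_edge (e : Fin I.m) {j : ℕ} (hj : j < 4) :
    (I.encode k).getD (4 + (4 * e + j)) 0 =
      [(I.src e : ℕ), (I.dst e : ℕ), I.weight e, I.capacity e].getD j 0 := by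
  have := e.2
  unfold encode
  rw [List.getD_append _ _ _ _ (by rw [List.length_append, length_flatten_edges]; simp; omega),
    List.getD_append_right _ _ _ _ (by simp)]
  simp only [List.length_cons, List.length_nil]
  rw [show 4 + (4 * (e : ℕ) + j) - (0 + 1 + 1 + 1 + 1) = 4 * e + j by omega,
    getD_flatten (c := 4) (by simp [List.mem_ofFn]) hj [] (by simp)]
  congr 1
  rw [List.getD_eq_getElem _ _ (by simp)]
  simp

theorem encodes : LoopLang.Encodes I k fun i => (I.encode k).getD i 0 where
  n := rfl
  m := rfl
  k := rfl
  budget := rfl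
  src e := I.encode_getD_edge k e (j := 0) (by decide)
  dst e := by
    rw [show 5 + 4 * (e : ℕ) = 4 + (4 * e + 1) by ring]
    exact I.encode_getD_edge k e (j := 1) (by decide)
  weight e := by
    rw [show 6 + 4 * (e : ℕ) = 4 + (4 * e + 2) by ring]
    exact I.encode_getD_edge k e (j := 2) (by decide)
  capacity e := by
    rw [show 7 + 4 * (e : ℕ) = 4 + (4 * e + 3) by ring]
    exact I.encode_getD_edge k e (j := 3) (by decide)
  waypoint v := by
    unfold encode
    rw [List.getD_append_right _ _ _ _ (by
      rw [List.length_append, length_flatten_edges]; simp)]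
    rw [List.length_append, length_flatten_edges]
    simp only [List.length_cons, List.length_nil]
    rw [show 4 + 4 * I.m + (v : ℕ) - (0 + 1 + 1 + 1 + 1 + 4 * I.m) = v by omega,
      List.getD_eq_getElem _ _ (by simp)]
    simp

variable {I}

theorem StronglyConnected.exists_src (h : I.StronglyConnected) (hn : 2 ≤ I.n) (u : Fin I.n) :
    ∃ e, I.src e = u := by
  obtain ⟨v, hv⟩ : ∃ v : Fin I.n, v ≠ u := by
    by_contra! h'
    have := Fintype.card_le_one_iff.2 fun a b : Fin I.n => (h' a).trans (h' b).symm
    simp at this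
    omega
  obtain ⟨es, hes⟩ := h u v
  cases es with
  | nil => exact absurd hes.symm hv
  | cons e es => exact ⟨e, hes.1⟩

/-- Every vertex has an outgoing edge. The time for clearing the table and reading the waypoints is
therefore covered by `m`. -/
theorem StronglyConnected.n_le_m (h : I.StronglyConnected) (hn : 2 ≤ I.n) : I.n ≤ I.m := by
  have := Fintype.card_le_of_surjective I.src (h.exists_src hn)
  simpa using this

/-- The empty walk visits one vertex only; in a nonempty closed walk every visited vertex, even the
start, is the head of an edge. Hence `k` below the number of waypoints can be rejected at once. -/
theorem HasSolutionOfSize.card_waypoints_le {k : ℕ} (h : I.HasSolutionOfSize k)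
    (hW : 2 ≤ I.waypoints.card) : I.waypoints.card ≤ k := by
  obtain ⟨u, es, hes, hk⟩ := h
  refine le_trans ?_ hk
  cases es with
  | nil =>
    have : I.waypoints ⊆ {u} := fun x hx => by simpa using hes.visits x hx
    have := Finset.card_le_card this
    simp at this
    omega
  | cons e es =>
    have hu : ∃ e' ∈ e :: es, I.dst e' = u := by
      rcases RouteSearch.isWalk_end hes.closed.2 with h | ⟨e', he', h⟩
      · exact ⟨e, by simp, h.symm⟩
      · exact ⟨e', by simp [he'], h⟩
    have hsub : I.waypoints ⊆ ((e :: es).map I.dst).toFinset := by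
      intro x hx
      rw [List.mem_toFinset, List.mem_map]
      rcases hes.visits x hx with rfl | h
      · exact hu
      · exact h
    calc I.waypoints.card ≤ ((e :: es).map I.dst).toFinset.card := Finset.card_le_card hsub
      _ ≤ ((e :: es).map I.dst).length := List.toFinset_card_le _
      _ = _ := List.length_map _

end DWRP

/-! ### Estimates for the time -/

namespace LoopLang

open Param HashFamily

variable {n m k : ℕ}

theorem lam_bounds (hk : 2 ≤ k) : 2 ≤ 2 ^ lam k ∧ k ≤ 2 ^ lam k ∧ ell k ≤ 10 * 2 ^ lam k ∧
    blk k ≤ 2 ^ lam k ∧ K k ≤ 2 * (2 ^ lam k) ^ 2 ∧ Kc k ≤ (2 ^ lam k) ^ 10 :=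
  ⟨by calc 2 = 2 ^ 1 := rfl
        _ ≤ _ := Nat.pow_le_pow_right (by decide) (lam_pos hk),
    le_two_pow_lam k, Nat.mul_le_mul_left 10 (lam_le_two_pow k), blk_le_two_pow hk, K_le k,
    Kc_le hk⟩

theorem prepareTime_le (hk : 2 ≤ k) (hm : 2 ≤ m) (hn : n ≤ m) :
    prepareTime n m k ≤ 900 * m * (2 ^ lam k) ^ 2 := by
  obtain ⟨h1, h2, h3, h4, -, -⟩ := lam_bounds hk
  have h5 := root_le m
  unfold prepareTime
  set W := 2 ^ lam k
  have h6 : ell k * blk k ≤ 10 * W * W := Nat.mul_le_mul h3 h4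
  have h7 : W * 2 ≤ W * W := Nat.mul_le_mul_left W h1
  have h8 : 10 * W * W = 10 * (W * W) := by ring
  have h9 : W * W * 2 ≤ W * W * m := Nat.mul_le_mul_left _ hm
  have h10 : 4 * m ≤ W * W * m := Nat.mul_le_mul_right m (by nlinarith)
  have h11 : 900 * m * W ^ 2 = 900 * (W * W * m) := by ring
  rw [h11]
  omega

/-- The cost is of order `K ^ 2 * T * Q ^ 3`, and `Q ^ 3 ≤ 8 * m` makes it linear in `m` up to `T`.
-/
theorem hashesTime_le (hk : 2 ≤ k) (hm : 2 ≤ m) :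
    hashesTime m k ≤ 44480 * (T m * m) * (2 ^ lam k) ^ 4 := by
  obtain ⟨h1, -, -, -, h5, -⟩ := lam_bounds hk
  have hQ := root_pow_le hm
  have hQ1 := one_lt_root hm
  have hT := T_pos hm
  have hK := K_pos hk
  unfold hashesTime greedyTime M
  rw [show wtTime 2 = 460 from rfl]
  set W := 2 ^ lam k
  set Q := root m
  set κ := K k
  set t := T m
  have e1 : 1 ≤ Q := by omega
  have e2 : 1 ≤ Q ^ 2 := Nat.one_le_pow _ _ e1
  have e3 : Q ≤ Q ^ 3 := Nat.le_self_pow (by decide) Q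
  have e4 : Q ^ 2 ≤ Q ^ 3 := Nat.pow_le_pow_right e1 (by decide)
  have e5 : 1 ≤ κ * t := Nat.mul_pos hK hT
  have e6 : 1 ≤ κ * Q ^ 3 := Nat.mul_pos hK (by omega)
  have e7 : Q ^ 3 ≤ κ * Q ^ 3 := Nat.le_mul_of_pos_left _ hK
  calc κ * t * (Q * (κ * (Q ^ 2 * (460 + 35) + 60) + 70) + Q ^ 2 * (460 + 45) + 50) +
        Q ^ 2 * (2 * 50 + 60) + 20 + 30
      ≤ κ * t * (Q * (κ * (Q ^ 2 * (460 + 35) + 60 * Q ^ 2) + 70 * (κ * Q ^ 2)) +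
          (κ * Q ^ 3) * (460 + 45) + 50 * (κ * Q ^ 3)) +
        κ * t * ((κ * Q ^ 3) * (2 * 50 + 60) + 50 * (κ * Q ^ 3)) := by
        rw [add_assoc _ 20 30, add_assoc _ _ (20 + 30)]
        have e8 : 1 ≤ κ * Q ^ 2 := Nat.mul_pos hK e2
        refine Nat.add_le_add (by gcongr <;> omega) ?_
        refine le_trans ?_ (Nat.le_mul_of_pos_left _ e5)
        omega
    _ = 1390 * (κ ^ 2 * (t * Q ^ 3)) := by ring
    _ ≤ 1390 * ((2 * W ^ 2) ^ 2 * (t * (8 * m))) := by gcongr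
    _ = _ := by ring

/-- In the application `X = 4 ^ k` and `W = 2 ^ lam k`. The term `tot` times the edges and their
copies dominates. -/
theorem roundTime_le_of_le {l b W X tot : ℕ} (hm : 0 < m) (hn : n ≤ m) (hX : 1 ≤ X) (hW : 1 ≤ W)
    (hk : k ≤ W) (hl : l ≤ 10 * W) (hb : b ≤ W) (htot : tot ≤ X * W ^ 10 * (2 * W)) :
    roundTime n m k l b tot + 5 ≤ 2000 * m * X * W ^ 12 := by
  have e2 : W ^ 3 ≤ X * W ^ 12 :=
    (Nat.pow_le_pow_right hW (by decide)).trans (Nat.le_mul_of_pos_left _ hX)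
  have e3 : 1 ≤ m * (X * W ^ 12) := Nat.mul_pos hm (Nat.mul_pos hX (Nat.pow_pos hW))
  have f1 : 1 ≤ W ^ 2 := Nat.one_le_pow _ _ hW
  have f2 : 1 ≤ W ^ 3 := Nat.one_le_pow _ _ hW
  have f3 : 1 ≤ m * W := Nat.mul_pos hm hW
  have f4 : n ≤ m * W := hn.trans (Nat.le_mul_of_pos_right _ hW)
  have f5 : l * 70 ≤ 700 * W ^ 2 :=
    calc l * 70 ≤ 10 * W * 70 * W := (Nat.mul_le_mul_right 70 hl).trans (Nat.le_mul_of_pos_right _ hW)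
      _ = _ := by ring
  have f6 : l * b * 15 ≤ 150 * W ^ 2 :=
    calc l * b * 15 ≤ 10 * W * W * 15 := Nat.mul_le_mul_right _ (Nat.mul_le_mul hl hb)
      _ = _ := by ring
  have f7 : k * (l * 70 + l * b * 15 + 80) + 110 ≤ 1040 * W ^ 3 :=
    calc k * (l * 70 + l * b * 15 + 80) + 110 ≤ W * (930 * W ^ 2) + 110 * W ^ 3 :=
          Nat.add_le_add (Nat.mul_le_mul hk (by omega)) (by omega)
      _ = _ := by ring
  have f8 : m * (k * 155 + 105) ≤ 260 * (m * W) :=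
    calc m * (k * 155 + 105) ≤ m * (260 * W) := Nat.mul_le_mul_left _ (by omega)
      _ = _ := by ring
  have f9 : tot * (n * 20 + m * (k * 155 + 105) + 80) ≤ 720 * (m * (X * W ^ 12)) :=
    calc tot * (n * 20 + m * (k * 155 + 105) + 80) ≤ X * W ^ 10 * (2 * W) * (360 * (m * W)) :=
          Nat.mul_le_mul htot (by omega)
      _ = _ := by ring
  have f10 : m * (k * (l * 70 + l * b * 15 + 80) + 110) ≤ 1040 * (m * (X * W ^ 12)) :=
    calc m * (k * (l * 70 + l * b * 15 + 80) + 110) ≤ m * (1040 * W ^ 3) :=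
          Nat.mul_le_mul_left _ f7
      _ ≤ m * (1040 * (X * W ^ 12)) := Nat.mul_le_mul_left _ (Nat.mul_le_mul_left _ e2)
      _ = _ := by ring
  rw [show 2000 * m * X * W ^ 12 = 2000 * (m * (X * W ^ 12)) by ring]
  have key {a b z : ℕ} (ha : a ≤ 1040 * z) (hb : b ≤ 720 * z) (hz : 1 ≤ z) :
      a + b + 80 + 5 ≤ 2000 * z := by omega
  exact key f10 f9 e3

theorem roundTime_le (hk : 2 ≤ k) (hm : 2 ≤ m) (hn : n ≤ m) {q : ℕ} (hq : q ≤ k) :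
    roundTime n m k (ell k) (blk k) (2 ^ (ell k * blk k + q) * (k + 1)) + 5 ≤
      2000 * m * 4 ^ k * (2 ^ lam k) ^ 12 := by
  obtain ⟨h1, h2, h3, h4, -, -⟩ := lam_bounds hk
  refine roundTime_le_of_le (by omega) hn (Nat.one_le_pow _ _ (by decide)) (by omega) h2 h3 h4 ?_
  refine Nat.mul_le_mul ?_ (by omega)
  rw [show 4 = 2 ^ 2 from rfl, ← pow_mul, ← pow_mul, ← pow_add]
  have := ell_mul_blk_le k
  exact Nat.pow_le_pow_right (by decide) (by omega)

theorem mainTime_le (hk : 2 ≤ k) (hm : 2 ≤ m) (hn : n ≤ m) {q : ℕ} (hq : q ≤ k) :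
    mainTime n m k q ≤ 5000 * (T m * m) * D k ^ ell k * 4 ^ k * (2 ^ lam k) ^ 14 := by
  have h := roundTime_le hk hm hn hq
  obtain ⟨h1, -, -, -, h5, -⟩ := lam_bounds hk
  have hT := T_pos hm
  have hK := K_pos hk
  have hD : 0 < D k ^ ell k := Nat.pow_pos (D_pos hk)
  have hX : 0 < 4 ^ k := by positivity
  have hm' : 0 < m := by omega
  unfold mainTime M
  set r := roundTime n m k (ell k) (blk k) (2 ^ (ell k * blk k + q) * (k + 1)) + 5
  generalize hδ : D k ^ ell k = δ at *
  generalize 4 ^ k = X at *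
  generalize hW : 2 ^ lam k = W at *
  generalize T m = t at *
  generalize K k = κ at *
  have e1 : 0 < δ * (m * X * W ^ 12) := by positivity
  have e2 : 0 < κ * t * (δ * (m * X * W ^ 12)) := by positivity
  calc κ * t * (δ * r + 10) + 10
      ≤ κ * t * (δ * (2000 * m * X * W ^ 12) + 10 * (δ * (m * X * W ^ 12))) +
        10 * (κ * t * (δ * (m * X * W ^ 12))) := by
        refine Nat.add_le_add (Nat.mul_le_mul_left _ (Nat.add_le_add (Nat.mul_le_mul_left _ h) ?_)) ?_
        · omega
        · omega
    _ = 2020 * (κ * (t * m * δ * X * W ^ 12)) := by ring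
    _ ≤ 2020 * (2 * W ^ 2 * (t * m * δ * X * W ^ 12)) :=
        Nat.mul_le_mul_left _ (Nat.mul_le_mul_right _ h5)
    _ = 4040 * (t * m * δ * X * W ^ 14) := by ring
    _ ≤ 5000 * (t * m * δ * X * W ^ 14) := Nat.mul_le_mul_right _ (by decide)
    _ = _ := by ring

theorem colorsTime_le_mul (hk : 2 ≤ k) :
    colorsTime k ≤ 1000 * (D k * blk k ^ 3 * Kc k ^ blk k) := by
  have hs := blk_pos k
  have hc := Kc_pos hk
  have hR := R_pos hk
  have hD : R k * Kc k ≤ D k := by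
    unfold D; rw [mul_comm]; exact Nat.mul_le_mul_right _ (Nat.le_succ _)
  unfold colorsTime greedyTime
  have hw : wtTime (blk k) + 45 ≤ 225 * blk k ^ 2 := by unfold wtTime; nlinarith
  have hP : 0 < Kc k ^ blk k := Nat.pow_pos hc
  generalize Kc k ^ blk k = P at *
  generalize wtTime (blk k) = w at *
  generalize blk k = s at *
  generalize D k = δ at *
  generalize Kc k = c at *
  generalize R k = r at *
  have hs1 : 1 ≤ s := hs
  have e1 : s * (P * (w + 35) + 60) + 70 ≤ 355 * (s ^ 3 * P) := by
    have f1 : P * (w + 35) ≤ P * (225 * s ^ 2) := Nat.mul_le_mul_left _ (by nlinarith)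
    have f2 : 1 ≤ P * s ^ 2 := Nat.mul_pos hP (Nat.pow_pos hs)
    have f3 : 1 ≤ s ^ 3 * P := Nat.mul_pos (Nat.pow_pos hs) hP
    calc s * (P * (w + 35) + 60) + 70 ≤ s * (P * (225 * s ^ 2) + 60 * (P * s ^ 2)) +
          70 * (s ^ 3 * P) := by
          refine Nat.add_le_add (Nat.mul_le_mul_left _ (Nat.add_le_add f1 ?_)) ?_ <;> omega
      _ = _ := by ring
  have e2 : 1 ≤ c * (s ^ 3 * P) := Nat.mul_pos hc (Nat.mul_pos (Nat.pow_pos hs) hP)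
  have e3 : P * (w + 45) ≤ 225 * (c * (s ^ 3 * P)) := by
    have f1 : s ^ 2 ≤ s ^ 3 := Nat.pow_le_pow_right hs1 (by decide)
    calc P * (w + 45) ≤ P * (225 * s ^ 3) := Nat.mul_le_mul_left _ (by omega)
      _ ≤ c * (P * (225 * s ^ 3)) := Nat.le_mul_of_pos_left _ hc
      _ = _ := by ring
  have e4 : c * (s * (P * (w + 35) + 60) + 70) ≤ 355 * (c * (s ^ 3 * P)) :=
    (Nat.mul_le_mul_left c e1).trans (le_of_eq (by ring))
  have e5 : r * (c * (s * (P * (w + 35) + 60) + 70) + P * (w + 45) + 50) ≤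
      630 * (r * (c * (s ^ 3 * P))) := by
    generalize c * (s ^ 3 * P) = X at *
    generalize c * (s * (P * (w + 35) + 60) + 70) = Y at *
    generalize P * (w + 45) = Z at *
    exact (Nat.mul_le_mul_left r (show Y + Z + 50 ≤ 630 * X by omega)).trans (le_of_eq (by ring))
  have e6 : P * (s * 50 + 60) ≤ 110 * (r * (c * (s ^ 3 * P))) := by
    have f1 : s ≤ s ^ 3 := Nat.le_self_pow (by decide) s
    calc P * (s * 50 + 60) ≤ P * (110 * s ^ 3) := Nat.mul_le_mul_left _ (by omega)
      _ ≤ c * (P * (110 * s ^ 3)) := Nat.le_mul_of_pos_left _ hc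
      _ ≤ r * (c * (P * (110 * s ^ 3))) := Nat.le_mul_of_pos_left _ hR
      _ = _ := by ring
  have e7 : s ≤ r * (c * (s ^ 3 * P)) :=
    calc s ≤ s ^ 3 := Nat.le_self_pow (by decide) s
      _ ≤ s ^ 3 * P := Nat.le_mul_of_pos_right _ hP
      _ ≤ c * (s ^ 3 * P) := Nat.le_mul_of_pos_left _ hc
      _ ≤ _ := Nat.le_mul_of_pos_left _ hR
  have e8 : r * (c * (s ^ 3 * P)) ≤ δ * s ^ 3 * P :=
    calc r * (c * (s ^ 3 * P)) = r * c * (s ^ 3 * P) := by ring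
      _ ≤ δ * (s ^ 3 * P) := Nat.mul_le_mul_right _ hD
      _ = _ := by ring
  have key {a b z y : ℕ} (ha : a ≤ 630 * z) (hb : b ≤ 110 * z) (hz : s ≤ z) (hy : z ≤ y) :
      s * 15 + (a + b + 20) + 40 ≤ 1000 * y := by omega
  exact key e5 e6 e7 e8

/-- Here `Kc ^ blk` contributes `2 ^ k` and the crude bound `exp (blk k) ≤ 2 ^ k * 2 ^ 2` another `2
^ k`; the exponent `33` is `18 + 2 + 3 + 10`. -/
theorem colorsTime_le (hk : 2 ≤ k) :
    (colorsTime k : ℝ) ≤ 1000 * (4 ^ k * (2 ^ lam k) ^ 33) := by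
  have h0 : (2 : ℝ) ≤ 2 ^ lam k := by exact_mod_cast (lam_bounds hk).1
  have h1 : (colorsTime k : ℝ) ≤ 1000 * (D k * blk k ^ 3 * Kc k ^ blk k) := by
    exact_mod_cast colorsTime_le_mul hk
  have h2 : (blk k : ℝ) ≤ 2 ^ lam k := by exact_mod_cast blk_le_two_pow hk
  have h3 : (Kc k : ℝ) ^ blk k ≤ 2 ^ k * (2 ^ lam k) ^ 10 := by
    have : Kc k ^ blk k ≤ 2 ^ k * (2 ^ lam k) ^ 10 := by
      refine (Kc_pow_le hk).trans ?_
      rw [← pow_mul, ← pow_add]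
      refine Nat.pow_le_pow_right (by decide) ?_
      have := ell_mul_blk_le k
      unfold ell at this
      omega
    exact_mod_cast this
  have h4 : Real.exp (blk k) ≤ 2 ^ k * (2 ^ lam k) ^ 2 := by
    refine (exp_le_four_pow _).trans ?_
    rw [show (4 : ℝ) = 2 ^ 2 by norm_num, ← pow_mul]
    calc (2 : ℝ) ^ (2 * blk k) ≤ 2 ^ (k + 2) := by
          have := blk_le hk
          exact pow_le_pow_right₀ (by norm_num) (by omega)
      _ = 2 ^ k * 2 ^ 2 := pow_add _ _ _
      _ ≤ _ := by gcongr
  set W : ℝ := 2 ^ lam k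
  calc (colorsTime k : ℝ) ≤ 1000 * (D k * blk k ^ 3 * Kc k ^ blk k) := h1
    _ ≤ 1000 * (W ^ 18 * (2 ^ k * W ^ 2) * W ^ 3 * (2 ^ k * W ^ 10)) := by
        gcongr
        exact (D_le hk).trans (by gcongr)
    _ = 1000 * ((2 * 2) ^ k * W ^ 33) := by rw [mul_pow]; ring
    _ = _ := by norm_num

/-- From `2 ^ T m ≤ 2 * m`; the summand `log 2` is absorbed as `m ≥ 2`. -/
theorem T_le_log (hm : 2 ≤ m) : (T m : ℝ) ≤ 4 * Real.log m := by
  have h1 : (2 : ℝ) ^ T m ≤ 2 * m := by exact_mod_cast two_pow_T_le hm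
  have hm' : (2 : ℝ) ≤ m := by exact_mod_cast hm
  have h2 := Real.log_le_log (by positivity) h1
  rw [Real.log_pow, Real.log_mul (by norm_num) (by positivity)] at h2
  have h3 := Real.log_le_log (by norm_num) hm'
  have h4 := Real.log_two_gt_d9
  have h5 : (0 : ℝ) ≤ T m := by positivity
  nlinarith

/-- The constant in the exponent of `k ^ (A * log k)`. -/
noncomputable def expConst : ℝ := 856 / Real.log 2

/-- `2 ^ lam k ≤ 2 * k ≤ k ^ 2` yields `lam k * log 2 ≤ 2 * log k`; squaring it accounts for `856 =
4 * 214`. -/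
theorem two_pow_lam_sq_le (hk : 2 ≤ k) :
    (2 : ℝ) ^ (214 * lam k ^ 2) ≤ (k : ℝ) ^ (expConst * Real.log k) := by
  have hk' : (2 : ℝ) ≤ k := by exact_mod_cast hk
  have h1 : (2 : ℝ) ^ lam k ≤ k ^ 2 := by
    have : (2 : ℝ) ^ lam k ≤ 2 * k := by exact_mod_cast two_pow_lam_le hk
    nlinarith
  have h2 := Real.log_le_log (by positivity) h1
  rw [Real.log_pow, Real.log_pow] at h2
  push_cast at h2
  have hlog : 0 < Real.log 2 := Real.log_pos (by norm_num)
  have h3 : ((lam k : ℝ) * Real.log 2) ^ 2 ≤ (2 * Real.log k) ^ 2 := by gcongr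
  rw [Real.rpow_def_of_pos (by linarith), ← Real.rpow_natCast, Real.rpow_def_of_pos (by norm_num)]
  apply Real.exp_le_exp.2
  push_cast
  unfold expConst
  rw [show Real.log k * (856 / Real.log 2 * Real.log k) = 214 * (2 * Real.log k) ^ 2 / Real.log 2 by
    ring, le_div_iff₀ hlog]
  linarith

theorem one_le_rpow_log (k : ℕ) : (1 : ℝ) ≤ (k : ℝ) ^ (expConst * Real.log k) := by
  have hlog : 0 < Real.log 2 := Real.log_pos (by norm_num)
  rcases Nat.eq_zero_or_pos k with rfl | hk
  · simp
  · have h1 : (1 : ℝ) ≤ k := by exact_mod_cast hk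
    refine Real.one_le_rpow h1 (mul_nonneg ?_ (Real.log_nonneg h1))
    unfold expConst
    positivity

/-- The main loop dominates: `W ^ 14` from a round and the hash functions and `W ^ 20` from the
number of colourings make `W ^ 34`, and `180 + 34 = 214`. The constant is `4 * 52500`, where `4`
comes from `T_le_log`. -/
theorem time_le (hk : 2 ≤ k) (hm : 2 ≤ m) (hn : n ≤ m) {q : ℕ} (hq : q ≤ k) :
    ((8 + (n * 30 + 60 + prepareTime n m k + hashesTime m k + colorsTime k + mainTime n m k q) :
      ℕ) : ℝ) ≤ 210000 * (Real.exp k * 4 ^ k * (k : ℝ) ^ (expConst * Real.log k) *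
        (m * Real.log m)) := by
  have h0 : (2 : ℝ) ≤ 2 ^ lam k := by exact_mod_cast (lam_bounds hk).1
  have h1 : (prepareTime n m k : ℝ) ≤ 900 * m * (2 ^ lam k) ^ 2 := by
    exact_mod_cast prepareTime_le hk hm hn
  have h2 : (hashesTime m k : ℝ) ≤ 44480 * (T m * m) * (2 ^ lam k) ^ 4 := by
    exact_mod_cast hashesTime_le hk hm
  have h3 := colorsTime_le hk
  have h4 : (mainTime n m k q : ℝ) ≤
      5000 * (T m * m) * D k ^ ell k * 4 ^ k * (2 ^ lam k) ^ 14 := by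
    exact_mod_cast mainTime_le hk hm hn hq
  have h5 := D_pow_le hk
  have h6 : (n : ℝ) ≤ m := by exact_mod_cast hn
  have h7 : (1 : ℝ) ≤ T m := by exact_mod_cast T_pos hm
  have h8 : (2 : ℝ) ≤ m := by exact_mod_cast hm
  have h9 : (1 : ℝ) ≤ 4 ^ k := one_le_pow₀ (by norm_num)
  have h10 : (1 : ℝ) ≤ Real.exp k := Real.one_le_exp (by positivity)
  have h11 : (1 : ℝ) ≤ 2 ^ (180 * lam k ^ 2) := one_le_pow₀ (by norm_num)
  have h12 : (2 : ℝ) ^ (180 * lam k ^ 2) * (2 ^ lam k) ^ 34 ≤ (k : ℝ) ^ (expConst * Real.log k) := by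
    refine le_trans ?_ (two_pow_lam_sq_le hk)
    rw [← pow_mul, ← pow_add]
    refine pow_le_pow_right₀ (by norm_num) ?_
    have := Nat.le_self_pow (n := 2) (by decide) (lam k)
    omega
  have h13 := T_le_log hm
  set W : ℝ := 2 ^ lam k
  set E : ℝ := 2 ^ (180 * lam k ^ 2)
  have hW1 : 1 ≤ W := by linarith
  set Z : ℝ := T m * m * Real.exp k * 4 ^ k * (E * W ^ 34) with hZ
  have hTm : (m : ℝ) ≤ T m * m := le_mul_of_one_le_left (by positivity) h7
  have hEW : 1 ≤ E * W ^ 34 := one_le_mul_of_one_le_of_one_le h11 (one_le_pow₀ hW1)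
  -- All four phases are compared with the single quantity `Z`, which has the largest power of `W`
  -- among them.
  have hbase {x y : ℝ} {i : ℕ} (hi : i ≤ 34) (hx : 0 ≤ x)
      (hxy : x ≤ T m * m * Real.exp k * 4 ^ k) : x * W ^ i ≤ Z := by
    rw [hZ]
    have : W ^ i ≤ E * W ^ 34 :=
      (pow_le_pow_right₀ hW1 hi).trans (le_mul_of_one_le_left (by positivity) h11)
    gcongr
  have hXY : 1 ≤ Real.exp k * 4 ^ k := one_le_mul_of_one_le_of_one_le h10 h9
  have b0 : (m : ℝ) ≤ T m * m * Real.exp k * 4 ^ k := by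
    rw [mul_assoc]
    exact hTm.trans (le_mul_of_one_le_right (by positivity) hXY)
  have b1 : (T m * m : ℝ) ≤ T m * m * Real.exp k * 4 ^ k := by
    rw [mul_assoc (_ * _)]
    exact le_mul_of_one_le_right (by positivity) hXY
  have b2 : (4 : ℝ) ^ k ≤ T m * m * Real.exp k * 4 ^ k :=
    le_mul_of_one_le_left (by positivity)
      (one_le_mul_of_one_le_of_one_le (one_le_mul_of_one_le_of_one_le h7 (by linarith)) h10)
  have c0 : (m : ℝ) ≤ Z := by simpa using hbase (y := 0) (i := 0) (by decide) (by positivity) b0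
  have c1 : (prepareTime n m k : ℝ) ≤ 900 * Z := by
    have := hbase (y := 0) (i := 2) (by decide) (by positivity) b0
    linarith
  have c2 : (hashesTime m k : ℝ) ≤ 44480 * Z := by
    have := hbase (y := 0) (i := 4) (by decide) (by positivity) b1
    linarith
  have c3 : (colorsTime k : ℝ) ≤ 1000 * Z := by
    have := hbase (y := 0) (i := 33) (by decide) (by positivity) b2
    linarith
  have c4 : (mainTime n m k q : ℝ) ≤ 5000 * Z :=
    calc (mainTime n m k q : ℝ) ≤ 5000 * (T m * m) * D k ^ ell k * 4 ^ k * W ^ 14 := h4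
      _ ≤ 5000 * (T m * m) * (E * W ^ 20 * Real.exp k) * 4 ^ k * W ^ 14 := by gcongr
      _ = 5000 * Z := by rw [hZ]; ring
  push_cast
  calc (8 : ℝ) + (n * 30 + 60 + prepareTime n m k + hashesTime m k + colorsTime k +
        mainTime n m k q) ≤ 52500 * Z := by linarith
    _ ≤ 52500 * (4 * Real.log m * m * Real.exp k * 4 ^ k * (k : ℝ) ^ (expConst * Real.log k)) := by
        rw [hZ]; gcongr
    _ = _ := by ring

theorem short_time_le (hm : 2 ≤ m) (hn : n ≤ m) :
    ((8 + (n * 30 + 60) : ℕ) : ℝ) ≤ 210000 * (Real.exp k * 4 ^ k *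
      (k : ℝ) ^ (expConst * Real.log k) * (m * Real.log m)) := by
  have h6 : (n : ℝ) ≤ m := by exact_mod_cast hn
  have h8 : (2 : ℝ) ≤ m := by exact_mod_cast hm
  have h9 : (1 : ℝ) ≤ 4 ^ k := one_le_pow₀ (by norm_num)
  have h10 : (1 : ℝ) ≤ Real.exp k := Real.one_le_exp (by positivity)
  have h3 := Real.log_le_log (by norm_num) h8
  have h4 := Real.log_two_gt_d9
  have h5 : (1 : ℝ) ≤ Real.exp k * 4 ^ k * (k : ℝ) ^ (expConst * Real.log k) :=
    one_le_mul_of_one_le_of_one_le (one_le_mul_of_one_le_of_one_le h10 h9) (one_le_rpow_log k)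
  have h7 : (m : ℝ) * (1 / 2) ≤ m * Real.log m := by gcongr; linarith
  have h11 : (m : ℝ) * Real.log m ≤ Real.exp k * 4 ^ k *
      (k : ℝ) ^ (expConst * Real.log k) * (m * Real.log m) :=
    le_mul_of_one_le_left (by nlinarith) h5
  push_cast
  linarith

end LoopLang

/-- One program decides, for every strongly connected instance with at least two waypoints and
every `k`, whether there is a solution with at most `k` edge occurrences, in time
`O(e ^ k * 4 ^ k * k ^ (A * log k) * m * log m)`. If all numbers of the input have at most `L` bits,
then words of `B * (k + L)` bits suffice. -/
theorem theorem1 :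
    ∃ (P : WordRAM.Program) (A C : ℝ) (B : ℕ), 0 < B ∧
      ∀ (I : DWRP) (k : ℕ), I.StronglyConnected → 2 ≤ I.waypoints.card →
        ∀ L : ℕ, (∀ x ∈ I.encode k, x < 2 ^ L) → ∀ w : ℕ, B * (k + L) ≤ w →
          ∃ (t : ℕ) (τ : WordRAM.State),
            WordRAM.Exec w P (WordRAM.initial (I.encode k)) t τ ∧
            (I.HasSolutionOfSize k → τ.reg 0 = 1) ∧
            (¬ I.HasSolutionOfSize k → τ.reg 0 = 0) ∧
            (t : ℝ) ≤ C * (Real.exp k * 4 ^ k * (k : ℝ) ^ (A * Real.log k)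
              * (I.m * Real.log I.m)) := by
  refine ⟨.seq LoopLang.loadLength (LoopLang.decideCmd.compile 81), LoopLang.expConst, 210000, 1004,
    by decide, ?_⟩
  intro I k hcon hW L hL w hw
  have hn2 : 2 ≤ I.n := by
    have := Finset.card_le_univ I.waypoints
    simp at this
    omega
  have hnm := hcon.n_le_m hn2
  have hm2 : 2 ≤ I.m := hn2.trans hnm
  have hn : I.n < 2 ^ L := hL _ (by simp [DWRP.encode])
  have hm : I.m < 2 ^ L := hL _ (by simp [DWRP.encode])
  have hk : k < 2 ^ L := hL _ (by simp [DWRP.encode])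
  have hb : I.budget < 2 ^ L := hL _ (by simp [DWRP.encode])
  have hwt (e) : I.weight e < 2 ^ L := hL _ (by
    simp only [DWRP.encode, List.mem_append, List.mem_flatten, List.mem_ofFn]
    exact Or.inl (Or.inr ⟨_, ⟨e, rfl⟩, by simp⟩))
  have hL1 : 1 < L := by
    by_contra! h
    have : 2 ^ L ≤ 2 ^ 1 := Nat.pow_le_pow_right (by decide) h
    omega
  have hlen := I.length_encode k
  set V := 2 ^ (1000 * (k + L)) with hV
  have h16 : 16 ≤ V :=
    calc 16 = 2 ^ 4 := rfl
      _ ≤ V := Nat.pow_le_pow_right (by decide) (by omega)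
  have hLV : 2 ^ L * 16 ≤ V :=
    calc 2 ^ L * 16 = 2 ^ (L + 4) := by rw [pow_add]; norm_num
      _ ≤ V := Nat.pow_le_pow_right (by decide) (by omega)
  -- The factor `16` of the translation takes four more bits; hence `1004` instead of `1000`.
  have hwV : 16 * V ≤ 2 ^ w :=
    calc 16 * V = 2 ^ (4 + 1000 * (k + L)) := by rw [pow_add, ← hV]; norm_num
      _ ≤ 2 ^ w := Nat.pow_le_pow_right (by decide) (by omega)
  have hlenV : (I.encode k).length < V := by omega
  have hin := I.encodes k
  have h0 : (LoopLang.St.initial (I.encode k)).Has [(.q, 0), (.out, 0)] := by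
    simp [LoopLang.St.Has, LoopLang.St.initial]
  have run {t : ℕ} {post : LoopLang.St → Prop} (h : LoopLang.Spec V (I.encode k).length
      LoopLang.decideCmd t (LoopLang.St.initial (I.encode k)) post) :
      ∃ (t' : ℕ) (τ : WordRAM.State) (ρ : LoopLang.St),
        WordRAM.Exec w (.seq LoopLang.loadLength (LoopLang.decideCmd.compile 81))
          (WordRAM.initial (I.encode k)) t' τ ∧ t' ≤ 8 + t ∧ τ.reg 0 = ρ.reg .out ∧ post ρ := by
    obtain ⟨τ, hτ, hτ'⟩ := LoopLang.exec_initial h16 hlenV.le hwV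
      (fun x hx => (hL x hx).trans_le (by omega))
      (by rw [hlen, show (I.encode k).getD 1 0 = I.m from rfl,
        show (I.encode k).getD 0 0 = I.n from rfl]) (by decide) h.1
    exact ⟨_, τ, _, hτ, Nat.add_le_add_left h.2.1 8, hτ', h.2.2⟩
  -- In the second case `k` is at least the number of waypoints and thus at least two, as the
  -- estimates require.
  rcases lt_or_ge k I.waypoints.card with hq | hq
  · obtain ⟨t, τ, ρ, h1, h2, h3, h4⟩ :=
      run (LoopLang.spec_decideCmd_of_lt hin h0 hlen.ge hlenV hq)
    exact ⟨t, τ, h1, fun h => absurd (h.card_waypoints_le hW) (by omega), fun _ => by rw [h3, h4],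
      (Nat.cast_le.2 h2).trans (LoopLang.short_time_le hm2 hnm)⟩
  · obtain ⟨t, τ, ρ, h1, h2, h3, h4⟩ := run (LoopLang.spec_decideCmd hin h0 (by omega) hm2
      (LoopLang.algorithmSmall (by omega) hm2 hn hm hk hb hwt hq hlen) hq
      (Finset.card_pos.1 (by omega)))
    exact ⟨t, τ, h1, fun h => h3.trans (h4.1 h), fun h => h3.trans (h4.2 h),
      (Nat.cast_le.2 h2).trans (LoopLang.time_le (by omega) hm2 hnm hq)⟩
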